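/- **Setting.** Let $n,k\ge 0$, $T\in\,]0,+\infty[$, $x^0\in\mathbb R^n$, let $f,g_1,\dots,g_k:\mathbb R^n\to\mathbb R^n$ be locally Lipschitz, and write $G(x)u=\sum_{i=1}^k u_i\,g_i(x)$. Norms are Euclidean, and absolute continuity on $[0,+\infty[$ is understood on compact subintervals. **Space-time curves.** Let $\mathcal Y_{m,T}$ be the set of absolutely continuous $(\theta,y):[0,+\infty[\,\to\mathbb R^{1+m}$ with $\theta(0)=0$, $\dot\theta\ge 0$ a.e., $\int_0^\infty|(\dot\theta,\dot y)|\,dt=+\infty$ and $\theta(+\infty)>T$. Put $\theta^\#(T)=\sup\{s\ge 0:\theta(s)\le T\}$ and let $(\theta_T,y_T)(t)=(\theta,y)(\min\{t,\theta^\#(T)\})$ be the parameterization of the segment of the curve in $[0,T]\times\mathbb R^m$. Let $\mathcal T$ be the set of increasing absolutely continuous bijections of $[0,+\infty[$ with absolutely continuous inverse, and put $$d_T\big((\theta,y),(\tilde\theta,\tilde y)\big)=\inf_{\alpha\in\mathcal T}\big\|(\theta_T,y_T)-(\tilde\theta_T,\tilde y_T)\circ\alpha\big\|_{L_\infty[0,+\infty[}.$$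 Two elements of $\mathcal Y_{m,T}$ are identified if their segments in $[0,T]\times\mathbb R^m$ are the same Fréchet curve, i.e. if $d_T=0$. The set of classes $[(\theta,y)]$ is $\mathcal F_{m,T}$; it carries the strengthened Fréchet metric $$d_T^+\big([(\theta,y)],[(\tilde\theta,\tilde y)]\big)=d_T\big((\theta,y),(\tilde\theta,\tilde y)\big)+\left|\int_0^{\theta^\#(T)}|(\dot\theta,\dot y)|\,dt-\int_0^{\tilde\theta^\#(T)}|(\dot{\tilde\theta},\dot{\tilde y})|\,dt\right|.$$ The space of Fréchet generalized controls is $\mathcal F^0_{k,T}=\{[(V,W)]\in\mathcal F_{k,T}:W(0)=0\}$ with the metric $d_T^+$. **Trajectories.** For a representative $(V,W)$ of a generalized control put $(v,w)=(\dot V,\dot W)$, and let $y_{(v,w)}$ be the absolutely continuous solution of $$\dot y=f(y)\,v+G(y)\,w\quad\text{a.e.},\qquad y(0)=x^0 .$$ If it exists on all of $[0,V^\#(T)]$, then $[(V,y_{(v,w)})]\in\mathcal F_{n,T}$ denotes the class of the curve with segment $(V,y_{(v,w)})|_{[0,V^\#(T)]}$ in $[0,T]\times\mathbb R^n$. Let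 $\mathcal W_T\subset\mathcal F^0_{k,T}$ be the set of generalized controls for which this generalized trajectory is defined on $[0,T]$, i.e. $y_{(v,w)}$ exists on $[0,V^\#(T)]$ for some representative $(V,W)$. The (ordinary) input-to-trajectory map sends $[(t,U)]$, where $u:[0,+\infty[\,\to\mathbb R^k$ is locally integrable and $U(t)=\int_0^t u(s)\,ds$, to $[(t,x_u)]\in\mathcal F_{n,T}$, where $x_u$ is the trajectory of $\dot x=f(x)+G(x)u$, $x(0)=x^0$; its domain consists of the $[(t,U)]$ for which $x_u$ is defined on $[0,T]$. **Theorem.** 1. $\mathcal W_T$ is an open subset of $(\mathcal F^0_{k,T},d_T^+)$. 2. The map $\Phi:\mathcal W_T\to\mathcal F_{n,T}$, $[(V,W)]\mapsto[(V,y_{(v,w)})]$, is well defined: for $[(V,W)]\in\mathcal W_T$ and every representative $(V,W)$ the solution $y_{(v,w)}$ exists on $[0,V^\#(T)]$, and the class $[(V,y_{(v,w)})]$ does not depend on the representative. The domain of the input-to-trajectory map is contained in $\mathcal W_T$, and $\Phi$ extends the input-to-trajectory map. $\Phi$ is continuous with respect to $d_T^+$ on the domain and on the image, and it is the only map $\mathcal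 W_T\to\mathcal F_{n,T}$ that extends the input-to-trajectory map and is continuous in this sense. -/

import Mathlib

open MeasureTheory Set Filter Topology
open scoped ENNReal

noncomputable section

namespace FrechetCurves

/-- The Euclidean space `ℝⁿ`. -/
abbrev Space (n : ℕ) := EuclideanSpace ℝ (Fin n)

/-- Space-time `ℝ^{1+n}` with its Euclidean norm; `p.fst` is the time coordinate and `p.snd` the
space coordinate. -/
abbrev SpaceTime (n : ℕ) := WithLp 2 (ℝ × Space n)

/-! ### Absolutely continuous functions on `[0, +∞[` -/

/-- Absolute continuity on `[0, +∞[` in the local sense (on every compact `[0, b]`), as needed for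
curves of infinite length. Functions on `[0, +∞[` are represented by functions on `ℝ` whose values
at negative arguments are irrelevant. -/
def LocallyAC {E : Type*} [PseudoMetricSpace E] (g : ℝ → E) : Prop :=
  ∀ b : ℝ, 0 ≤ b → AbsolutelyContinuousOnInterval g 0 b

/-- Monotonically increasing absolutely continuous bijections `[0, +∞[ → [0, +∞[` with absolutely
continuous inverse. -/
def IsReparam (α : ℝ → ℝ) : Prop :=
  MonotoneOn α (Ici 0) ∧ BijOn α (Ici 0) (Ici 0) ∧ LocallyAC α ∧
    ∃ β : ℝ → ℝ, InvOn β α (Ici 0) (Ici 0) ∧ MapsTo β (Ici 0) (Ici 0) ∧ LocallyAC β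

/-- The Fréchet distance `inf_α ‖g₁ - g₂ ∘ α‖_{L_∞[0, +∞[}` (an element of `[0, +∞]`); for
continuous functions the `L_∞` norm is the supremum. -/
def frechetDist {E : Type*} [PseudoMetricSpace E] (g₁ g₂ : ℝ → E) : ℝ≥0∞ :=
  ⨅ (α : ℝ → ℝ) (_ : IsReparam α), ⨆ (t : ℝ) (_ : 0 ≤ t), edist (g₁ t) (g₂ (α t))

theorem isReparam_id : IsReparam (fun t => t) := by
  have h : LocallyAC (fun t : ℝ => t) := fun b _ =>
    (LipschitzWith.id.lipschitzOnWith (s := uIcc 0 b)).absolutelyContinuousOnInterval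
  exact ⟨fun _ _ _ _ h => h, bijOn_id _, h, fun t => t, ⟨fun _ _ => rfl, fun _ _ => rfl⟩,
    fun _ h => h, h⟩

theorem absolutelyContinuousOnInterval_comp {E : Type*} [PseudoMetricSpace E] {g : ℝ → E}
    {φ : ℝ → ℝ} {b c : ℝ} (hb : 0 ≤ b) (hc : 0 ≤ c) (hg : AbsolutelyContinuousOnInterval g 0 c)
    (hφ : AbsolutelyContinuousOnInterval φ 0 b) (hm : MonotoneOn φ (Icc 0 b))
    (hmaps : MapsTo φ (Icc 0 b) (Icc 0 c)) :
    AbsolutelyContinuousOnInterval (fun t => g (φ t)) 0 b := by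
  rw [absolutelyContinuousOnInterval_iff] at hg hφ ⊢
  intro ε hε
  obtain ⟨δ, hδ, H⟩ := hg ε hε
  obtain ⟨η, hη, K⟩ := hφ δ hδ
  refine ⟨η, hη, fun E hE hEη => ?_⟩
  refine H (E.1, fun i => (φ (E.2 i).1, φ (E.2 i).2)) ⟨?_, ?_⟩ (K E hE hEη)
  · intro i hi
    obtain ⟨h1, h2⟩ := hE.1 i hi
    rw [uIcc_of_le hb] at h1 h2
    rw [uIcc_of_le hc]
    exact ⟨hmaps h1, hmaps h2⟩
  · intro i hi j hj hij
    have hd := hE.2 hi hj hij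
    obtain ⟨hi1, hi2⟩ := hE.1 i hi
    obtain ⟨hj1, hj2⟩ := hE.1 j hj
    rw [uIcc_of_le hb] at hi1 hi2 hj1 hj2
    simp only [Function.onFun] at hd ⊢
    have key : ∀ x ∈ Icc 0 b, ∀ y ∈ Icc 0 b, x ≤ y → φ x ≤ φ y :=
      fun x hx y hy => hm hx hy
    generalize (E.2 i).1 = a at *
    generalize (E.2 i).2 = r at *
    generalize (E.2 j).1 = p at *
    generalize (E.2 j).2 = q at *
    rw [Set.disjoint_left]
    intro z hz hz'
    have hex : max (min a r) (min p q) < min (max a r) (max p q) := by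
      by_contra hcon
      push Not at hcon
      simp only [uIoc, mem_Ioc] at hz hz'
      rcases le_total a r with h1 | h1 <;> rcases le_total p q with h2 | h2 <;>
        simp only [h1, h2, key _ hi1 _ hi2, key _ hi2 _ hi1, key _ hj1 _ hj2, key _ hj2 _ hj1,
          min_eq_left, min_eq_right, max_eq_left, max_eq_right] at hz hz' hcon <;>
        rcases min_le_iff.1 hcon with h3 | h3 <;> rcases le_max_iff.1 h3 with h4 | h4 <;>
        first
        | (have := key _ hi1 _ hi2 h4; linarith)
        | (have := key _ hi2 _ hi1 h4; linarith)
        | (have := key _ hi1 _ hj1 h4; linarith)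
        | (have := key _ hi1 _ hj2 h4; linarith)
        | (have := key _ hi2 _ hj1 h4; linarith)
        | (have := key _ hi2 _ hj2 h4; linarith)
        | (have := key _ hj1 _ hi1 h4; linarith)
        | (have := key _ hj1 _ hi2 h4; linarith)
        | (have := key _ hj2 _ hi1 h4; linarith)
        | (have := key _ hj2 _ hi2 h4; linarith)
        | (have := key _ hj1 _ hj2 h4; linarith)
        | (have := key _ hj2 _ hj1 h4; linarith)
    exact Set.disjoint_left.1 hd (show min (max a r) (max p q) ∈ uIoc a r from
      ⟨lt_of_le_of_lt (le_max_left _ _) hex, min_le_left _ _⟩)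
      ⟨lt_of_le_of_lt (le_max_right _ _) hex, min_le_right _ _⟩

theorem LocallyAC.comp_monotone {E : Type*} [PseudoMetricSpace E] {g : ℝ → E} {φ : ℝ → ℝ}
    (hg : LocallyAC g) (hφ : LocallyAC φ) (hm : MonotoneOn φ (Ici 0))
    (hmaps : MapsTo φ (Ici 0) (Ici 0)) : LocallyAC (fun t => g (φ t)) := fun b hb =>
  absolutelyContinuousOnInterval_comp hb (hmaps hb) (hg _ (hmaps hb)) (hφ b hb)
    (hm.mono Icc_subset_Ici_self)
    fun _ hx => ⟨hmaps hx.1, hm hx.1 hb hx.2⟩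

theorem IsReparam.comp {α β : ℝ → ℝ} (hα : IsReparam α) (hβ : IsReparam β) :
    IsReparam (fun t => β (α t)) := by
  obtain ⟨ma, ba, aca, α', ⟨la, ra⟩, mpa, aca'⟩ := hα
  obtain ⟨mb, bb, acb, β', ⟨lb, rb⟩, mpb, acb'⟩ := hβ
  have mono' : MonotoneOn β' (Ici 0) := by
    intro x hx y hy hxy
    by_contra hcon
    push Not at hcon
    have h1 := mb (mpb hy) (mpb hx) hcon.le
    rw [rb hx, rb hy] at h1
    have : x = y := le_antisymm hxy h1
    simp [this] at hcon
  refine ⟨fun x hx y hy hxy => mb (ba.mapsTo hx) (ba.mapsTo hy) (ma hx hy hxy), bb.comp ba,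
    acb.comp_monotone aca ma ba.mapsTo, fun t => α' (β' t), ⟨fun x hx => ?_, fun x hx => ?_⟩,
    fun x hx => mpa (mpb hx), aca'.comp_monotone acb' mono' mpb⟩
  · show α' (β' (β (α x))) = x
    rw [lb (ba.mapsTo hx), la hx]
  · show β (α (α' (β' x))) = x
    rw [ra (mpb hx), rb hx]

theorem IsReparam.exists_inv {α : ℝ → ℝ} (hα : IsReparam α) :
    ∃ β, IsReparam β ∧ InvOn β α (Ici 0) (Ici 0) := by
  obtain ⟨ma, ba, aca, β, ⟨la, ra⟩, mpa, aca'⟩ := hα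
  refine ⟨β, ⟨?_, ?_, aca', α, ⟨ra, la⟩, ba.mapsTo, aca⟩, ⟨la, ra⟩⟩
  · intro x hx y hy hxy
    by_contra hcon
    push Not at hcon
    have h1 := ma (mpa hy) (mpa hx) hcon.le
    rw [ra hx, ra hy] at h1
    have : x = y := le_antisymm hxy h1
    simp [this] at hcon
  · exact (InvOn.symm ⟨la, ra⟩).bijOn mpa ba.mapsTo

section frechetDist

variable {E : Type*} [PseudoMetricSpace E]

theorem frechetDist_self (g : ℝ → E) : frechetDist g g = 0 := by
  refine le_antisymm (iInf₂_le_of_le _ isReparam_id ?_) zero_le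
  simp

theorem frechetDist_comm_le (g h : ℝ → E) : frechetDist g h ≤ frechetDist h g := by
  refine le_iInf₂ fun α hα => ?_
  obtain ⟨β, hβ, hinv⟩ := hα.exists_inv
  refine iInf₂_le_of_le β hβ (iSup₂_le fun t ht => ?_)
  have h0 : 0 ≤ β t := hβ.2.1.mapsTo ht
  refine le_trans ?_ (le_iSup₂ (f := fun (s : ℝ) (_ : 0 ≤ s) => edist (h s) (g (α s))) (β t) h0)
  rw [hinv.2 ht, edist_comm]

theorem frechetDist_comm (g h : ℝ → E) : frechetDist g h = frechetDist h g :=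
  le_antisymm (frechetDist_comm_le g h) (frechetDist_comm_le h g)

theorem frechetDist_triangle (g₁ g₂ g₃ : ℝ → E) :
    frechetDist g₁ g₃ ≤ frechetDist g₁ g₂ + frechetDist g₂ g₃ := by
  simp only [frechetDist]
  rw [ENNReal.iInf_add]
  refine le_iInf fun α => ?_
  rw [ENNReal.iInf_add]
  refine le_iInf fun hα => ?_
  rw [ENNReal.add_iInf]
  refine le_iInf fun β => ?_
  rw [ENNReal.add_iInf]
  refine le_iInf fun hβ => ?_
  refine iInf₂_le_of_le _ (hα.comp hβ) (iSup₂_le fun t ht => ?_)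
  refine (edist_triangle _ (g₂ (α t)) _).trans (add_le_add ?_ ?_)
  · exact le_iSup₂ (f := fun (s : ℝ) (_ : 0 ≤ s) => edist (g₁ s) (g₂ (α s))) t ht
  · exact le_iSup₂ (f := fun (s : ℝ) (_ : 0 ≤ s) => edist (g₂ s) (g₃ (β s))) (α t)
      (hα.2.1.mapsTo ht)

/-- The total variation does not increase under uniform limits of reparameterizations. -/
theorem eVariationOn_le_of_frechetDist_eq_zero {g h : ℝ → E} (H : frechetDist g h = 0) :
    eVariationOn g (Ici 0) ≤ eVariationOn h (Ici 0) := by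
  have hex : ∀ n : ℕ, ∃ α, IsReparam α ∧
      ∀ t, 0 ≤ t → edist (g t) (h (α t)) ≤ ((n : ℝ≥0∞) + 1)⁻¹ := by
    intro n
    have hpos : frechetDist g h < ((n : ℝ≥0∞) + 1)⁻¹ := by
      rw [H]; simp
    obtain ⟨α, hα, hlt⟩ : ∃ α, ∃ (_ : IsReparam α),
        (⨆ (t : ℝ) (_ : 0 ≤ t), edist (g t) (h (α t))) < ((n : ℝ≥0∞) + 1)⁻¹ := by
      simpa only [frechetDist, iInf_lt_iff] using hpos
    exact ⟨α, hα, fun t ht => (le_iSup₂ (f := fun (s : ℝ) (_ : 0 ≤ s) =>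
      edist (g s) (h (α s))) t ht).trans hlt.le⟩
  choose α hα hle using hex
  have hvar : ∀ n, eVariationOn (fun t => h (α n t)) (Ici 0) = eVariationOn h (Ici 0) := by
    intro n
    have := eVariationOn.comp_eq_of_monotoneOn h (α n) (hα n).1
    rw [(hα n).2.1.image_eq] at this
    exact this
  by_contra hcon
  push Not at hcon
  have hlim : ∀ x ∈ Ici (0 : ℝ), Tendsto (fun n => h (α n x)) atTop (𝓝 (g x)) := by
    intro x hx
    rw [EMetric.tendsto_atTop]
    intro ε hε
    obtain ⟨N, hN⟩ := ENNReal.exists_inv_nat_lt hε.ne'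
    refine ⟨N, fun n hn => ?_⟩
    rw [edist_comm]
    refine lt_of_le_of_lt (hle n x hx) (lt_of_le_of_lt ?_ hN)
    rw [ENNReal.inv_le_inv]
    calc (N : ℝ≥0∞) ≤ n := by exact_mod_cast hn
      _ ≤ n + 1 := le_self_add
  have := eVariationOn.lowerSemicontinuous_aux hlim hcon
  obtain ⟨n, hn⟩ := this.exists
  rw [hvar n] at hn
  exact lt_irrefl _ hn

end frechetDist

/-! ### Length -/

section length

variable {E : Type*} [NormedAddCommGroup E] [NormedSpace ℝ E] [FiniteDimensional ℝ E]

/-- For an absolutely continuous curve, the integral of the speed is the total variation. -/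
theorem integral_norm_deriv_eq_variation {g : ℝ → E} {S : ℝ} (hS : 0 ≤ S)
    (hg : AbsolutelyContinuousOnInterval g 0 S) :
    ∫ t in (0 : ℝ)..S, ‖deriv g t‖ = (eVariationOn g (Icc 0 S)).toReal := by
  have hbv := hg.boundedVariationOn
  rw [uIcc_of_le hS] at hbv
  have h0 : (0 : ℝ) ∈ Icc 0 S := ⟨le_rfl, hS⟩
  have hSm : S ∈ Icc 0 S := ⟨hS, le_rfl⟩
  have hlbv := hbv.locallyBoundedVariationOn
  set v : ℝ → ℝ := variationOnFromTo g (Icc 0 S) 0 with hv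
  have hvm : MonotoneOn v (Icc 0 S) := variationOnFromTo.monotoneOn hlbv h0
  have hvm' : MonotoneOn v (uIcc 0 S) := by rwa [uIcc_of_le hS]
  have hv0 : v 0 = 0 := variationOnFromTo.self _ _ _
  have hvS : v S = (eVariationOn g (Icc 0 S)).toReal := by
    rw [hv, variationOnFromTo.eq_of_le _ _ hS, inter_self]
  have hdist : ∀ x ∈ Icc 0 S, ∀ y ∈ Icc 0 S, dist (g x) (g y) ≤ |v x - v y| := by
    have aux : ∀ x ∈ Icc 0 S, ∀ y ∈ Icc 0 S, x ≤ y → dist (g x) (g y) ≤ v y - v x := by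
      intro x hx y hy hxy
      rw [hv, variationOnFromTo.sub_right hlbv h0 hy hx, variationOnFromTo.eq_of_le _ _ hxy,
        dist_edist]
      refine ENNReal.toReal_mono (hlbv x y hx hy) (eVariationOn.edist_le g ?_ ?_)
      · exact ⟨hx, le_rfl, hxy⟩
      · exact ⟨hy, hxy, le_rfl⟩
    intro x hx y hy
    rcases le_total x y with h | h
    · exact (aux x hx y hy h).trans (by rw [abs_sub_comm]; exact le_abs_self _)
    · rw [dist_comm]; exact (aux y hy x hx h).trans (le_abs_self _)
  have hgd : ∀ᵐ x, x ∈ uIcc 0 S → DifferentiableAt ℝ g x :=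
    hg.boundedVariationOn.ae_differentiableAt_of_mem_uIcc
  have hvd : ∀ᵐ x, x ∈ Icc 0 S → DifferentiableWithinAt ℝ v (Icc 0 S) x :=
    hvm.ae_differentiableWithinAt_of_mem
  have hne0 : ∀ᵐ x : ℝ, x ≠ 0 := by simp [ae_iff, measure_singleton]
  have hneS : ∀ᵐ x : ℝ, x ≠ S := by simp [ae_iff, measure_singleton]
  have hle : ∀ᵐ x, x ∈ uIoc 0 S → ‖deriv g x‖ ≤ deriv v x := by
    filter_upwards [hgd, hvd, hne0, hneS] with x h1 h2 h3 h4 h5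
    rw [uIoc_of_le hS] at h5
    have hx : x ∈ Icc 0 S := ⟨h5.1.le, h5.2⟩
    have hnhds : Icc 0 S ∈ 𝓝 x := Icc_mem_nhds h5.1 (lt_of_le_of_ne h5.2 h4)
    have hg' := (h1 (by rwa [uIcc_of_le hS])).hasDerivAt
    have hv' := ((h2 hx).differentiableAt hnhds).hasDerivAt
    have hpos : 0 ≤ deriv v x := by
      rw [← derivWithin_of_mem_nhds hnhds]
      exact hvm.derivWithin_nonneg
    rw [hasDerivAt_iff_tendsto_slope] at hg' hv'
    have hle := le_of_tendsto_of_tendsto hg'.norm hv'.norm ?_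
    · rwa [Real.norm_of_nonneg hpos] at hle
    · filter_upwards [mem_nhdsWithin_of_mem_nhds hnhds] with y hy
      rw [slope_def_module, slope_def_module, norm_smul, norm_smul]
      refine mul_le_mul_of_nonneg_left ?_ (norm_nonneg _)
      rw [← dist_eq_norm, Real.norm_eq_abs]
      exact hdist y hy x hx
  have hvi : IntervalIntegrable (deriv v) volume 0 S := hvm'.intervalIntegrable_deriv
  have hgi : IntervalIntegrable (deriv g) volume 0 S := by
    refine hvi.mono_fun (aestronglyMeasurable_deriv g _) ?_
    rw [EventuallyLE, ae_restrict_iff' measurableSet_uIoc]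
    filter_upwards [hle] with x hx hx'
    exact (hx hx').trans (le_abs_self _)
  apply le_antisymm
  · have h1 : ∫ t in (0 : ℝ)..S, ‖deriv g t‖ ≤ ∫ t in (0 : ℝ)..S, deriv v t := by
      rw [intervalIntegral.integral_of_le hS, intervalIntegral.integral_of_le hS]
      rw [uIoc_of_le hS] at hle
      refine integral_mono_ae hgi.norm.1 hvi.1 ?_
      rw [EventuallyLE, ae_restrict_iff' measurableSet_Ioc]
      exact hle
    have h2 := hvm'.intervalIntegral_deriv_mem_uIcc
    rw [uIcc_of_le (by rw [sub_nonneg]; exact hvm h0 hSm hS)] at h2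
    calc _ ≤ _ := h1
      _ ≤ _ := h2.2
      _ = _ := by rw [hv0, hvS, sub_zero]
  · set L : ℝ → ℝ := fun t => ∫ s in (0 : ℝ)..t, ‖deriv g s‖ with hL
    have hint : ∀ x ∈ Icc 0 S, ∀ y ∈ Icc 0 S, IntervalIntegrable (deriv g) volume x y := by
      intro x hx y hy
      refine hgi.mono_set ?_
      rw [uIcc_of_le hS]
      exact Set.OrdConnected.uIcc_subset ordConnected_Icc hx hy
    have hPac : AbsolutelyContinuousOnInterval (fun t => ∫ s in (0 : ℝ)..t, deriv g s) 0 S := by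
      have hLac := hgi.norm.absolutelyContinuousOnInterval_intervalIntegral (c := 0)
        (by simp)
      rw [absolutelyContinuousOnInterval_iff] at hLac ⊢
      intro ε hε
      obtain ⟨δ, hδ, H⟩ := hLac ε hε
      refine ⟨δ, hδ, fun E hE hEδ => lt_of_le_of_lt (Finset.sum_le_sum fun i hi => ?_)
        (H E hE hEδ)⟩
      obtain ⟨h1, h2⟩ := hE.1 i hi
      rw [uIcc_of_le hS] at h1 h2
      rw [dist_eq_norm, dist_eq_norm,
        intervalIntegral.integral_interval_sub_left (hint _ h0 _ h1) (hint _ h0 _ h2),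
        intervalIntegral.integral_interval_sub_left (hint _ h0 _ h1).norm (hint _ h0 _ h2).norm]
      exact intervalIntegral.norm_integral_le_abs_integral_norm
    have hconst := (hg.sub hPac).const_of_ae_hasDerivAt_zero (by
      filter_upwards [hgd, hgi.ae_hasDerivAt_integral] with x h1 h2 h3
      have := (h1 h3).hasDerivAt.sub (h2 h3 0 (by simp))
      rwa [sub_self] at this)
    obtain ⟨C, hC⟩ := hconst
    rw [uIcc_of_le hS] at hC
    have hFTC : ∀ x ∈ Icc 0 S, ∀ y ∈ Icc 0 S, g y - g x = ∫ s in x..y, deriv g s := by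
      intro x hx y hy
      have e1 := hC x hx
      have e2 := hC y hy
      simp only [Pi.sub_apply] at e1 e2
      rw [← intervalIntegral.integral_interval_sub_left (hint _ h0 _ hy) (hint _ h0 _ hx)]
      rw [← e2] at e1
      rw [sub_eq_sub_iff_sub_eq_sub] at e1
      rw [← neg_sub (g x), e1, neg_sub]
    have hLdist : ∀ x ∈ Icc 0 S, ∀ y ∈ Icc 0 S, edist (g x) (g y) ≤ edist (L x) (L y) := by
      intro x hx y hy
      rw [edist_dist, edist_dist]
      refine ENNReal.ofReal_le_ofReal ?_
      rw [dist_eq_norm, dist_eq_norm, hFTC y hy x hx, hL]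
      simp only
      rw [intervalIntegral.integral_interval_sub_left (hint _ h0 _ hx).norm (hint _ h0 _ hy).norm]
      exact intervalIntegral.norm_integral_le_abs_integral_norm
    have hLmono : MonotoneOn L (Icc 0 S) := by
      intro x hx y hy hxy
      have : 0 ≤ L y - L x := by
        rw [hL]; simp only
        rw [intervalIntegral.integral_interval_sub_left (hint _ h0 _ hy).norm
          (hint _ h0 _ hx).norm]
        exact intervalIntegral.integral_nonneg hxy fun _ _ => norm_nonneg _
      linarith
    have hvar : eVariationOn g (Icc 0 S) ≤ eVariationOn L (Icc 0 S) := by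
      refine iSup_le fun p => ?_
      refine le_trans (Finset.sum_le_sum fun i _ => ?_) (eVariationOn.sum_le p.2.2.1 p.2.2.2)
      exact hLdist _ (p.2.2.2 _) _ (p.2.2.2 _)
    have h3 := (hLmono.eVariationOn_eq h0 hSm).le
    rw [inter_self] at h3
    have hL0 : L 0 = 0 := by simp [hL]
    rw [hL0, sub_zero] at h3
    refine ENNReal.toReal_le_of_le_ofReal ?_ (hvar.trans h3)
    exact intervalIntegral.integral_nonneg hS fun _ _ => norm_nonneg _

end length

/-! ### Space-time curves -/

/-- Parameterizations `(θ, y) : [0, +∞[ → ℝ^{1+n}` of space-time curves that are defined on the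
compact time interval `[0, T]`: absolutely continuous, with `θ(0) = 0`, `θ̇ ≥ 0` a.e., infinite
length, and `θ(+∞) > T`. -/
structure SpaceTimeCurve (n : ℕ) (T : ℝ) where
  toFun : ℝ → SpaceTime n
  locallyAC : LocallyAC toFun
  time_zero : (toFun 0).fst = 0
  deriv_time_nonneg : ∀ᵐ t ∂volume.restrict (Ici (0 : ℝ)), 0 ≤ deriv (fun s => (toFun s).fst) t
  infinite_length : ∫⁻ t in Ici (0 : ℝ), ‖deriv toFun t‖ₑ = ⊤
  exists_gt : ∃ t : ℝ, 0 ≤ t ∧ T < (toFun t).fst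

namespace SpaceTimeCurve

variable {n : ℕ} {T : ℝ}

/-- `θ^#(T) = sup {s ≥ 0 : θ(s) ≤ T}`. -/
def exitParam (g : SpaceTimeCurve n T) : ℝ :=
  sSup {s : ℝ | 0 ≤ s ∧ (g.toFun s).fst ≤ T}

/-- The truncated parameterization `(θ_T, y_T)`, which stops at the parameter `θ^#(T)`. It
parameterizes the segment of the curve in `[0, T] × ℝⁿ`. -/
def trunc (g : SpaceTimeCurve n T) : ℝ → SpaceTime n :=
  fun t => g.toFun (min t g.exitParam)

/-- The length `ℓ_{(θ, y)}(θ^#(T))` of the segment of the curve in `[0, T] × ℝⁿ`. -/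
def length (g : SpaceTimeCurve n T) : ℝ :=
  ∫ t in (0 : ℝ)..g.exitParam, ‖deriv g.toFun t‖

/-- `d_T`: the Fréchet distance between the segments in `[0, T] × ℝⁿ`. -/
def dT (g h : SpaceTimeCurve n T) : ℝ := (frechetDist g.trunc h.trunc).toReal

/-- `d_T^+`: the strengthened Fréchet distance between the segments in `[0, T] × ℝⁿ`. -/
def dTplus (g h : SpaceTimeCurve n T) : ℝ := dT g h + |g.length - h.length|

theorem exitParam_nonneg (g : SpaceTimeCurve n T) : 0 ≤ g.exitParam :=
  Real.sSup_nonneg fun _ hs => hs.1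

theorem min_mem (g : SpaceTimeCurve n T) {t : ℝ} (ht : 0 ≤ t) :
    min t g.exitParam ∈ Icc 0 g.exitParam :=
  ⟨le_min ht g.exitParam_nonneg, min_le_right _ _⟩

theorem frechetDist_ne_top (g h : SpaceTimeCurve n T) : frechetDist g.trunc h.trunc ≠ ⊤ := by
  obtain ⟨C, hC⟩ := (g.locallyAC _ g.exitParam_nonneg).exists_bound
  obtain ⟨D, hD⟩ := (h.locallyAC _ h.exitParam_nonneg).exists_bound
  rw [uIcc_of_le g.exitParam_nonneg] at hC
  rw [uIcc_of_le h.exitParam_nonneg] at hD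
  refine ne_top_of_le_ne_top (ENNReal.ofReal_ne_top (r := C + D))
    (iInf₂_le_of_le _ isReparam_id (iSup₂_le fun t ht => ?_))
  rw [edist_dist]
  refine ENNReal.ofReal_le_ofReal ?_
  rw [dist_eq_norm]
  exact (norm_sub_le _ _).trans (add_le_add (hC _ (g.min_mem ht)) (hD _ (h.min_mem ht)))

theorem length_eq_variation (g : SpaceTimeCurve n T) :
    g.length = (eVariationOn g.trunc (Ici 0)).toReal := by
  have hmono : MonotoneOn (fun t : ℝ => min t g.exitParam) (Ici 0) :=
    fun _ _ _ _ h => min_le_min_right _ h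
  have himg : (fun t : ℝ => min t g.exitParam) '' Ici 0 = Icc 0 g.exitParam := by
    ext x
    constructor
    · rintro ⟨t, ht, rfl⟩
      exact g.min_mem ht
    · intro hx
      exact ⟨x, hx.1, min_eq_left hx.2⟩
  have h := eVariationOn.comp_eq_of_monotoneOn g.toFun _ hmono
  rw [himg] at h
  rw [length, integral_norm_deriv_eq_variation g.exitParam_nonneg
    (g.locallyAC _ g.exitParam_nonneg), ← h]
  rfl

theorem length_eq_of_frechetDist_eq_zero {g h : SpaceTimeCurve n T}
    (H : frechetDist g.trunc h.trunc = 0) : g.length = h.length := by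
  rw [length_eq_variation, length_eq_variation]
  congr 1
  exact le_antisymm (eVariationOn_le_of_frechetDist_eq_zero H)
    (eVariationOn_le_of_frechetDist_eq_zero (by rwa [frechetDist_comm]))

theorem dT_comm (g h : SpaceTimeCurve n T) : dT g h = dT h g := by rw [dT, frechetDist_comm, dT]

theorem dT_triangle (g₁ g₂ g₃ : SpaceTimeCurve n T) : dT g₁ g₃ ≤ dT g₁ g₂ + dT g₂ g₃ := by
  rw [dT, dT, dT, ← ENNReal.toReal_add (frechetDist_ne_top _ _) (frechetDist_ne_top _ _)]
  exact ENNReal.toReal_mono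
    (ENNReal.add_ne_top.2 ⟨frechetDist_ne_top _ _, frechetDist_ne_top _ _⟩)
    (frechetDist_triangle _ _ _)

theorem dT_nonneg (g h : SpaceTimeCurve n T) : 0 ≤ dT g h := ENNReal.toReal_nonneg

theorem dTplus_triangle (g₁ g₂ g₃ : SpaceTimeCurve n T) :
    dTplus g₁ g₃ ≤ dTplus g₁ g₂ + dTplus g₂ g₃ := by
  have h1 := dT_triangle g₁ g₂ g₃
  have h2 := abs_sub_le g₁.length g₂.length g₃.length
  simp only [dTplus]
  linarith

theorem dTplus_comm (g h : SpaceTimeCurve n T) : dTplus g h = dTplus h g := by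
  rw [dTplus, dTplus, dT_comm, abs_sub_comm]

/-- Two parameterizations are identified if their segments in `[0, T] × ℝⁿ` are the same Fréchet
curve. -/
instance setoid (n : ℕ) (T : ℝ) : Setoid (SpaceTimeCurve n T) where
  r g h := frechetDist g.trunc h.trunc = 0
  iseqv :=
    { refl := fun g => frechetDist_self _
      symm := fun {g h} H => by rwa [frechetDist_comm]
      trans := fun {g₁ g₂ g₃} H₁ H₂ => le_antisymm
        ((frechetDist_triangle _ g₂.trunc _).trans (by rw [H₁, H₂, add_zero])) zero_le }

theorem dTplus_eq_zero {g h : SpaceTimeCurve n T} : dTplus g h = 0 ↔ g ≈ h := by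
  constructor
  · intro H
    have h1 := dT_nonneg g h
    have h2 := abs_nonneg (g.length - h.length)
    have h3 : dT g h = 0 := by simp only [dTplus] at H; linarith
    rcases (ENNReal.toReal_eq_zero_iff _).1 h3 with h0 | h0
    · exact h0
    · exact absurd h0 (frechetDist_ne_top _ _)
  · intro H
    have H' : frechetDist g.trunc h.trunc = 0 := H
    rw [dTplus, length_eq_of_frechetDist_eq_zero H', dT, H']
    simp

end SpaceTimeCurve

/-- `𝓕_{n,T}`: Fréchet curves in space-time `ℝ^{1+n}` that are defined on the time interval
`[0, T]`, each identified with its segment in `[0, T] × ℝⁿ`. -/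
def FrechetSpace (n : ℕ) (T : ℝ) : Type := Quotient (SpaceTimeCurve.setoid n T)

/-- The class `[(θ, y)]`. -/
def SpaceTimeCurve.cls {n : ℕ} {T : ℝ} (g : SpaceTimeCurve n T) : FrechetSpace n T :=
  Quotient.mk (SpaceTimeCurve.setoid n T) g

/-- `𝓕_{n,T}` carries the strengthened Fréchet metric `d_T^+`. -/
instance (n : ℕ) (T : ℝ) : MetricSpace (FrechetSpace n T) where
  dist := Quotient.lift₂ SpaceTimeCurve.dTplus (by
    intro a₁ b₁ a₂ b₂ h₁ h₂
    have h₁' := SpaceTimeCurve.dTplus_eq_zero.2 h₁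
    have h₂' := SpaceTimeCurve.dTplus_eq_zero.2 h₂
    have t1 := SpaceTimeCurve.dTplus_triangle a₁ a₂ b₁
    have t2 := SpaceTimeCurve.dTplus_triangle a₂ b₂ b₁
    have t3 := SpaceTimeCurve.dTplus_triangle a₂ a₁ b₂
    have t4 := SpaceTimeCurve.dTplus_triangle a₁ b₁ b₂
    have c1 := SpaceTimeCurve.dTplus_comm a₁ a₂
    have c2 := SpaceTimeCurve.dTplus_comm b₁ b₂
    linarith)
  dist_self := by
    rintro ⟨g⟩
    exact SpaceTimeCurve.dTplus_eq_zero.2 (Setoid.refl g)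
  dist_comm := by
    rintro ⟨g⟩ ⟨h⟩
    exact SpaceTimeCurve.dTplus_comm g h
  dist_triangle := by
    rintro ⟨g₁⟩ ⟨g₂⟩ ⟨g₃⟩
    exact SpaceTimeCurve.dTplus_triangle g₁ g₂ g₃
  eq_of_dist_eq_zero := by
    rintro ⟨g⟩ ⟨h⟩ H
    exact Quotient.sound (SpaceTimeCurve.dTplus_eq_zero.1 H)

theorem dist_cls {n : ℕ} {T : ℝ} (g h : SpaceTimeCurve n T) :
    dist g.cls h.cls = SpaceTimeCurve.dT g h + |g.length - h.length| := rfl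

/-- `𝓕⁰_{k,T}`: the Fréchet generalized controls `[(V, W)] ∈ 𝓕_{k,T}`, `W(0) = 0`, with the metric
`d_T^+` inherited from `𝓕_{k,T}`. -/
def GeneralizedControl (k : ℕ) (T : ℝ) : Set (FrechetSpace k T) :=
  {c | ∃ g : SpaceTimeCurve k T, g.cls = c ∧ (g.toFun 0).snd = 0}

/-! ### Graphs -/

section graph

variable {n : ℕ}

/-- The graph parameterization `t ↦ (t, x(t))`. -/
def graphFun (x : ℝ → Space n) : ℝ → SpaceTime n := fun t => WithLp.toLp 2 (t, x t)

theorem locallyAC_graphFun {x : ℝ → Space n} (hx : LocallyAC x) : LocallyAC (graphFun x) := by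
  intro b hb
  have h1 := isReparam_id.2.2.1 b hb
  have h2 := hx b hb
  refine squeeze_zero (fun E => Finset.sum_nonneg fun _ _ => dist_nonneg) (fun E => ?_)
    (by simpa using Tendsto.add h1 h2)
  rw [← Finset.sum_add_distrib]
  refine Finset.sum_le_sum fun i _ => ?_
  simp only [graphFun]
  rw [WithLp.prod_dist_eq_of_L2]
  refine Real.sqrt_le_iff.2 ⟨by positivity, ?_⟩
  have e1 : 0 ≤ dist (E.2 i).1 (E.2 i).2 := dist_nonneg
  have e2 : 0 ≤ dist (x (E.2 i).1) (x (E.2 i).2) := dist_nonneg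
  show dist (E.2 i).1 (E.2 i).2 ^ 2 + dist (x (E.2 i).1) (x (E.2 i).2) ^ 2 ≤ _
  nlinarith [mul_nonneg e1 e2]

theorem ae_differentiableAt_of_locallyAC {E : Type*} [NormedAddCommGroup E] [NormedSpace ℝ E]
    [FiniteDimensional ℝ E] {g : ℝ → E} (hg : LocallyAC g) :
    ∀ᵐ t ∂volume.restrict (Ici (0 : ℝ)), DifferentiableAt ℝ g t := by
  rw [ae_restrict_iff' measurableSet_Ici]
  have : ∀ m : ℕ, ∀ᵐ x, x ∈ uIcc (0 : ℝ) m → DifferentiableAt ℝ g x := fun m =>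
    (hg m m.cast_nonneg).boundedVariationOn.ae_differentiableAt_of_mem_uIcc
  filter_upwards [ae_all_iff.2 this] with x hx hx0
  obtain ⟨m, hm⟩ := exists_nat_ge x
  exact hx m (by rw [uIcc_of_le m.cast_nonneg]; exact ⟨hx0, hm⟩)

/-- The space-time curve `(t, x(t))`. -/
def graphCurve (T : ℝ) (x : ℝ → Space n) (hx : LocallyAC x) : SpaceTimeCurve n T where
  toFun := graphFun x
  locallyAC := locallyAC_graphFun hx
  time_zero := rfl
  deriv_time_nonneg := by
    refine Eventually.of_forall fun t => ?_
    show 0 ≤ deriv (fun s : ℝ => s) t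
    simp
  infinite_length := by
    have hae : ∀ᵐ t ∂volume.restrict (Ici (0 : ℝ)), (1 : ℝ≥0∞) ≤ ‖deriv (graphFun x) t‖ₑ := by
      filter_upwards [ae_differentiableAt_of_locallyAC (locallyAC_graphFun hx)] with t ht
      have hd : HasDerivAt (fun s => (WithLp.fstL 2 ℝ ℝ (Space n)) (graphFun x s))
          ((WithLp.fstL 2 ℝ ℝ (Space n)) (deriv (graphFun x) t)) t :=
        (WithLp.fstL 2 ℝ ℝ (Space n)).hasFDerivAt.comp_hasDerivAt t ht.hasDerivAt
      have h1 : (deriv (graphFun x) t).fst = 1 := hd.unique (hasDerivAt_id t)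
      have h2 : ‖(deriv (graphFun x) t).fst‖ ≤ ‖deriv (graphFun x) t‖ := by
        rw [WithLp.prod_norm_eq_of_L2]
        exact Real.le_sqrt_of_sq_le (le_add_of_nonneg_right (sq_nonneg _))
      rw [h1, norm_one] at h2
      rw [← ofReal_norm]
      simpa using ENNReal.ofReal_le_ofReal h2
    refine top_unique ?_
    calc (⊤ : ℝ≥0∞) = ∫⁻ t in Ici (0 : ℝ), 1 := by simp
      _ ≤ _ := lintegral_mono_ae hae
  exists_gt := ⟨|T| + 1, by positivity, lt_of_le_of_lt (le_abs_self T) (lt_add_one _)⟩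

theorem locallyAC_primitive {u : ℝ → Space n} (hu : LocallyIntegrableOn u (Ici 0)) :
    LocallyAC (fun t => ∫ s in (0 : ℝ)..t, u s) := by
  intro b hb
  have hint : ∀ x ∈ uIcc 0 b, IntervalIntegrable u volume 0 x := by
    intro x hx
    rw [uIcc_of_le hb] at hx
    rw [intervalIntegrable_iff_integrableOn_Icc_of_le hx.1]
    exact hu.integrableOn_compact_subset (fun y hy => hy.1) isCompact_Icc
  have hLac := (hint b (by simp)).norm.absolutelyContinuousOnInterval_intervalIntegral (c := 0)
    (by simp)
  rw [absolutelyContinuousOnInterval_iff] at hLac ⊢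
  intro ε hε
  obtain ⟨δ, hδ, H⟩ := hLac ε hε
  refine ⟨δ, hδ, fun E hE hEδ => lt_of_le_of_lt (Finset.sum_le_sum fun i hi => ?_) (H E hE hEδ)⟩
  obtain ⟨h1, h2⟩ := hE.1 i hi
  rw [dist_eq_norm, dist_eq_norm,
    intervalIntegral.integral_interval_sub_left (hint _ h1) (hint _ h2),
    intervalIntegral.integral_interval_sub_left (hint _ h1).norm (hint _ h2).norm]
  exact intervalIntegral.norm_integral_le_abs_integral_norm

theorem locallyAC_stop {T : ℝ} (hT : 0 ≤ T) {x : ℝ → Space n}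
    (hx : AbsolutelyContinuousOnInterval x 0 T) : LocallyAC (fun t => x (min t T)) := by
  have hproj : ∀ b, AbsolutelyContinuousOnInterval (fun t : ℝ => min t T) 0 b := fun b =>
    ((LipschitzWith.id.min_const T).lipschitzOnWith (s := uIcc 0 b)).absolutelyContinuousOnInterval
  exact fun b hb => absolutelyContinuousOnInterval_comp hb hT hx (hproj b)
    (fun _ _ _ _ h => min_le_min_right _ h) fun t ht => ⟨le_min ht.1 hT, min_le_right _ _⟩

end graph

/-! ### The control system `ẋ = f(x) + ∑ᵢ gᵢ(x) uᵢ`, `x(0) = x⁰` -/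

section system

variable {n k : ℕ} {T : ℝ}

/-- The ordinary control `u`, as the generalized control `[(t, U)]` with `U(t) = ∫₀ᵗ u`. -/
def ordinaryControl (T : ℝ) (u : ℝ → Space k) (hu : LocallyIntegrableOn u (Ici 0)) :
    GeneralizedControl k T :=
  ⟨(graphCurve T _ (locallyAC_primitive hu)).cls, _, rfl, by
    show (∫ s in (0 : ℝ)..0, u s) = 0
    simp⟩

/-- The ordinary path `x ∈ AC[0, T]`, as the element `[(t, x)]` of `𝓕_{n,T}`. Only the segment in
`[0, T] × ℝⁿ` matters, and `x` is continued by a constant beyond `T`. -/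
def ordinaryPath (hT : 0 ≤ T) (x : ℝ → Space n) (hx : AbsolutelyContinuousOnInterval x 0 T) :
    FrechetSpace n T :=
  (graphCurve T _ (locallyAC_stop hT hx)).cls

/-- `x(0) = x⁰` and `ẋ(t) = f(x(t)) + G(x(t)) u(t)` for a.e. `t ∈ [0, T]`; the columns of `G` are
the vector fields `g₁, …, g_k`. -/
def IsTrajectory (f : Space n → Space n) (G : Fin k → Space n → Space n) (x₀ : Space n) (T : ℝ)
    (u : ℝ → Space k) (x : ℝ → Space n) : Prop :=
  x 0 = x₀ ∧ ∀ᵐ t ∂volume.restrict (Icc 0 T),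
    HasDerivAt x (f (x t) + ∑ i, u t i • G i (x t)) t

/-- `y` solves the reparameterized system `ẏ = f(y) v + G(y) w`, `y(0) = x⁰`, on
`[0, V^#(T)]`, where `(v, w)` is the derivative of the parameterization `(V, W)`. -/
def IsReducedTrajectory (f : Space n → Space n) (G : Fin k → Space n → Space n) (x₀ : Space n)
    (g : SpaceTimeCurve k T) (y : ℝ → Space n) : Prop :=
  AbsolutelyContinuousOnInterval y 0 g.exitParam ∧ y 0 = x₀ ∧
    ∀ᵐ t ∂volume.restrict (Icc 0 g.exitParam),
      HasDerivAt y (deriv (fun s => (g.toFun s).fst) t • f (y t) +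
        ∑ i, deriv (fun s => (g.toFun s).snd) t i • G i (y t)) t

/-- For `g = (V, W)`: the curve `h` is `(V, y_{(v, w)})` on the parameter interval `[0, V^#(T)]`, and
its segment in `[0, T] × ℝⁿ` is parameterized by that interval. In particular the solution
`y_{(v, w)}` exists on all of `[0, V^#(T)]`. -/
def IsGeneralizedTrajectory (f : Space n → Space n) (G : Fin k → Space n → Space n)
    (x₀ : Space n) (g : SpaceTimeCurve k T) (h : SpaceTimeCurve n T) : Prop :=
  h.exitParam = g.exitParam ∧
    (∀ t ∈ Icc 0 g.exitParam, (h.toFun t).fst = (g.toFun t).fst) ∧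
    IsReducedTrajectory f G x₀ g (fun t => (h.toFun t).snd)

/-- `𝓦_T`: the generalized controls whose generalized trajectory is well defined on `[0, T]`. -/
def admissibleControls (f : Space n → Space n) (G : Fin k → Space n → Space n) (x₀ : Space n)
    (T : ℝ) : Set (GeneralizedControl k T) :=
  {c | ∃ (g : SpaceTimeCurve k T) (h : SpaceTimeCurve n T),
    g.cls = c.1 ∧ IsGeneralizedTrajectory f G x₀ g h}

/-- `Φ : D → 𝓕_{n,T}` extends the input-to-trajectory map `[(t, U)] ↦ [(t, x_u)]`: for each ordinary
control `u` whose trajectory `x = x_u` is defined on `[0, T]`, `[(t, U)]` lies in `D` and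
`Φ([(t, U)]) = [(t, x_u)]`. -/
def ExtendsInputToTrajectory (f : Space n → Space n) (G : Fin k → Space n → Space n)
    (x₀ : Space n) (hT : 0 ≤ T) (D : Set (GeneralizedControl k T)) (Φ : D → FrechetSpace n T) :
    Prop :=
  ∀ (u : ℝ → Space k) (hu : LocallyIntegrableOn u (Ici 0)) (x : ℝ → Space n)
    (hx : AbsolutelyContinuousOnInterval x 0 T), IsTrajectory f G x₀ T u x →
    ∃ hD : ordinaryControl T u hu ∈ D, Φ ⟨_, hD⟩ = ordinaryPath hT x hx

end system

end FrechetCurves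

end

open FrechetCurves

/-!
The theorem rests on the parameterization of curves by arc length. For a space-time curve `g` let
`ĝ = g.natParam` be the segment of `g` in `[0, T] × ℝᵐ`, parameterized by its arc length and
extended by constants; it is 1-Lipschitz, and `g.trunc = ĝ ∘ s` for the arc length `s = g.arc`.

*Convergence of curves.* If `gⱼ → g` in `d_T^+`, there are reparameterizations `αⱼ` such that `gⱼ
∘ αⱼ → g` uniformly, and the lengths converge. The variation is lower semicontinuous, and this
applies to both `[0, t]` and `[t, ∞[`; as the total lengths converge, neither part can lose length
in the limit. Hence `sⱼ(αⱼ(t)) → s(t)`, and `ĝⱼ → ĝ` pointwise up to the length of `g`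
(`tendsto_natParam`). Then also `ĝⱼ + ĝ → 2ĝ`, so that by lower semicontinuity `∫ ‖ĝⱼ' + ĝ'‖` is
asymptotically at least twice the length of `g`, although both velocities lie in the unit ball.
The parallelogram law turns this into `∫ ‖ĝⱼ' - ĝ'‖ → 0` (`tendsto_integral_deriv_natParam`). This
strong convergence of the controls is what the length term in `d_T^+` provides.

*Equations.* The reduced system is an equation `ẏ = F(y) ġ` with a field `F` of linear maps
(`systemField`). It is carried from `g` to `ĝ` and back by the estimate `y(b) - y(a) - F(y(a))
(g(b) - g(a)) = O((s(b) - s(a))²)`, which does not depend on the parameterization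
(`IncrementEstimate`). Along `ĝ`, for globally Lipschitz `F`, solutions exist by Picard iteration
and depend on the driving velocity in `L¹` by Gronwall's lemma (`Solves.dist_le_of_lipschitz`). If
`F` is only locally Lipschitz, it is modified outside a ball that contains the solution along the
limit curve in its interior; solutions along nearby curves remain in this ball
(`exists_solves_tendsto`). This proves that the set of admissible controls is open. It also gives
uniform convergence of `(V̂ⱼ, ŷⱼ)` and convergence of the velocities in `L¹`, hence convergence of
the generalized trajectories in `d_T^+` (`IsGeneralizedTrajectory.tendsto`); the passage back from
natural parameterizations to the Fréchet distance is `frechetDist_comp_arc_le`. For constant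
sequences the same statements say that the trajectory exists for every representative and that its
class does not depend on the representative.

*Uniqueness of the extension.* Ordinary controls are dense: on the segment of `(V, W)` the time
`V` is replaced by a strictly increasing function close to it (`exists_ordinaryControl_dist_le`).
As the domain is open, a continuous map on it is determined by its values at ordinary controls,
and there every admissible control has a trajectory in the ordinary sense.
-/

namespace FrechetCurves

/-! ### Absolutely continuous functions with values in a finite-dimensional space -/

section AbsolutelyContinuous

theorem absolutelyContinuousOnInterval_of_dist_le {X Y : Type*} [PseudoMetricSpace X]
    [PseudoMetricSpace Y] {y : ℝ → X} {s : ℝ → Y} {C a b : ℝ}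
    (hs : AbsolutelyContinuousOnInterval s a b)
    (h : ∀ p ∈ uIcc a b, ∀ q ∈ uIcc a b, dist (y p) (y q) ≤ C * dist (s p) (s q)) :
    AbsolutelyContinuousOnInterval y a b := by
  have h2 : Tendsto (fun E : ℕ × (ℕ → ℝ × ℝ) => C * ∑ i ∈ Finset.range E.1,
      dist (s (E.2 i).1) (s (E.2 i).2))
      (AbsolutelyContinuousOnInterval.totalLengthFilter ⊓
        𝓟 (AbsolutelyContinuousOnInterval.disjWithin a b)) (𝓝 0) := by
    simpa using Tendsto.const_mul C hs
  refine squeeze_zero' (Eventually.of_forall fun E => Finset.sum_nonneg fun _ _ => dist_nonneg)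
    ?_ h2
  filter_upwards [mem_inf_of_right (mem_principal_self _)] with E hE
  rw [Finset.mul_sum]
  exact Finset.sum_le_sum fun i hi => h _ (hE.1 i hi).1 _ (hE.1 i hi).2

theorem locallyAC_min_const (S : ℝ) : LocallyAC fun t : ℝ => min t S := fun b _ =>
  ((LipschitzWith.id.min_const S).lipschitzOnWith (s := uIcc 0 b)).absolutelyContinuousOnInterval

variable {E : Type*} [NormedAddCommGroup E] [NormedSpace ℝ E]

theorem absolutelyContinuousOnInterval_primitive {u : ℝ → E} {S : ℝ}
    (hu : IntervalIntegrable u volume 0 S) :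
    AbsolutelyContinuousOnInterval (fun t => ∫ r in (0 : ℝ)..t, u r) 0 S := by
  have hint : ∀ x ∈ uIcc 0 S, IntervalIntegrable u volume 0 x := fun x hx =>
    hu.mono_set (uIcc_subset_uIcc_left hx)
  refine absolutelyContinuousOnInterval_of_dist_le (C := 1)
    (hu.norm.absolutelyContinuousOnInterval_intervalIntegral (c := 0) (by simp)) ?_
  intro p hp q hq
  rw [one_mul, dist_eq_norm, dist_eq_norm,
    intervalIntegral.integral_interval_sub_left (hint _ hp) (hint _ hq),
    intervalIntegral.integral_interval_sub_left (hint _ hp).norm (hint _ hq).norm]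
  exact intervalIntegral.norm_integral_le_abs_integral_norm

variable [FiniteDimensional ℝ E] {g : ℝ → E} {S : ℝ}

theorem ae_differentiableAt_of_absolutelyContinuousOnInterval
    (hg : AbsolutelyContinuousOnInterval g 0 S) :
    ∀ᵐ t, t ∈ uIcc 0 S → DifferentiableAt ℝ g t :=
  hg.boundedVariationOn.ae_differentiableAt_of_mem_uIcc

theorem intervalIntegrable_deriv (hS : 0 ≤ S) (hg : AbsolutelyContinuousOnInterval g 0 S) :
    IntervalIntegrable (deriv g) volume 0 S := by
  suffices h : IntervalIntegrable (fun t => ‖deriv g t‖) volume 0 S by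
    rw [intervalIntegrable_iff] at h ⊢
    exact (integrable_norm_iff (aestronglyMeasurable_deriv g _)).1 h
  by_contra hcon
  -- otherwise the integral has the junk value `0`, so that `g` has variation `0`
  have h0 := integral_norm_deriv_eq_variation hS hg
  rw [intervalIntegral.integral_undef hcon, eq_comm, ENNReal.toReal_eq_zero_iff] at h0
  have hbv := hg.boundedVariationOn
  rw [uIcc_of_le hS] at hbv
  rcases h0 with h0 | h0
  swap
  · exact hbv h0
  have hconst : ∀ t ∈ Ioo 0 S, deriv g t = 0 := by
    intro t ht
    have : g =ᶠ[𝓝 t] fun _ => g t := by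
      filter_upwards [Icc_mem_nhds ht.1 ht.2] with r hr
      have := (eVariationOn.eq_zero_iff g).1 h0 r hr t (Ioo_subset_Icc_self ht)
      exact edist_eq_zero.1 this
    rw [this.deriv_eq, deriv_const]
  refine hcon ?_
  refine (intervalIntegrable_const (c := (0 : ℝ))).congr_ae ?_
  rw [uIoc_of_le hS, ← restrict_Ioo_eq_restrict_Ioc, EventuallyEq,
    ae_restrict_iff' measurableSet_Ioo]
  exact Eventually.of_forall fun t ht => by simp [hconst t ht]

theorem integral_deriv_eq_sub (hS : 0 ≤ S) (hg : AbsolutelyContinuousOnInterval g 0 S) {a b : ℝ}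
    (ha : a ∈ Icc 0 S) (hb : b ∈ Icc 0 S) : ∫ t in a..b, deriv g t = g b - g a := by
  have hgi := intervalIntegrable_deriv hS hg
  rw [← uIcc_of_le hS] at ha hb
  have hint : ∀ x ∈ uIcc 0 S, IntervalIntegrable (deriv g) volume 0 x := fun x hx =>
    hgi.mono_set (uIcc_subset_uIcc_left hx)
  have hP := hg.sub (absolutelyContinuousOnInterval_primitive hgi)
  obtain ⟨C, hC⟩ := hP.const_of_ae_hasDerivAt_zero (by
    filter_upwards [ae_differentiableAt_of_absolutelyContinuousOnInterval hg,
      hgi.ae_hasDerivAt_integral] with x h1 h2 h3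
    have := (h1 h3).hasDerivAt.sub (h2 h3 0 (by simp))
    rwa [sub_self] at this)
  have e1 := hC a ha
  have e2 := hC b hb
  simp only [Pi.sub_apply] at e1 e2
  rw [← intervalIntegral.integral_interval_sub_left (hint _ hb) (hint _ ha)]
  rw [← e2, sub_eq_sub_iff_sub_eq_sub] at e1
  rw [← neg_sub (g a), e1, neg_sub]

theorem intervalIntegrable_deriv_of_mem (hS : 0 ≤ S) (hg : AbsolutelyContinuousOnInterval g 0 S)
    {a b : ℝ} (ha : a ∈ Icc 0 S) (hb : b ∈ Icc 0 S) :
    IntervalIntegrable (deriv g) volume a b :=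
  (intervalIntegrable_deriv hS hg).mono_set
    (by rw [uIcc_of_le hS]; exact ordConnected_Icc.uIcc_subset ha hb)

theorem dist_le_integral_norm_deriv (hS : 0 ≤ S) (hg : AbsolutelyContinuousOnInterval g 0 S)
    {a b : ℝ} (ha : a ∈ Icc 0 S) (hb : b ∈ Icc 0 S) (hab : a ≤ b) :
    ‖g b - g a‖ ≤ ∫ t in a..b, ‖deriv g t‖ := by
  rw [← integral_deriv_eq_sub hS hg ha hb]
  exact intervalIntegral.norm_integral_le_integral_norm hab

end AbsolutelyContinuous

/-! ### Differential equations driven by a path, and their change of parameter -/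

section Solves

variable {E H : Type*} [NormedAddCommGroup E] [NormedSpace ℝ E]
  [NormedAddCommGroup H] [NormedSpace ℝ H]

/-- `y` is an absolutely continuous solution of `ẏ = F(y) ġ` on `[0, S]`. -/
structure Solves (F : E → H →L[ℝ] E) (g : ℝ → H) (S : ℝ) (y : ℝ → E) : Prop where
  ac : AbsolutelyContinuousOnInterval y 0 S
  ae_hasDerivAt : ∀ᵐ t ∂volume.restrict (Icc 0 S), HasDerivAt y (F (y t) (deriv g t)) t

/-- The increments of `y` over `[a, b] ⊆ [0, S]` are `F(y(a)) (g(b) - g(a))` up to an error of order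
`(s(b) - s(a))²`. Unlike the differential equation `ẏ = F(y) ġ`, to which it is equivalent when `s`
is an arc length, this condition is stable under every monotone substitution. -/
def IncrementEstimate (F : E → H →L[ℝ] E) (g : ℝ → H) (s : ℝ → ℝ) (S : ℝ) (y : ℝ → E) : Prop :=
  ∃ C M : ℝ, ∀ a ∈ Icc 0 S, ∀ b ∈ Icc 0 S, a ≤ b →
    ‖y b - y a‖ ≤ M * (s b - s a) ∧ ‖y b - y a - F (y a) (g b - g a)‖ ≤ C * (s b - s a) ^ 2

variable {F : E → H →L[ℝ] E} {g : ℝ → H} {s : ℝ → ℝ} {S : ℝ} {y : ℝ → E}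

theorem IncrementEstimate.comp (h : IncrementEstimate F g s S y) {φ : ℝ → ℝ} {S' : ℝ}
    (hm : MonotoneOn φ (Icc 0 S')) (hφ : MapsTo φ (Icc 0 S') (Icc 0 S)) :
    IncrementEstimate F (fun t => g (φ t)) (fun t => s (φ t)) S' (fun t => y (φ t)) := by
  obtain ⟨C, M, h⟩ := h
  exact ⟨C, M, fun a ha b hb hab => h _ (hφ ha) _ (hφ hb) (hm ha hb hab)⟩

theorem IncrementEstimate.congr (h : IncrementEstimate F g s S y) {g' : ℝ → H} {s' : ℝ → ℝ}
    {y' : ℝ → E} (hg : EqOn g g' (Icc 0 S)) (hs : EqOn s s' (Icc 0 S)) (hy : EqOn y y' (Icc 0 S)) :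
    IncrementEstimate F g' s' S y' := by
  obtain ⟨C, M, h⟩ := h
  refine ⟨C, M, fun a ha b hb hab => ?_⟩
  rw [← hg ha, ← hg hb, ← hs ha, ← hs hb, ← hy ha, ← hy hb]
  exact h a ha b hb hab

theorem IncrementEstimate.eq_of_eq (h : IncrementEstimate F g s S y) {a b : ℝ} (ha : a ∈ Icc 0 S)
    (hb : b ∈ Icc 0 S) (hab : s a = s b) : y a = y b := by
  obtain ⟨C, M, h⟩ := h
  rcases le_total a b with hle | hle
  · have := (h a ha b hb hle).1
    rw [hab, sub_self, mul_zero] at this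
    exact (sub_eq_zero.1 (norm_le_zero_iff.1 this)).symm
  · have := (h b hb a ha hle).1
    rw [hab, sub_self, mul_zero] at this
    exact sub_eq_zero.1 (norm_le_zero_iff.1 this)

theorem Solves.deriv_ae (h : Solves F g S y) :
    ∀ᵐ t ∂volume.restrict (Icc 0 S), deriv y t = F (y t) (deriv g t) :=
  h.ae_hasDerivAt.mono fun _ ht => ht.deriv

theorem IncrementEstimate.hasDerivAt (h : IncrementEstimate F g s S y) {t : ℝ} (ht : t ∈ Ioo 0 S)
    (hy : DifferentiableAt ℝ y t) (hg : DifferentiableAt ℝ g t) (hs : DifferentiableAt ℝ s t) :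
    HasDerivAt y (F (y t) (deriv g t)) t := by
  obtain ⟨C, M, h⟩ := h
  have hr : HasDerivAt (fun b => y b - F (y t) (g b)) (deriv y t - F (y t) (deriv g t)) t :=
    hy.hasDerivAt.sub ((F (y t)).hasFDerivAt.comp_hasDerivAt t hg.hasDerivAt)
  have hq : HasDerivAt (fun b => C * (s b - s t) ^ 2) 0 t := by
    simpa using ((hs.hasDerivAt.sub_const (s t)).pow 2).const_mul C
  have hr' := (hasDerivWithinAt_iff_tendsto_slope' (lt_irrefl t : t ∉ Ioi t)).1
    (hr.hasDerivWithinAt (s := Ioi t))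
  have hq' := (hasDerivWithinAt_iff_tendsto_slope' (lt_irrefl t : t ∉ Ioi t)).1
    (hq.hasDerivWithinAt (s := Ioi t))
  have hle : ‖deriv y t - F (y t) (deriv g t)‖ ≤ 0 := by
    refine le_of_tendsto_of_tendsto (b := 𝓝[>] t) hr'.norm hq' ?_
    filter_upwards [self_mem_nhdsWithin, mem_nhdsWithin_of_mem_nhds (Iio_mem_nhds ht.2)]
      with b hb hb'
    have hb : t < b := hb
    have hb' : b < S := hb'
    have := (h t ⟨ht.1.le, ht.2.le⟩ b ⟨(ht.1.trans hb).le, hb'.le⟩ hb.le).2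
    rw [slope_def_module, slope_def_module, norm_smul, smul_eq_mul,
      Real.norm_of_nonneg (inv_nonneg.2 (sub_nonneg.2 hb.le))]
    refine mul_le_mul_of_nonneg_left ?_ (inv_nonneg.2 (sub_nonneg.2 hb.le))
    simp only [sub_self]
    rw [map_sub] at this
    rw [sub_sub_sub_comm]
    simpa using this
  rw [← sub_eq_zero.1 (norm_le_zero_iff.1 hle)]
  exact hy.hasDerivAt

variable [FiniteDimensional ℝ E]

theorem Solves.sub_eq_integral (h : Solves F g S y) (hS : 0 ≤ S) {a b : ℝ} (ha : a ∈ Icc 0 S)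
    (hb : b ∈ Icc 0 S) (hab : a ≤ b) :
    IntervalIntegrable (fun t => F (y t) (deriv g t)) volume a b ∧
      y b - y a = ∫ t in a..b, F (y t) (deriv g t) := by
  have hae : ∀ᵐ t ∂volume.restrict (uIoc a b), deriv y t = F (y t) (deriv g t) := by
    rw [uIoc_of_le hab]
    exact ae_restrict_of_ae_restrict_of_subset
      (Ioc_subset_Icc_self.trans (Icc_subset_Icc ha.1 hb.2)) h.deriv_ae
  refine ⟨(intervalIntegrable_deriv_of_mem hS h.ac ha hb).congr_ae hae, ?_⟩
  rw [← integral_deriv_eq_sub hS h.ac ha hb]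
  exact intervalIntegral.integral_congr_ae_restrict hae

variable [FiniteDimensional ℝ H]

/-- A solution satisfies the estimate for every `s` whose increments dominate the length of `g`:
insert `‖F(y(t)) - F(y(a))‖ = O(s(t) - s(a))` into `∫ (F(y(t)) - F(y(a))) ġ(t) dt`. -/
theorem Solves.incrementEstimate (h : Solves F g S y) (hF : LocallyLipschitz F) (hS : 0 ≤ S)
    (hg : AbsolutelyContinuousOnInterval g 0 S)
    (hs : ∀ a ∈ Icc 0 S, ∀ b ∈ Icc 0 S, a ≤ b → ∫ t in a..b, ‖deriv g t‖ ≤ s b - s a) :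
    IncrementEstimate F g s S y := by
  have hyc : ContinuousOn y (Icc 0 S) := by
    have := h.ac.continuousOn
    rwa [uIcc_of_le hS] at this
  have hcpt : IsCompact (y '' Icc 0 S) := isCompact_Icc.image_of_continuousOn hyc
  obtain ⟨K, hK⟩ := (hF.locallyLipschitzOn (s := y '' Icc 0 S)).exists_lipschitzOnWith_of_compact
    hcpt
  obtain ⟨M, hM⟩ := hcpt.exists_bound_of_continuousOn hF.continuous.continuousOn
  have hM0 : 0 ≤ M :=
    (norm_nonneg _).trans (hM _ (mem_image_of_mem y ⟨le_rfl, hS⟩))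
  have hgi : ∀ a ∈ Icc 0 S, ∀ b ∈ Icc 0 S, IntervalIntegrable (deriv g) volume a b :=
    fun a ha b hb => intervalIntegrable_deriv_of_mem hS hg ha hb
  have hs0 : ∀ a ∈ Icc 0 S, ∀ b ∈ Icc 0 S, a ≤ b → 0 ≤ s b - s a := fun a ha b hb hab =>
    (intervalIntegral.integral_nonneg hab fun _ _ => norm_nonneg _).trans (hs a ha b hb hab)
  have h1 : ∀ a ∈ Icc 0 S, ∀ b ∈ Icc 0 S, a ≤ b → ‖y b - y a‖ ≤ M * (s b - s a) := by
    intro a ha b hb hab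
    rw [(h.sub_eq_integral hS ha hb hab).2]
    calc ‖∫ t in a..b, F (y t) (deriv g t)‖ ≤ ∫ t in a..b, M * ‖deriv g t‖ := by
          refine intervalIntegral.norm_integral_le_of_norm_le hab
            (Eventually.of_forall fun t ht => ?_)
            ((hgi a ha b hb).norm.const_mul M)
          refine (ContinuousLinearMap.le_opNorm _ _).trans ?_
          exact mul_le_mul_of_nonneg_right
            (hM _ (mem_image_of_mem y ⟨ha.1.trans ht.1.le, ht.2.trans hb.2⟩)) (norm_nonneg _)
      _ ≤ M * (s b - s a) := by
          rw [intervalIntegral.integral_const_mul]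
          exact mul_le_mul_of_nonneg_left (hs a ha b hb hab) hM0
  refine ⟨K * M, M, fun a ha b hb hab => ⟨h1 a ha b hb hab, ?_⟩⟩
  obtain ⟨hi, he⟩ := h.sub_eq_integral hS ha hb hab
  have hi2 : IntervalIntegrable (fun t => F (y a) (deriv g t)) volume a b :=
    ⟨(F (y a)).integrable_comp (hgi a ha b hb).1, (F (y a)).integrable_comp (hgi a ha b hb).2⟩
  rw [he, ← integral_deriv_eq_sub hS hg ha hb,
    ← ContinuousLinearMap.intervalIntegral_comp_comm _ (hgi a ha b hb),
    ← intervalIntegral.integral_sub hi hi2]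
  calc _ ≤ ∫ t in a..b, K * M * (s b - s a) * ‖deriv g t‖ := by
        refine intervalIntegral.norm_integral_le_of_norm_le hab
            (Eventually.of_forall fun t ht => ?_)
          ((hgi a ha b hb).norm.const_mul _)
        have htm : t ∈ Icc 0 S := ⟨ha.1.trans ht.1.le, ht.2.trans hb.2⟩
        rw [← sub_apply]
        refine (ContinuousLinearMap.le_opNorm _ _).trans
          (mul_le_mul_of_nonneg_right ?_ (norm_nonneg _))
        refine (hK.norm_sub_le (mem_image_of_mem y htm) (mem_image_of_mem y ha)).trans ?_
        rw [mul_assoc]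
        refine mul_le_mul_of_nonneg_left ((h1 a ha t htm ht.1.le).trans ?_) K.2
        have := hs0 t htm b hb ht.2
        exact mul_le_mul_of_nonneg_left (by linarith) hM0
    _ ≤ K * M * (s b - s a) * (s b - s a) := by
        rw [intervalIntegral.integral_const_mul]
        exact mul_le_mul_of_nonneg_left (hs a ha b hb hab)
          (mul_nonneg (mul_nonneg K.2 hM0) (hs0 a ha b hb hab))
    _ = _ := by ring

/-- Conversely, wherever `y`, `g` and `s` are differentiable, the quadratic error does not
contribute to the derivative. -/
theorem IncrementEstimate.solves (h : IncrementEstimate F g s S y) (hS : 0 ≤ S)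
    (hg : AbsolutelyContinuousOnInterval g 0 S) (hs : AbsolutelyContinuousOnInterval s 0 S)
    (hm : MonotoneOn s (Icc 0 S)) : Solves F g S y := by
  have hac : AbsolutelyContinuousOnInterval y 0 S := by
    obtain ⟨C, M, h⟩ := h
    refine absolutelyContinuousOnInterval_of_dist_le (C := M) hs ?_
    rw [uIcc_of_le hS]
    intro p hp q hq
    rcases le_total p q with hpq | hpq
    · rw [dist_comm, dist_eq_norm, dist_comm (s p), Real.dist_eq,
        abs_of_nonneg (sub_nonneg.2 (hm hp hq hpq))]
      exact (h p hp q hq hpq).1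
    · rw [dist_eq_norm, Real.dist_eq, abs_of_nonneg (sub_nonneg.2 (hm hq hp hpq))]
      exact (h q hq p hp hpq).1
  refine ⟨hac, ?_⟩
  rw [← restrict_Ioo_eq_restrict_Icc, ae_restrict_iff' measurableSet_Ioo]
  filter_upwards [ae_differentiableAt_of_absolutelyContinuousOnInterval hac,
    ae_differentiableAt_of_absolutelyContinuousOnInterval hg,
    ae_differentiableAt_of_absolutelyContinuousOnInterval hs] with t h1 h2 h3 ht
  have htm : t ∈ uIcc 0 S := by rw [uIcc_of_le hS]; exact Ioo_subset_Icc_self ht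
  exact h.hasDerivAt ht (h1 htm) (h2 htm) (h3 htm)

end Solves

/-! ### Existence and stability for globally Lipschitz fields -/

section Stability

/-- Gronwall's lemma in integral form. -/
theorem le_mul_exp_of_le_add_integral {φ : ℝ → ℝ} {a K A : ℝ} (hA : 0 ≤ A) (ha : 0 ≤ a)
    (hK : 0 ≤ K) (hφ : ContinuousOn φ (Icc 0 A)) (h0 : ∀ t ∈ Icc 0 A, 0 ≤ φ t)
    (h : ∀ t ∈ Icc 0 A, φ t ≤ a + K * ∫ r in (0 : ℝ)..t, φ r) :
    ∀ t ∈ Icc 0 A, φ t ≤ a * Real.exp (K * t) := by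
  set ψ : ℝ → ℝ := IccExtend hA ((Icc 0 A).domRestrict φ) with hψ
  have hψc : Continuous ψ := (continuousOn_iff_continuous_domRestrict.1 hφ).Icc_extend'
  have hψφ : ∀ t ∈ Icc 0 A, ψ t = φ t := fun t ht => IccExtend_of_mem _ _ ht
  have hψ0 : ∀ t, 0 ≤ ψ t := fun t => h0 _ (projIcc 0 A hA t).2
  have hint : ∀ t ∈ Icc 0 A, ∫ r in (0 : ℝ)..t, φ r = ∫ r in (0 : ℝ)..t, ψ r := by
    intro t ht
    refine intervalIntegral.integral_congr fun r hr => ?_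
    rw [uIcc_of_le ht.1] at hr
    exact (hψφ r ⟨hr.1, hr.2.trans ht.2⟩).symm
  have hd : ∀ t, HasDerivAt (fun t => a + K * ∫ r in (0 : ℝ)..t, ψ r) (K * ψ t) t := fun t =>
    ((hψc.integral_hasStrictDerivAt 0 t).hasDerivAt.const_mul K).const_add a
  have hi0 : ∀ t ∈ Icc 0 A, 0 ≤ ∫ r in (0 : ℝ)..t, ψ r := fun t ht =>
    intervalIntegral.integral_nonneg ht.1 fun r _ => hψ0 r
  have key := norm_le_gronwallBound_of_norm_deriv_right_le (a := 0) (b := A) (δ := a) (K := K)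
    (ε := 0) (f := fun t => a + K * ∫ r in (0 : ℝ)..t, ψ r) (f' := fun t => K * ψ t)
    (fun t _ => (hd t).continuousAt.continuousWithinAt) (fun t _ => (hd t).hasDerivWithinAt)
    (by simp [abs_of_nonneg ha]) (by
      intro t ht
      have ht' := Ico_subset_Icc_self ht
      have h1 := h t ht'
      rw [hint t ht', ← hψφ t ht'] at h1
      rw [add_zero, Real.norm_of_nonneg (mul_nonneg hK (hψ0 t)),
        Real.norm_of_nonneg (add_nonneg ha (mul_nonneg hK (hi0 t ht')))]
      exact mul_le_mul_of_nonneg_left h1 hK)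
  intro t ht
  have h2 := key t ht
  rw [gronwallBound_ε0, sub_zero] at h2
  refine le_trans ?_ ((le_abs_self _).trans h2)
  rw [← hint t ht]
  exact h t ht

variable {E H : Type*} [NormedAddCommGroup E] [NormedSpace ℝ E]
  [NormedAddCommGroup H] [NormedSpace ℝ H]

theorem intervalIntegrable_clm_apply {L : ℝ → H →L[ℝ] E} {h : ℝ → H} {a b : ℝ}
    (hL : ContinuousOn L (uIcc a b)) (hh : IntervalIntegrable h volume a b) :
    IntervalIntegrable (fun t => L t (h t)) volume a b := by
  obtain ⟨M, hM⟩ := isCompact_uIcc.exists_bound_of_continuousOn hL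
  refine (hh.norm.const_mul M).mono_fun ?_ ?_
  · have h1 := (hL.mono uIoc_subset_uIcc).aestronglyMeasurable measurableSet_uIoc (μ := volume)
    exact isBoundedBilinearMap_apply.continuous.comp_aestronglyMeasurable
      (h1.prodMk hh.aestronglyMeasurable_restrict_uIoc)
  · rw [EventuallyLE, ae_restrict_iff' measurableSet_uIoc]
    refine Eventually.of_forall fun t ht => ?_
    refine (ContinuousLinearMap.le_opNorm _ _).trans ?_
    refine le_trans ?_ (le_abs_self _)
    exact mul_le_mul_of_nonneg_right (hM t (uIoc_subset_uIcc ht)) (norm_nonneg _)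

variable [FiniteDimensional ℝ E] [FiniteDimensional ℝ H] {F : E → H →L[ℝ] E} {K : NNReal}

/-- A Picard argument: in the weighted norm `sup e^{-λt} ‖y(t)‖`, `λ = 2K + 1`, the integral
operator is a contraction of `C([0, A], E)`. -/
theorem exists_solves_of_lipschitz (hF : LipschitzWith K F) {g : ℝ → H} (hg : LipschitzWith 1 g)
    (x₀ : E) {A : ℝ} (hA : 0 ≤ A) : ∃ y, y 0 = x₀ ∧ Solves F g A y := by
  have hgi : ∀ a b, IntervalIntegrable (deriv g) volume a b := by
    intro a b
    refine (intervalIntegrable_const (c := (1 : ℝ))).mono_fun (aestronglyMeasurable_deriv g _) ?_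
    exact Eventually.of_forall fun t => by
      simpa using norm_deriv_le_of_lipschitz (x₀ := t) hg
  set l : ℝ := 2 * K + 1 with hl
  have hl0 : 0 < l := by positivity
  -- `w z` is the curve `e^{λt} z(t)`, continued by constants outside `[0, A]`
  set w : C(Icc (0 : ℝ) A, E) → ℝ → E := fun z t => Real.exp (l * t) • IccExtend hA z t with hw
  have hwc : ∀ z, Continuous (w z) := fun z => by
    have : Continuous (IccExtend hA z) := z.continuous.Icc_extend'
    exact (by fun_prop : Continuous fun t => Real.exp (l * t)).smul this
  have hwi : ∀ z a b, IntervalIntegrable (fun t => F (w z t) (deriv g t)) volume a b := fun z a b =>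
    intervalIntegrable_clm_apply ((hF.continuous.comp (hwc z)).continuousOn) (hgi a b)
  set P : C(Icc (0 : ℝ) A, E) → C(Icc (0 : ℝ) A, E) := fun z =>
    ⟨fun t => Real.exp (-(l * t)) • (x₀ + ∫ r in (0 : ℝ)..t, F (w z r) (deriv g r)), by
      have h1 : Continuous fun t : ℝ => ∫ r in (0 : ℝ)..t, F (w z r) (deriv g r) :=
        intervalIntegral.continuous_primitive (hwi z) 0
      fun_prop⟩ with hP
  have hcontr : ContractingWith (1 / 2) P := by
    refine ⟨by rw [← NNReal.coe_lt_coe]; norm_num, LipschitzWith.of_dist_le_mul fun z₁ z₂ => ?_⟩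
    rw [ContinuousMap.dist_le (by positivity)]
    intro t
    have ht := t.2
    have hexp : ∫ r in (0 : ℝ)..t, Real.exp (l * r) = (Real.exp (l * t) - 1) / l := by
      rw [intervalIntegral.integral_comp_mul_left (fun r => Real.exp r) hl0.ne']
      simp [div_eq_inv_mul]
    have hbound : ‖∫ r in (0 : ℝ)..t, (F (w z₁ r) (deriv g r) - F (w z₂ r) (deriv g r))‖ ≤
        ∫ r in (0 : ℝ)..t, K * dist z₁ z₂ * Real.exp (l * r) := by
      refine intervalIntegral.norm_integral_le_of_norm_le ht.1 (Eventually.of_forall fun r hr => ?_)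
        (by apply Continuous.intervalIntegrable; fun_prop)
      rw [← sub_apply]
      refine (ContinuousLinearMap.le_opNorm _ _).trans ?_
      have e1 : ‖deriv g r‖ ≤ 1 := by simpa using norm_deriv_le_of_lipschitz (x₀ := r) hg
      have e2 := hF.norm_sub_le (w z₁ r) (w z₂ r)
      have e3 : ‖w z₁ r - w z₂ r‖ ≤ Real.exp (l * r) * dist z₁ z₂ := by
        rw [hw, ← smul_sub, norm_smul, Real.norm_of_nonneg (Real.exp_pos _).le, ← dist_eq_norm]
        exact mul_le_mul_of_nonneg_left (ContinuousMap.dist_apply_le_dist _) (Real.exp_pos _).le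
      calc _ ≤ K * (Real.exp (l * r) * dist z₁ z₂) * 1 := by
            refine mul_le_mul (e2.trans ?_) e1 (norm_nonneg _) (by positivity)
            exact mul_le_mul_of_nonneg_left e3 K.2
        _ = _ := by ring
    rw [intervalIntegral.integral_sub (hwi _ _ _) (hwi _ _ _),
      intervalIntegral.integral_const_mul, hexp] at hbound
    have e : P z₁ t - P z₂ t = Real.exp (-(l * t)) • ((∫ r in (0 : ℝ)..t, F (w z₁ r) (deriv g r)) -
        ∫ r in (0 : ℝ)..t, F (w z₂ r) (deriv g r)) := by
      rw [hP]
      simp only [ContinuousMap.coe_mk]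
      rw [← smul_sub, add_sub_add_left_eq_sub]
    rw [dist_eq_norm, e, norm_smul, Real.norm_of_nonneg (Real.exp_pos _).le]
    calc _ ≤ Real.exp (-(l * t)) * (K * dist z₁ z₂ * ((Real.exp (l * t) - 1) / l)) :=
          mul_le_mul_of_nonneg_left hbound (Real.exp_pos _).le
      _ = (K / l) * dist z₁ z₂ * (1 - Real.exp (-(l * t))) := by
          rw [Real.exp_neg]
          field_simp
      _ ≤ (1 / 2) * dist z₁ z₂ * 1 := by
          have h1 : (K : ℝ) / l ≤ 1 / 2 := by
            rw [div_le_div_iff₀ hl0 two_pos, hl]; linarith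
          have h2 : 0 ≤ 1 - Real.exp (-(l * t)) := by
            rw [sub_nonneg, Real.exp_le_one_iff]
            exact neg_nonpos.2 (mul_nonneg hl0.le ht.1)
          refine mul_le_mul (mul_le_mul_of_nonneg_right h1 dist_nonneg) ?_ h2 (by positivity)
          linarith [Real.exp_pos (-(l * (t : ℝ)))]
      _ = _ := by simp
  set z := ContractingWith.fixedPoint P hcontr with hz
  have hfix : P z = z := hcontr.fixedPoint_isFixedPt
  set y : ℝ → E := fun t => x₀ + ∫ r in (0 : ℝ)..t, F (w z r) (deriv g r) with hy
  have hyw : ∀ t ∈ Icc 0 A, w z t = y t := by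
    intro t ht
    have h1 : z ⟨t, ht⟩ = Real.exp (-(l * t)) • y t := by
      conv_lhs => rw [← hfix]
      rfl
    rw [hw]
    simp only
    rw [IccExtend_of_mem hA _ ht, h1, smul_smul, ← Real.exp_add, add_neg_cancel, Real.exp_zero,
      one_smul]
  refine ⟨y, by simp [hy], ?_, ?_⟩
  · exact absolutelyContinuousOnInterval_of_dist_le (C := 1)
      (absolutelyContinuousOnInterval_primitive (hwi z 0 A)) fun p _ q _ => by simp [hy]
  · rw [ae_restrict_iff' measurableSet_Icc]
    filter_upwards [(hwi z 0 A).ae_hasDerivAt_integral] with t ht htm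
    rw [← hyw t htm]
    refine (ht (by rwa [uIcc_of_le hA]) 0 (by simp)).const_add x₀

/-- Two solutions with the same initial value, driven by `g₁` and `g₂`, differ by at most a constant
times `∫ ‖ġ₁ - ġ₂‖`, and so do their derivatives in `L¹`. Only the second solution has to be
bounded a priori. -/
theorem Solves.dist_le_of_lipschitz (hF : LipschitzWith K F) {g₁ g₂ : ℝ → H} {y₁ y₂ : ℝ → E}
    {A M : ℝ} (hA : 0 ≤ A) (hg₁ : LipschitzWith 1 g₁) (hg₂ : LipschitzWith 1 g₂)
    (h₁ : Solves F g₁ A y₁) (h₂ : Solves F g₂ A y₂) (h0 : y₁ 0 = y₂ 0)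
    (hM : ∀ t ∈ Icc 0 A, ‖F (y₂ t)‖ ≤ M) :
    (∀ t ∈ Icc 0 A, ‖y₁ t - y₂ t‖ ≤
      M * (∫ r in (0 : ℝ)..A, ‖deriv g₁ r - deriv g₂ r‖) * Real.exp (K * A)) ∧
    ∫ r in (0 : ℝ)..A, ‖deriv y₁ r - deriv y₂ r‖ ≤
      K * A * (M * (∫ r in (0 : ℝ)..A, ‖deriv g₁ r - deriv g₂ r‖) * Real.exp (K * A)) +
        M * ∫ r in (0 : ℝ)..A, ‖deriv g₁ r - deriv g₂ r‖ := by
  have h0A : (0 : ℝ) ∈ Icc 0 A := ⟨le_rfl, hA⟩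
  have hM0 : 0 ≤ M := (norm_nonneg _).trans (hM 0 h0A)
  have hac : ∀ {g : ℝ → H}, LipschitzWith 1 g → AbsolutelyContinuousOnInterval g 0 A := fun hg =>
    (hg.lipschitzOnWith (s := uIcc 0 A)).absolutelyContinuousOnInterval
  have hgi : ∀ t ∈ Icc 0 A,
      IntervalIntegrable (fun r => ‖deriv g₁ r - deriv g₂ r‖) volume 0 t := fun t ht =>
    ((intervalIntegrable_deriv_of_mem hA (hac hg₁) h0A ht).sub
      (intervalIntegrable_deriv_of_mem hA (hac hg₂) h0A ht)).norm
  have hc : ContinuousOn (fun t => ‖y₁ t - y₂ t‖) (Icc 0 A) := by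
    have := (h₁.ac.continuousOn.sub h₂.ac.continuousOn).norm
    rwa [uIcc_of_le hA] at this
  have hyi : ∀ t ∈ Icc 0 A, IntervalIntegrable (fun r => ‖y₁ r - y₂ r‖) volume 0 t := fun t ht =>
    (hc.mono (by rw [uIcc_of_le ht.1]; exact Icc_subset_Icc_right ht.2)).intervalIntegrable
  set D := ∫ r in (0 : ℝ)..A, ‖deriv g₁ r - deriv g₂ r‖ with hD
  have hpt : ∀ r ∈ Icc 0 A, ‖F (y₁ r) (deriv g₁ r) - F (y₂ r) (deriv g₂ r)‖ ≤
      K * ‖y₁ r - y₂ r‖ + M * ‖deriv g₁ r - deriv g₂ r‖ := by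
    intro r hr
    have e : F (y₁ r) (deriv g₁ r) - F (y₂ r) (deriv g₂ r) =
        (F (y₁ r) - F (y₂ r)) (deriv g₁ r) + F (y₂ r) (deriv g₁ r - deriv g₂ r) := by
      rw [sub_apply, map_sub]; abel
    rw [e]
    refine (norm_add_le _ _).trans (add_le_add ?_ ?_)
    · refine (ContinuousLinearMap.le_opNorm _ _).trans ?_
      calc _ ≤ (K * ‖y₁ r - y₂ r‖) * 1 := by
            refine mul_le_mul (hF.norm_sub_le _ _) ?_ (norm_nonneg _) (by positivity)
            simpa using norm_deriv_le_of_lipschitz (x₀ := r) hg₁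
        _ = _ := mul_one _
    · exact (ContinuousLinearMap.le_opNorm _ _).trans
        (mul_le_mul_of_nonneg_right (hM r hr) (norm_nonneg _))
  have hbd : ∀ t ∈ Icc 0 A, ‖y₁ t - y₂ t‖ ≤ M * D + K * ∫ r in (0 : ℝ)..t, ‖y₁ r - y₂ r‖ := by
    intro t ht
    obtain ⟨i1, e1⟩ := h₁.sub_eq_integral hA h0A ht ht.1
    obtain ⟨i2, e2⟩ := h₂.sub_eq_integral hA h0A ht ht.1
    have e : y₁ t - y₂ t =
        ∫ r in (0 : ℝ)..t, (F (y₁ r) (deriv g₁ r) - F (y₂ r) (deriv g₂ r)) := by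
      rw [intervalIntegral.integral_sub i1 i2, ← e1, ← e2, h0]; abel
    rw [e]
    calc _ ≤ ∫ r in (0 : ℝ)..t, (K * ‖y₁ r - y₂ r‖ + M * ‖deriv g₁ r - deriv g₂ r‖) :=
          intervalIntegral.norm_integral_le_of_norm_le ht.1
            (Eventually.of_forall fun r hr => hpt r ⟨hr.1.le, hr.2.trans ht.2⟩)
            (((hyi t ht).const_mul _).add ((hgi t ht).const_mul _))
      _ = K * (∫ r in (0 : ℝ)..t, ‖y₁ r - y₂ r‖) +
          M * ∫ r in (0 : ℝ)..t, ‖deriv g₁ r - deriv g₂ r‖ := by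
          rw [intervalIntegral.integral_add ((hyi t ht).const_mul _) ((hgi t ht).const_mul _),
            intervalIntegral.integral_const_mul, intervalIntegral.integral_const_mul]
      _ ≤ _ := by
          rw [add_comm]
          gcongr
          exact intervalIntegral.integral_mono_interval le_rfl ht.1 ht.2
            (Eventually.of_forall fun _ => norm_nonneg _) (hgi A ⟨hA, le_rfl⟩)
  have hD0 : 0 ≤ D := intervalIntegral.integral_nonneg hA fun _ _ => norm_nonneg _
  have hsup : ∀ t ∈ Icc 0 A, ‖y₁ t - y₂ t‖ ≤ M * D * Real.exp (K * A) := by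
    intro t ht
    refine (le_mul_exp_of_le_add_integral hA (by positivity) K.2 hc
      (fun _ _ => norm_nonneg _) hbd t ht).trans ?_
    exact mul_le_mul_of_nonneg_left
      (Real.exp_le_exp.2 (mul_le_mul_of_nonneg_left ht.2 K.2)) (by positivity)
  refine ⟨hsup, ?_⟩
  have hAm : A ∈ Icc 0 A := ⟨hA, le_rfl⟩
  calc _ ≤ ∫ r in (0 : ℝ)..A, (K * (M * D * Real.exp (K * A)) + M * ‖deriv g₁ r - deriv g₂ r‖) := by
        refine intervalIntegral.integral_mono_ae_restrict hA
          ((intervalIntegrable_deriv hA h₁.ac).sub (intervalIntegrable_deriv hA h₂.ac)).norm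
          (intervalIntegrable_const.add ((hgi A hAm).const_mul _)) ?_
        filter_upwards [h₁.deriv_ae, h₂.deriv_ae, ae_restrict_mem measurableSet_Icc]
          with r e1 e2 hr
        rw [e1, e2]
        refine (hpt r hr).trans (add_le_add ?_ le_rfl)
        exact mul_le_mul_of_nonneg_left (hsup r hr) K.2
    _ = _ := by
        rw [intervalIntegral.integral_add intervalIntegrable_const ((hgi A hAm).const_mul _),
          intervalIntegral.integral_const, intervalIntegral.integral_const_mul]
        simp only [smul_eq_mul]
        ring

end Stability

/-! ### Arc length and the natural parameterization -/

namespace SpaceTimeCurve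

variable {n : ℕ} {T : ℝ} (g : SpaceTimeCurve n T)

/-- The length of the part of the stopped curve `g.trunc` over the parameters `[0, t]`. -/
noncomputable def arc (t : ℝ) : ℝ := ∫ r in (0 : ℝ)..min t g.exitParam, ‖deriv g.toFun r‖

/-- A parameter in `[0, θ^#(T)]` at which the arc length is `σ`, for `σ` between `0` and the length;
other values of `σ` are first moved to the nearer end of that interval. -/
noncomputable def paramOfArc (σ : ℝ) : ℝ :=
  Function.invFunOn g.arc (Icc 0 g.exitParam) (max 0 (min σ g.length))

/-- The segment of the curve in `[0, T] × ℝⁿ`, parameterized by its arc length on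
`[0, length]`, and constant on either side of this interval. -/
noncomputable def natParam (σ : ℝ) : SpaceTime n := g.toFun (g.paramOfArc σ)

theorem ac : AbsolutelyContinuousOnInterval g.toFun 0 g.exitParam :=
  g.locallyAC _ g.exitParam_nonneg

theorem left_mem : (0 : ℝ) ∈ Icc 0 g.exitParam := ⟨le_rfl, g.exitParam_nonneg⟩

theorem right_mem : g.exitParam ∈ Icc 0 g.exitParam := ⟨g.exitParam_nonneg, le_rfl⟩

theorem arc_of_mem {t : ℝ} (ht : t ∈ Icc 0 g.exitParam) :
    g.arc t = ∫ r in (0 : ℝ)..t, ‖deriv g.toFun r‖ := by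
  rw [arc, min_eq_left ht.2]

theorem arc_of_ge {t : ℝ} (ht : g.exitParam ≤ t) : g.arc t = g.length := by
  rw [arc, min_eq_right ht, length]

theorem arc_zero : g.arc 0 = 0 := by
  rw [g.arc_of_mem g.left_mem, intervalIntegral.integral_same]

theorem intervalIntegrable_norm_deriv {a b : ℝ} (ha : a ∈ Icc 0 g.exitParam)
    (hb : b ∈ Icc 0 g.exitParam) : IntervalIntegrable (fun r => ‖deriv g.toFun r‖) volume a b :=
  (intervalIntegrable_deriv_of_mem g.exitParam_nonneg g.ac ha hb).norm

theorem arc_sub_arc {a b : ℝ} (ha : a ∈ Icc 0 g.exitParam) (hb : b ∈ Icc 0 g.exitParam) :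
    g.arc b - g.arc a = ∫ r in a..b, ‖deriv g.toFun r‖ := by
  rw [g.arc_of_mem ha, g.arc_of_mem hb]
  exact intervalIntegral.integral_interval_sub_left
    (g.intervalIntegrable_norm_deriv g.left_mem hb) (g.intervalIntegrable_norm_deriv g.left_mem ha)

theorem monotoneOn_arc : MonotoneOn g.arc (Ici 0) := by
  intro a ha b hb hab
  have h := g.arc_sub_arc (g.min_mem ha) (g.min_mem hb)
  have h0 : 0 ≤ ∫ r in min a g.exitParam..min b g.exitParam, ‖deriv g.toFun r‖ :=
    intervalIntegral.integral_nonneg (min_le_min_right _ hab) fun _ _ => norm_nonneg _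
  rw [← h] at h0
  simpa [arc, min_assoc] using h0

theorem length_nonneg : 0 ≤ g.length :=
  intervalIntegral.integral_nonneg g.exitParam_nonneg fun _ _ => norm_nonneg _

theorem arc_mem {t : ℝ} (ht : 0 ≤ t) : g.arc t ∈ Icc 0 g.length := by
  constructor
  · rw [← g.arc_zero]
    exact g.monotoneOn_arc self_mem_Ici ht ht
  · rw [← g.arc_of_ge (le_max_right t g.exitParam)]
    exact g.monotoneOn_arc ht (ht.trans (le_max_left t g.exitParam)) (le_max_left _ _)

theorem locallyAC_arc : LocallyAC g.arc := by
  intro b hb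
  exact absolutelyContinuousOnInterval_comp (g := fun t => ∫ r in (0 : ℝ)..t, ‖deriv g.toFun r‖)
    (φ := fun t => min t g.exitParam) hb g.exitParam_nonneg
    (absolutelyContinuousOnInterval_primitive
      (g.intervalIntegrable_norm_deriv g.left_mem g.right_mem))
    (locallyAC_min_const _ b hb)
    (fun _ _ _ _ h => min_le_min_right _ h) fun t ht => g.min_mem ht.1

theorem image_arc_Icc : g.arc '' Icc 0 g.exitParam = Icc 0 g.length := by
  refine Subset.antisymm ?_ ?_
  · rintro _ ⟨t, ht, rfl⟩
    exact g.arc_mem ht.1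
  · have hc := (g.locallyAC_arc _ g.exitParam_nonneg).continuousOn
    rw [uIcc_of_le g.exitParam_nonneg] at hc
    have := intermediate_value_Icc g.exitParam_nonneg hc
    rwa [g.arc_zero, g.arc_of_ge le_rfl] at this

theorem image_arc_Ici : g.arc '' Ici 0 = Icc 0 g.length := by
  refine Subset.antisymm ?_ ?_
  · rintro _ ⟨t, ht, rfl⟩
    exact g.arc_mem ht
  · rw [← g.image_arc_Icc]
    exact image_mono Icc_subset_Ici_self

theorem clamp_mem (σ : ℝ) : max 0 (min σ g.length) ∈ Icc 0 g.length :=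
  ⟨le_max_left _ _, max_le g.length_nonneg (min_le_right _ _)⟩

theorem clamp_of_mem {σ : ℝ} (hσ : σ ∈ Icc 0 g.length) : max 0 (min σ g.length) = σ := by
  rw [min_eq_left hσ.2, max_eq_right hσ.1]

theorem paramOfArc_mem (σ : ℝ) : g.paramOfArc σ ∈ Icc 0 g.exitParam := by
  have h := g.clamp_mem σ
  rw [← g.image_arc_Icc] at h
  exact Function.invFunOn_mem h

theorem arc_paramOfArc' (σ : ℝ) : g.arc (g.paramOfArc σ) = max 0 (min σ g.length) := by
  have h := g.clamp_mem σ
  rw [← g.image_arc_Icc] at h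
  exact Function.invFunOn_eq h

theorem arc_paramOfArc {σ : ℝ} (hσ : σ ∈ Icc 0 g.length) : g.arc (g.paramOfArc σ) = σ := by
  rw [arc_paramOfArc', g.clamp_of_mem hσ]

theorem monotoneOn_paramOfArc : MonotoneOn g.paramOfArc (Icc 0 g.length) := by
  intro a ha b hb hab
  by_contra hcon
  push Not at hcon
  have h := g.monotoneOn_arc (g.paramOfArc_mem b).1 (g.paramOfArc_mem a).1 hcon.le
  rw [g.arc_paramOfArc ha, g.arc_paramOfArc hb] at h
  rw [le_antisymm hab h] at hcon
  exact lt_irrefl _ hcon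

theorem dist_le_arc {a b : ℝ} (ha : a ∈ Icc 0 g.exitParam) (hb : b ∈ Icc 0 g.exitParam) :
    dist (g.toFun a) (g.toFun b) ≤ dist (g.arc a) (g.arc b) := by
  wlog hab : a ≤ b generalizing a b
  · rw [dist_comm, dist_comm (g.arc a)]
    exact this hb ha (le_of_not_ge hab)
  rw [dist_comm, dist_eq_norm, dist_comm, Real.dist_eq, g.arc_sub_arc ha hb]
  exact (dist_le_integral_norm_deriv g.exitParam_nonneg g.ac ha hb hab).trans (le_abs_self _)

theorem lipschitzWith_natParam : LipschitzWith 1 g.natParam := by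
  refine LipschitzWith.of_dist_le_mul fun a b => ?_
  refine (g.dist_le_arc (g.paramOfArc_mem a) (g.paramOfArc_mem b)).trans ?_
  rw [arc_paramOfArc', arc_paramOfArc']
  exact ((LipschitzWith.id.min_const g.length).const_max 0).dist_le_mul a b

theorem natParam_arc {t : ℝ} (ht : 0 ≤ t) : g.natParam (g.arc t) = g.trunc t := by
  have h := g.dist_le_arc (g.paramOfArc_mem (g.arc t)) (g.min_mem ht)
  rw [g.arc_paramOfArc (g.arc_mem ht)] at h
  have e : g.arc (min t g.exitParam) = g.arc t := by simp [arc]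
  rw [e, dist_self] at h
  exact dist_le_zero.1 h

theorem natParam_of_ge {σ : ℝ} (hσ : g.length ≤ σ) : g.natParam σ = g.natParam g.length := by
  simp [natParam, paramOfArc, hσ]

theorem deriv_natParam_of_gt {σ : ℝ} (hσ : g.length < σ) : deriv g.natParam σ = 0 := by
  have : g.natParam =ᶠ[𝓝 σ] fun _ => g.natParam g.length := by
    filter_upwards [Ioi_mem_nhds hσ] with r hr
    exact g.natParam_of_ge (le_of_lt hr)
  rw [this.deriv_eq, deriv_const]

theorem norm_deriv_natParam_le (σ : ℝ) : ‖deriv g.natParam σ‖ ≤ 1 := by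
  simpa using norm_deriv_le_of_lipschitz (x₀ := σ) g.lipschitzWith_natParam

theorem eVariationOn_trunc_Icc {t : ℝ} (ht : 0 ≤ t) :
    eVariationOn g.trunc (Icc 0 t) = ENNReal.ofReal (g.arc t) := by
  have hm := g.min_mem ht
  have hmono : MonotoneOn (fun r : ℝ => min r g.exitParam) (Icc 0 t) :=
    fun _ _ _ _ h => min_le_min_right _ h
  have himg : (fun r : ℝ => min r g.exitParam) '' Icc 0 t = Icc 0 (min t g.exitParam) := by
    ext x
    constructor
    · rintro ⟨r, hr, rfl⟩
      exact ⟨(g.min_mem hr.1).1, min_le_min_right _ hr.2⟩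
    · intro hx
      exact ⟨x, ⟨hx.1, hx.2.trans (min_le_left _ _)⟩, min_eq_left (hx.2.trans (min_le_right _ _))⟩
  have h := eVariationOn.comp_eq_of_monotoneOn g.toFun _ hmono
  rw [himg] at h
  have hac : AbsolutelyContinuousOnInterval g.toFun 0 (min t g.exitParam) :=
    g.locallyAC _ hm.1
  have hbv := hac.boundedVariationOn
  rw [uIcc_of_le hm.1] at hbv
  rw [arc, integral_norm_deriv_eq_variation hm.1 hac, ENNReal.ofReal_toReal hbv, ← h]
  rfl

theorem trunc_of_ge {t : ℝ} (ht : g.exitParam ≤ t) : g.trunc t = g.toFun g.exitParam := by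
  rw [trunc, min_eq_right ht]

theorem eVariationOn_trunc_Ici {t : ℝ} (ht : 0 ≤ t) :
    eVariationOn g.trunc (Ici t) = ENNReal.ofReal (g.length - g.arc t) := by
  set b := max t g.exitParam with hb
  have htb : t ≤ b := le_max_left _ _
  have h1 : eVariationOn g.trunc (Ici t) = eVariationOn g.trunc (Icc t b) := by
    rw [← Icc_union_Ici_eq_Ici htb,
      eVariationOn.union g.trunc (isGreatest_Icc htb) isLeast_Ici,
      eVariationOn.constant_on (s := Ici b), add_zero]
    rintro _ ⟨p, hp, rfl⟩ _ ⟨q, hq, rfl⟩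
    rw [g.trunc_of_ge ((le_max_right _ _).trans hp), g.trunc_of_ge ((le_max_right _ _).trans hq)]
  have h2 := eVariationOn.union g.trunc (isGreatest_Icc ht) (isLeast_Icc htb)
  rw [Icc_union_Icc_eq_Icc ht htb, g.eVariationOn_trunc_Icc ht,
    g.eVariationOn_trunc_Icc (ht.trans htb), g.arc_of_ge (le_max_right _ _)] at h2
  rw [h1, ENNReal.ofReal_sub _ (g.arc_mem ht).1, h2, ENNReal.add_sub_cancel_left
    ENNReal.ofReal_ne_top]

theorem eVariationOn_natParam :
    eVariationOn g.natParam (Icc 0 g.length) = ENNReal.ofReal g.length := by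
  have h := eVariationOn.comp_eq_of_monotoneOn g.natParam _ g.monotoneOn_arc
  rw [image_arc_Ici] at h
  have h' : eVariationOn (g.natParam ∘ g.arc) (Ici 0) = eVariationOn g.trunc (Ici 0) :=
    eVariationOn.congr fun t ht => g.natParam_arc ht
  rw [← h, h', g.eVariationOn_trunc_Ici le_rfl, arc_zero, sub_zero]

end SpaceTimeCurve

/-! ### Convergence in the strengthened Fréchet metric -/

section Reparam

variable {α : ℝ → ℝ}

theorem IsReparam.nonneg (hα : IsReparam α) {t : ℝ} (ht : 0 ≤ t) : 0 ≤ α t := hα.2.1.mapsTo ht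

theorem IsReparam.le_of_le (hα : IsReparam α) {r t : ℝ} (hr : 0 ≤ r) (ht : 0 ≤ t)
    (h : α r ≤ α t) : r ≤ t := by
  by_contra hcon
  push Not at hcon
  have := hα.2.1.injOn hr ht (le_antisymm h (hα.1 ht hr hcon.le))
  exact hcon.ne' this

theorem IsReparam.image_Icc (hα : IsReparam α) {t : ℝ} (ht : 0 ≤ t) :
    α '' Icc 0 t = Icc 0 (α t) := by
  refine Subset.antisymm ?_ fun x hx => ?_
  · rintro _ ⟨r, hr, rfl⟩
    exact ⟨hα.nonneg hr.1, hα.1 hr.1 ht hr.2⟩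
  · obtain ⟨r, hr, rfl⟩ := hα.2.1.surjOn hx.1
    exact ⟨r, ⟨hr, hα.le_of_le hr ht hx.2⟩, rfl⟩

theorem IsReparam.image_Ici (hα : IsReparam α) {t : ℝ} (ht : 0 ≤ t) :
    α '' Ici t = Ici (α t) := by
  refine Subset.antisymm ?_ fun x hx => ?_
  · rintro _ ⟨r, hr, rfl⟩
    exact hα.1 ht (ht.trans hr) hr
  · obtain ⟨r, hr, rfl⟩ := hα.2.1.surjOn ((hα.nonneg ht).trans hx)
    exact ⟨r, hα.le_of_le ht hr hx, rfl⟩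

theorem IsReparam.map_zero (hα : IsReparam α) : α 0 = 0 := by
  obtain ⟨r, hr, h⟩ := hα.2.1.surjOn (self_mem_Ici : (0 : ℝ) ∈ Ici 0)
  exact le_antisymm (h ▸ hα.1 self_mem_Ici hr hr) (hα.nonneg le_rfl)

end Reparam

theorem eventually_lt_of_ofReal {x c : ℝ} {xs : ℕ → ℝ} (h0 : ∀ j, 0 ≤ xs j)
    (h : ∀ v < ENNReal.ofReal x, ∀ᶠ j in atTop, v < ENNReal.ofReal (xs j)) (hc : c < x) :
    ∀ᶠ j in atTop, c < xs j := by
  rcases lt_or_ge c 0 with hc0 | hc0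
  · exact Eventually.of_forall fun j => hc0.trans_le (h0 j)
  · filter_upwards [h _ ((ENNReal.ofReal_lt_ofReal_iff_of_nonneg hc0).2 hc)] with j hj
    exact (ENNReal.ofReal_lt_ofReal_iff_of_nonneg hc0).1 hj

theorem tendsto_of_eventually_gt_of_eventually_gt_sub {x y : ℝ} {xs ys : ℕ → ℝ}
    (hys : Tendsto ys atTop (𝓝 y)) (h₁ : ∀ c < x, ∀ᶠ j in atTop, c < xs j)
    (h₂ : ∀ c < y - x, ∀ᶠ j in atTop, c < ys j - xs j) : Tendsto xs atTop (𝓝 x) := by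
  refine tendsto_order.2 ⟨h₁, fun c hc => ?_⟩
  have e := hys.eventually_lt_const (show y < y + (c - x) / 2 by linarith)
  filter_upwards [e, h₂ (y - x - (c - x) / 2) (by linarith)] with j e1 e2
  linarith

namespace SpaceTimeCurve

variable {n : ℕ} {T : ℝ} {g : SpaceTimeCurve n T} {gs : ℕ → SpaceTimeCurve n T}

theorem tendsto_length (h : Tendsto (fun j => (gs j).cls) atTop (𝓝 g.cls)) :
    Tendsto (fun j => (gs j).length) atTop (𝓝 g.length) := by
  rw [tendsto_iff_dist_tendsto_zero] at h ⊢
  refine squeeze_zero (fun _ => dist_nonneg) (fun j => ?_) h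
  rw [dist_cls, Real.dist_eq]
  exact le_add_of_nonneg_left (dT_nonneg _ _)

/-- Near-optimal reparameterizations turn convergence in `d_T^+` into pointwise convergence. -/
theorem exists_reparam_tendsto (h : Tendsto (fun j => (gs j).cls) atTop (𝓝 g.cls)) :
    ∃ α : ℕ → ℝ → ℝ, (∀ j, IsReparam (α j)) ∧
      ∀ t, 0 ≤ t → Tendsto (fun j => (gs j).trunc (α j t)) atTop (𝓝 (g.trunc t)) := by
  have hd : Tendsto (fun j => frechetDist g.trunc (gs j).trunc) atTop (𝓝 0) := by
    rw [tendsto_iff_dist_tendsto_zero] at h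
    have h1 : Tendsto (fun j => dT (gs j) g) atTop (𝓝 0) := by
      refine squeeze_zero (fun _ => dT_nonneg _ _) (fun j => ?_) h
      rw [dist_cls]
      exact le_add_of_nonneg_right (abs_nonneg _)
    have h2 := ENNReal.tendsto_ofReal h1
    rw [ENNReal.ofReal_zero] at h2
    refine h2.congr fun j => ?_
    rw [dT, ENNReal.ofReal_toReal (frechetDist_ne_top _ _), frechetDist_comm]
  have hex : ∀ j : ℕ, ∃ α, IsReparam α ∧ ∀ t, 0 ≤ t →
      edist (g.trunc t) ((gs j).trunc (α t)) ≤
        frechetDist g.trunc (gs j).trunc + ENNReal.ofReal (1 / ((j : ℝ) + 1)) := by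
    intro j
    have hlt : frechetDist g.trunc (gs j).trunc <
        frechetDist g.trunc (gs j).trunc + ENNReal.ofReal (1 / ((j : ℝ) + 1)) :=
      ENNReal.lt_add_right (frechetDist_ne_top _ _) (by
        rw [Ne, ENNReal.ofReal_eq_zero, not_le]; positivity)
    obtain ⟨α, hα, hlt'⟩ : ∃ α, ∃ (_ : IsReparam α),
        (⨆ (t : ℝ) (_ : 0 ≤ t), edist (g.trunc t) ((gs j).trunc (α t))) <
          frechetDist g.trunc (gs j).trunc + ENNReal.ofReal (1 / ((j : ℝ) + 1)) := by
      conv_lhs at hlt => rw [frechetDist]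
      simpa only [iInf_lt_iff] using hlt
    exact ⟨α, hα, fun t ht => (le_iSup₂ (f := fun (r : ℝ) (_ : 0 ≤ r) =>
      edist (g.trunc r) ((gs j).trunc (α r))) t ht).trans hlt'.le⟩
  choose α hα hle using hex
  refine ⟨α, hα, fun t ht => ?_⟩
  rw [tendsto_iff_edist_tendsto_0]
  have h0 : Tendsto (fun j : ℕ => frechetDist g.trunc (gs j).trunc +
      ENNReal.ofReal (1 / ((j : ℝ) + 1))) atTop (𝓝 0) := by
    simpa using hd.add (ENNReal.tendsto_ofReal (tendsto_one_div_add_atTop_nhds_zero_nat (𝕜 := ℝ)))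
  refine tendsto_of_tendsto_of_tendsto_of_le_of_le tendsto_const_nhds h0 (fun _ => zero_le)
    fun j => ?_
  rw [edist_comm]
  exact hle j t ht

/-- Lower semicontinuity of the variation, applied to both parts into which a parameter divides the
curve, shows that reparameterizations realizing the convergence also match the arc lengths. -/
theorem tendsto_natParam (h : Tendsto (fun j => (gs j).cls) atTop (𝓝 g.cls)) {σ : ℝ}
    (hσ : σ ∈ Icc 0 g.length) :
    Tendsto (fun j => (gs j).natParam σ) atTop (𝓝 (g.natParam σ)) := by
  obtain ⟨α, hα, hlim⟩ := exists_reparam_tendsto h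
  obtain ⟨t, ht, rfl⟩ : ∃ t, 0 ≤ t ∧ g.arc t = σ :=
    ⟨_, (g.paramOfArc_mem σ).1, g.arc_paramOfArc hσ⟩
  have harc : Tendsto (fun j => (gs j).arc (α j t)) atTop (𝓝 (g.arc t)) := by
    refine tendsto_of_eventually_gt_of_eventually_gt_sub (tendsto_length h)
      (fun c hc => eventually_lt_of_ofReal (fun j => ((gs j).arc_mem ((hα j).nonneg ht)).1)
        (fun v hv => ?_) hc)
      (fun c hc => eventually_lt_of_ofReal
        (fun j => sub_nonneg.2 ((gs j).arc_mem ((hα j).nonneg ht)).2) (fun v hv => ?_) hc)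
    · rw [← g.eVariationOn_trunc_Icc ht] at hv
      filter_upwards [eVariationOn.lowerSemicontinuous_aux
        (F := fun j => (gs j).trunc ∘ α j) (fun r hr => hlim r hr.1) hv] with j hj
      rwa [eVariationOn.comp_eq_of_monotoneOn _ _ ((hα j).1.mono Icc_subset_Ici_self),
        (hα j).image_Icc ht, (gs j).eVariationOn_trunc_Icc ((hα j).nonneg ht)] at hj
    · rw [← g.eVariationOn_trunc_Ici ht] at hv
      filter_upwards [eVariationOn.lowerSemicontinuous_aux
        (s := Ici t) (F := fun j => (gs j).trunc ∘ α j)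
        (fun r hr => hlim r (ht.trans hr)) hv] with j hj
      rwa [eVariationOn.comp_eq_of_monotoneOn _ _ ((hα j).1.mono (Ici_subset_Ici.2 ht)),
        (hα j).image_Ici ht, (gs j).eVariationOn_trunc_Ici ((hα j).nonneg ht)] at hj
  rw [g.natParam_arc ht]
  refine (hlim t ht).congr_dist ?_
  refine squeeze_zero (fun _ => dist_nonneg) (fun j => ?_)
    (tendsto_iff_dist_tendsto_zero.1 harc)
  rw [← (gs j).natParam_arc ((hα j).nonneg ht)]
  simpa using (gs j).lipschitzWith_natParam.dist_le_mul ((gs j).arc (α j t)) (g.arc t)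

theorem intervalIntegrable_deriv_natParam (g : SpaceTimeCurve n T) (a b : ℝ) :
    IntervalIntegrable (deriv g.natParam) volume a b := by
  refine (intervalIntegrable_const (c := (1 : ℝ))).mono_fun (aestronglyMeasurable_deriv _ _) ?_
  exact Eventually.of_forall fun t => by simpa using g.norm_deriv_natParam_le t

theorem ae_differentiableAt_natParam (g : SpaceTimeCurve n T) :
    ∀ᵐ t, DifferentiableAt ℝ g.natParam t :=
  g.lipschitzWith_natParam.ae_differentiableAt

/-- A quantitative form of the uniform convexity of the unit ball. -/
theorem norm_sub_le_of_norm_le_one {V : Type*} [NormedAddCommGroup V] [InnerProductSpace ℝ V]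
    {a b : V} (ha : ‖a‖ ≤ 1) (hb : ‖b‖ ≤ 1) {ε : ℝ} (hε : 0 < ε) :
    ‖a - b‖ ≤ ε + 4 / ε * (2 - ‖a + b‖) := by
  have h := parallelogram_law_with_norm ℝ a b
  have h2 : ‖a + b‖ ≤ 2 := (norm_add_le a b).trans (by linarith)
  have h3 := norm_nonneg (a + b)
  have h4 := norm_nonneg (a - b)
  have h5 : ‖a - b‖ ^ 2 ≤ 4 * (2 - ‖a + b‖) := by
    nlinarith [norm_nonneg a, norm_nonneg b, mul_nonneg (sub_nonneg.2 h2) (sub_nonneg.2 h2)]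
  have h6 : ‖a - b‖ ≤ ε + ‖a - b‖ ^ 2 / ε := by
    rw [← sub_le_iff_le_add', le_div_iff₀ hε]
    nlinarith [sq_nonneg (‖a - b‖ - ε)]
  calc _ ≤ ε + ‖a - b‖ ^ 2 / ε := h6
    _ ≤ ε + 4 * (2 - ‖a + b‖) / ε := by gcongr
    _ = _ := by ring

/-- The sums `ĝⱼ + ĝ` of the natural parameterizations converge to `2ĝ`, so that in the limit they
are at least as long as `2ĝ`. As the velocities of `ĝⱼ` and `ĝ` lie in the unit ball, which is
uniformly convex, these velocities must be close to each other in `L¹`. -/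
theorem tendsto_integral_deriv_natParam_Icc
    (h : Tendsto (fun j => (gs j).cls) atTop (𝓝 g.cls)) :
    Tendsto (fun j => ∫ r in (0 : ℝ)..g.length, ‖deriv (gs j).natParam r - deriv g.natParam r‖)
      atTop (𝓝 0) := by
  set L := g.length with hL
  have hL0 : 0 ≤ L := g.length_nonneg
  have hac : ∀ g : SpaceTimeCurve n T, AbsolutelyContinuousOnInterval g.natParam 0 L := fun g =>
    (g.lipschitzWith_natParam.lipschitzOnWith (s := uIcc 0 L)).absolutelyContinuousOnInterval
  have hvar : ∀ g₁ g₂ : SpaceTimeCurve n T,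
      eVariationOn (g₁.natParam + g₂.natParam) (Icc 0 L) =
        ENNReal.ofReal (∫ r in (0 : ℝ)..L, ‖deriv g₁.natParam r + deriv g₂.natParam r‖) := by
    intro g₁ g₂
    have hac' : AbsolutelyContinuousOnInterval (g₁.natParam + g₂.natParam) 0 L :=
      (hac g₁).add (hac g₂)
    have hbv := hac'.boundedVariationOn
    rw [uIcc_of_le hL0] at hbv
    rw [← ENNReal.ofReal_toReal hbv, ← integral_norm_deriv_eq_variation hL0 hac']
    congr 1
    refine intervalIntegral.integral_congr_ae ?_
    filter_upwards [g₁.ae_differentiableAt_natParam, g₂.ae_differentiableAt_natParam]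
      with r h1 h2 _
    rw [deriv_add h1 h2]
  have hspeed : ∫ r in (0 : ℝ)..L, ‖deriv g.natParam r + deriv g.natParam r‖ = 2 * L := by
    have e : ∀ r, ‖deriv g.natParam r + deriv g.natParam r‖ = 2 * ‖deriv g.natParam r‖ := by
      intro r
      rw [← two_smul ℝ, norm_smul, Real.norm_two]
    simp_rw [e]
    rw [intervalIntegral.integral_const_mul, integral_norm_deriv_eq_variation hL0 (hac g), hL,
      g.eVariationOn_natParam, ENNReal.toReal_ofReal g.length_nonneg]
  have hlsc : ∀ c < 2 * L, ∀ᶠ j in atTop,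
      c < ∫ r in (0 : ℝ)..L, ‖deriv (gs j).natParam r + deriv g.natParam r‖ := by
    intro c hc
    refine eventually_lt_of_ofReal
      (fun j => intervalIntegral.integral_nonneg hL0 fun _ _ => norm_nonneg _) (fun v hv => ?_) hc
    rw [← hspeed, ← hvar g g] at hv
    filter_upwards [eVariationOn.lowerSemicontinuous_aux
      (F := fun j => (gs j).natParam + g.natParam)
      (fun r hr => (tendsto_natParam h hr).add_const _) hv] with j hj
    rwa [hvar] at hj
  have hbound : ∀ ε > 0, ∀ᶠ j in atTop,
      ∫ r in (0 : ℝ)..L, ‖deriv (gs j).natParam r - deriv g.natParam r‖ ≤ ε * (L + 4) := by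
    intro ε hε
    filter_upwards [hlsc (2 * L - ε ^ 2) (by have := pow_pos hε 2; linarith)] with j hj
    have i1 := ((gs j).intervalIntegrable_deriv_natParam 0 L).sub
      (g.intervalIntegrable_deriv_natParam 0 L)
    have i2 := (((gs j).intervalIntegrable_deriv_natParam 0 L).add
      (g.intervalIntegrable_deriv_natParam 0 L)).norm
    have i3 : IntervalIntegrable (fun r => 2 - ‖deriv (gs j).natParam r + deriv g.natParam r‖)
        volume 0 L := intervalIntegrable_const.sub i2
    calc _ ≤ ∫ r in (0 : ℝ)..L,
          (ε + 4 / ε * (2 - ‖deriv (gs j).natParam r + deriv g.natParam r‖)) :=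
          intervalIntegral.integral_mono_on hL0 i1.norm
            (intervalIntegrable_const.add (i3.const_mul _))
            fun r _ => norm_sub_le_of_norm_le_one ((gs j).norm_deriv_natParam_le r)
              (g.norm_deriv_natParam_le r) hε
      _ = ε * L + 4 / ε * (2 * L -
          ∫ r in (0 : ℝ)..L, ‖deriv (gs j).natParam r + deriv g.natParam r‖) := by
          rw [intervalIntegral.integral_add intervalIntegrable_const (i3.const_mul _),
            intervalIntegral.integral_const, intervalIntegral.integral_const_mul,
            intervalIntegral.integral_sub intervalIntegrable_const i2,
            intervalIntegral.integral_const]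
          simp only [smul_eq_mul]
          ring
      _ ≤ ε * L + 4 / ε * ε ^ 2 := by gcongr; linarith
      _ = _ := by field_simp
  refine tendsto_order.2 ⟨fun c hc => Eventually.of_forall fun j => hc.trans_le
    (intervalIntegral.integral_nonneg hL0 fun _ _ => norm_nonneg _), fun c hc => ?_⟩
  have hL4 : 0 < L + 4 := by linarith
  filter_upwards [hbound (c / 2 / (L + 4)) (by positivity)] with j hj
  rw [div_mul_cancel₀ _ hL4.ne'] at hj
  linarith

theorem tendsto_integral_deriv_natParam
    (h : Tendsto (fun j => (gs j).cls) atTop (𝓝 g.cls)) {A : ℝ} (hA : g.length ≤ A)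
    (hAs : ∀ j, (gs j).length ≤ A) :
    Tendsto (fun j => ∫ r in (0 : ℝ)..A, ‖deriv (gs j).natParam r - deriv g.natParam r‖)
      atTop (𝓝 0) := by
  have hmax : Tendsto (fun j => 2 * (max g.length (gs j).length - g.length)) atTop (𝓝 0) := by
    have := (tendsto_const_nhds (x := g.length)).max (tendsto_length h)
    simpa using (this.sub_const g.length).const_mul 2
  have hsum := (tendsto_integral_deriv_natParam_Icc h).add hmax
  rw [add_zero] at hsum
  refine squeeze_zero (fun j => intervalIntegral.integral_nonneg (g.length_nonneg.trans hA)
    fun _ _ => norm_nonneg _) (fun j => ?_) hsum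
  set m := max g.length (gs j).length with hm
  have hi : ∀ a b, IntervalIntegrable
      (fun r => ‖deriv (gs j).natParam r - deriv g.natParam r‖) volume a b := fun a b =>
    (((gs j).intervalIntegrable_deriv_natParam a b).sub
      (g.intervalIntegrable_deriv_natParam a b)).norm
  have hLm : g.length ≤ m := le_max_left _ _
  have hmA : m ≤ A := max_le hA (hAs j)
  rw [← intervalIntegral.integral_add_adjacent_intervals (hi 0 g.length) (hi _ A),
    ← intervalIntegral.integral_add_adjacent_intervals (hi g.length m) (hi m A)]
  have h1 : ∫ r in g.length..m, ‖deriv (gs j).natParam r - deriv g.natParam r‖ ≤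
      2 * (m - g.length) := by
    calc _ ≤ ∫ r in g.length..m, (2 : ℝ) :=
          intervalIntegral.integral_mono_on hLm (hi _ _) intervalIntegrable_const fun r _ =>
            (norm_sub_le _ _).trans (by
              linarith [(gs j).norm_deriv_natParam_le r, g.norm_deriv_natParam_le r])
      _ = _ := by rw [intervalIntegral.integral_const, smul_eq_mul, mul_comm]
  have h2 : ∫ r in m..A, ‖deriv (gs j).natParam r - deriv g.natParam r‖ = 0 := by
    rw [intervalIntegral.integral_of_le hmA]
    refine setIntegral_eq_zero_of_forall_eq_zero fun r hr => ?_
    rw [g.deriv_natParam_of_gt (hLm.trans_lt hr.1),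
      (gs j).deriv_natParam_of_gt ((le_max_right _ _).trans_lt hr.1), sub_zero, norm_zero]
  rw [h2, add_zero]
  exact add_le_add le_rfl h1

end SpaceTimeCurve

/-! ### Estimates of the Fréchet distance -/

/-- An absolutely continuous function with slopes bounded below by `e > 0` is a reparameterization,
its inverse being `e⁻¹`-Lipschitz. -/
theorem isReparam_of_le_sub {q : ℝ → ℝ} {e : ℝ} (he : 0 < e) (hq : LocallyAC q) (h0 : q 0 = 0)
    (h : ∀ a b, 0 ≤ a → a ≤ b → e * (b - a) ≤ q b - q a) : IsReparam q := by
  have hm : StrictMonoOn q (Ici 0) := fun a ha b _ hab => by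
    have := h a b ha hab.le
    have := mul_pos he (sub_pos.2 hab)
    linarith
  have hmaps : MapsTo q (Ici 0) (Ici 0) := fun a ha => by
    have := hm.monotoneOn self_mem_Ici ha ha
    rwa [h0] at this
  have hsurj : SurjOn q (Ici 0) (Ici 0) := by
    intro x hx
    have hx' : 0 ≤ x / e := div_nonneg hx he.le
    have hc := (hq (x / e) hx').continuousOn
    rw [uIcc_of_le hx'] at hc
    have h1 := h 0 (x / e) le_rfl hx'
    rw [sub_zero, h0, sub_zero, mul_div_cancel₀ _ he.ne'] at h1
    obtain ⟨t, ht, hxt⟩ := intermediate_value_Icc hx' hc ⟨h0.trans_le hx, h1⟩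
    exact ⟨t, ht.1, hxt⟩
  have hbij : BijOn q (Ici 0) (Ici 0) := ⟨hmaps, hm.injOn, hsurj⟩
  have hinv := hbij.invOn_invFunOn
  have hmaps' : MapsTo (Function.invFunOn q (Ici 0)) (Ici 0) (Ici 0) := hsurj.mapsTo_invFunOn
  refine ⟨hm.monotoneOn, hbij, hq, _, hinv, hmaps', fun b hb => ?_⟩
  refine absolutelyContinuousOnInterval_of_dist_le (C := e⁻¹) (isReparam_id.2.2.1 b hb) ?_
  rw [uIcc_of_le hb]
  intro x hx y hy
  have key : ∀ a, 0 ≤ a → ∀ b, 0 ≤ b → dist a b ≤ e⁻¹ * dist (q a) (q b) := by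
    intro a ha b hb
    wlog hab : a ≤ b generalizing a b
    · rw [dist_comm, dist_comm (q a)]
      exact this b hb a ha (le_of_not_ge hab)
    have := h a b ha hab
    rw [dist_comm, Real.dist_eq, dist_comm, Real.dist_eq, abs_of_nonneg (sub_nonneg.2 hab),
      inv_mul_eq_div, le_div_iff₀ he, mul_comm]
    exact this.trans (le_abs_self _)
  have := key _ (hmaps' hx.1) _ (hmaps' hy.1)
  rwa [hinv.2 hx.1, hinv.2 hy.1] at this

theorem LocallyAC.add_mul {s : ℝ → ℝ} (hs : LocallyAC s) (e : ℝ) :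
    LocallyAC (fun t => s t + e * t) := fun b hb =>
  (hs b hb).fun_add ((isReparam_id.2.2.1 b hb).const_mul e)

theorem frechetDist_congr {X : Type*} [PseudoMetricSpace X] {g₁ g₂ h₁ h₂ : ℝ → X}
    (hg : EqOn g₁ g₂ (Ici 0)) (hh : EqOn h₁ h₂ (Ici 0)) :
    frechetDist g₁ h₁ = frechetDist g₂ h₂ := by
  simp only [frechetDist]
  refine iInf_congr fun α => iInf_congr fun hα => iSup_congr fun t => iSup_congr fun ht => ?_
  rw [hg ht, hh (hα.nonneg ht)]

theorem frechetDist_le_of_dist_le {X : Type*} [PseudoMetricSpace X] {g h : ℝ → X} {α : ℝ → ℝ}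
    (hα : IsReparam α) {c : ℝ} (H : ∀ t, 0 ≤ t → dist (g t) (h (α t)) ≤ c) :
    frechetDist g h ≤ ENNReal.ofReal c :=
  iInf₂_le_of_le α hα (iSup₂_le fun t ht => by
    rw [edist_dist]
    exact ENNReal.ofReal_le_ofReal (H t ht))

/-- Curves that factor through arc lengths `s₁`, `s₂` are compared by matching the parameters `t₁`
and `t₂` for which `s₁(t₁) + e t₁ = s₂(t₂) + e t₂`, with a small `e > 0`. -/
theorem frechetDist_comp_arc_le {n : ℕ} {T : ℝ} (g₁ g₂ : SpaceTimeCurve n T) {X : Type*}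
    [PseudoMetricSpace X] {Y₁ Y₂ : ℝ → X} {η M : ℝ} (hM : 0 ≤ M)
    (hY : ∀ σ ∈ Icc 0 g₁.length, dist (Y₁ σ) (Y₂ σ) ≤ η)
    (hY₂ : ∀ σ ∈ Icc 0 g₁.length, ∀ τ ∈ Icc 0 g₂.length, dist (Y₂ σ) (Y₂ τ) ≤ M * |σ - τ|) :
    frechetDist (fun t => Y₁ (g₁.arc t)) (fun t => Y₂ (g₂.arc t)) ≤
      ENNReal.ofReal (η + M * |g₁.length - g₂.length|) := by
  refine ENNReal.le_of_forall_pos_le_add fun ε hε _ => ?_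
  set R : ℝ := g₁.exitParam + g₂.exitParam with hR
  have hS₁ := g₁.exitParam_nonneg
  have hS₂ := g₂.exitParam_nonneg
  have hMR : 0 ≤ M * R := mul_nonneg hM (add_nonneg hS₁ hS₂)
  have hε' : (0 : ℝ) < ε := hε
  set e : ℝ := ε / (M * R + 1) with he
  have he0 : 0 < e := by positivity
  have hrep : ∀ g : SpaceTimeCurve n T, IsReparam (fun t => g.arc t + e * t) := fun g =>
    isReparam_of_le_sub he0 (g.locallyAC_arc.add_mul e) (by simp [g.arc_zero]) fun a b ha hab => by
      have := g.monotoneOn_arc ha (ha.trans hab) hab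
      linarith
  obtain ⟨β, hβ, hinv⟩ := (hrep g₂).exists_inv
  set α : ℝ → ℝ := fun t => β (g₁.arc t + e * t) with hα
  have hαr : IsReparam α := (hrep g₁).comp hβ
  have hαeq : ∀ t, 0 ≤ t → g₂.arc (α t) + e * α t = g₁.arc t + e * t := fun t ht =>
    hinv.2 ((hrep g₁).nonneg ht)
  have hclose : ∀ t, 0 ≤ t →
      |g₁.arc t - g₂.arc (α t)| ≤ |g₁.length - g₂.length| + e * R := by
    intro t ht
    have hα0 : 0 ≤ α t := hαr.nonneg ht
    have h1 := hαeq t ht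
    have h2 := (g₁.arc_mem ht).2
    have h3 := (g₂.arc_mem hα0).2
    have h4 := abs_nonneg (g₁.length - g₂.length)
    have h5 := le_abs_self (g₁.length - g₂.length)
    have h6 := neg_abs_le (g₁.length - g₂.length)
    have h7 := mul_nonneg he0.le hS₁
    have h8 := mul_nonneg he0.le hS₂
    have h9 := mul_nonneg he0.le ht
    have h10 := mul_nonneg he0.le hα0
    rw [hR, mul_add]
    rcases le_total t g₁.exitParam with c1 | c1 <;>
      rcases le_total (α t) g₂.exitParam with c2 | c2
    · have := mul_le_mul_of_nonneg_left c1 he0.le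
      have := mul_le_mul_of_nonneg_left c2 he0.le
      rw [abs_le]; constructor <;> linarith
    · rw [g₂.arc_of_ge c2] at h1 ⊢
      have := mul_le_mul_of_nonneg_left c1 he0.le
      rw [abs_le]; constructor <;> linarith
    · rw [g₁.arc_of_ge c1] at h1 ⊢
      have := mul_le_mul_of_nonneg_left c2 he0.le
      rw [abs_le]; constructor <;> linarith
    · rw [g₁.arc_of_ge c1, g₂.arc_of_ge c2]
      linarith
  have hη : 0 ≤ η := dist_nonneg.trans (hY 0 ⟨le_rfl, g₁.length_nonneg⟩)
  rw [← ENNReal.ofReal_coe_nnreal, ← ENNReal.ofReal_add (by positivity) hε'.le]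
  refine frechetDist_le_of_dist_le hαr fun t ht => ?_
  have hm1 := g₁.arc_mem ht
  refine (dist_triangle _ _ _).trans ((add_le_add (hY _ hm1)
    (hY₂ _ hm1 _ (g₂.arc_mem (hαr.nonneg ht)))).trans ?_)
  have h1 := mul_le_mul_of_nonneg_left (hclose t ht) hM
  have h2 : M * (e * R) ≤ ε := by
    rw [he, ← mul_assoc, mul_comm M, mul_assoc, div_mul_eq_mul_div, div_le_iff₀ (by positivity)]
    nlinarith
  linarith

/-! ### The control system as an equation driven by a space-time curve -/

section field

variable {n k : ℕ} {T : ℝ}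

/-- The control system as one field of linear maps: `y ↦ ((v, w) ↦ v f(y) + ∑ᵢ wᵢ gᵢ(y))`. -/
noncomputable def systemField (f : Space n → Space n) (G : Fin k → Space n → Space n)
    (y : Space n) : SpaceTime k →L[ℝ] Space n :=
  (WithLp.fstL 2 ℝ ℝ (Space k)).smulRight (f y) +
    ∑ i, ((EuclideanSpace.proj i).comp (WithLp.sndL 2 ℝ ℝ (Space k))).smulRight (G i y)

theorem systemField_apply (f : Space n → Space n) (G : Fin k → Space n → Space n) (y : Space n)
    (p : SpaceTime k) : systemField f G y p = p.fst • f y + ∑ i, p.snd i • G i y := by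
  simp [systemField]

theorem locallyLipschitz_systemField {f : Space n → Space n} {G : Fin k → Space n → Space n}
    (hf : LocallyLipschitz f) (hG : ∀ i, LocallyLipschitz (G i)) :
    LocallyLipschitz (systemField f G) := by
  have key : ∀ (c : SpaceTime k →L[ℝ] ℝ) {φ : Space n → Space n}, LocallyLipschitz φ →
      LocallyLipschitz fun y => c.smulRight (φ y) := fun c φ hφ =>
    (ContinuousLinearMap.smulRightL ℝ (SpaceTime k) (Space n) c).lipschitz.locallyLipschitz.comp hφ
  have hsum : ∀ s : Finset (Fin k), LocallyLipschitz fun y => ∑ i ∈ s,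
      ((EuclideanSpace.proj i).comp (WithLp.sndL 2 ℝ ℝ (Space k)) :
        SpaceTime k →L[ℝ] ℝ).smulRight (G i y) := by
    intro s
    induction s using Finset.induction_on with
    | empty => simpa using LocallyLipschitz.const (0 : SpaceTime k →L[ℝ] Space n)
    | insert i s his ih =>
      simp_rw [Finset.sum_insert his]
      exact (key _ (hG i)).add ih
  exact (key _ hf).add (hsum _)

theorem hasDerivAt_fst {g : ℝ → SpaceTime k} {t : ℝ} {g' : SpaceTime k} (h : HasDerivAt g g' t) :
    HasDerivAt (fun s => (g s).fst) g'.fst t :=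
  (WithLp.fstL 2 ℝ ℝ (Space k)).hasFDerivAt.comp_hasDerivAt t h

theorem hasDerivAt_snd {g : ℝ → SpaceTime k} {t : ℝ} {g' : SpaceTime k} (h : HasDerivAt g g' t) :
    HasDerivAt (fun s => (g s).snd) g'.snd t :=
  (WithLp.sndL 2 ℝ ℝ (Space k)).hasFDerivAt.comp_hasDerivAt t h

theorem hasDerivAt_toLp {a : ℝ → ℝ} {y : ℝ → Space k} {t a' : ℝ} {y' : Space k}
    (ha : HasDerivAt a a' t) (hy : HasDerivAt y y' t) :
    HasDerivAt (fun s => (WithLp.toLp 2 (a s, y s) : SpaceTime k)) (WithLp.toLp 2 (a', y')) t :=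
  (WithLp.prodContinuousLinearEquiv 2 ℝ ℝ (Space k)).symm.toContinuousLinearMap.hasFDerivAt
    |>.comp_hasDerivAt t (ha.prodMk hy)

theorem dist_fst_le (p q : SpaceTime k) : dist p.fst q.fst ≤ dist p q := by
  rw [WithLp.prod_dist_eq_of_L2]
  exact Real.le_sqrt_of_sq_le (le_add_of_nonneg_right (sq_nonneg _))

theorem dist_snd_le (p q : SpaceTime k) : dist p.snd q.snd ≤ dist p q := by
  rw [WithLp.prod_dist_eq_of_L2]
  exact Real.le_sqrt_of_sq_le (le_add_of_nonneg_left (sq_nonneg _))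

theorem dist_toLp_le (a b : ℝ) (x y : Space k) :
    dist (WithLp.toLp 2 (a, x) : SpaceTime k) (WithLp.toLp 2 (b, y)) ≤ dist a b + dist x y := by
  rw [WithLp.prod_dist_eq_of_L2]
  refine Real.sqrt_le_iff.2 ⟨by positivity, ?_⟩
  have e1 : 0 ≤ dist a b := dist_nonneg
  have e2 : 0 ≤ dist x y := dist_nonneg
  show dist a b ^ 2 + dist x y ^ 2 ≤ _
  nlinarith [mul_nonneg e1 e2]

theorem absolutelyContinuousOnInterval_toLp {a : ℝ → ℝ} {y : ℝ → Space k} {b c : ℝ}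
    (ha : AbsolutelyContinuousOnInterval a b c) (hy : AbsolutelyContinuousOnInterval y b c) :
    AbsolutelyContinuousOnInterval
      (fun t => (WithLp.toLp 2 (a t, y t) : SpaceTime k)) b c := by
  refine squeeze_zero (fun E => Finset.sum_nonneg fun _ _ => dist_nonneg) (fun E => ?_)
    (by simpa using Tendsto.add ha hy)
  rw [← Finset.sum_add_distrib]
  exact Finset.sum_le_sum fun i _ => dist_toLp_le _ _ _ _

theorem absolutelyContinuousOnInterval_fst {g : ℝ → SpaceTime k} {b c : ℝ}
    (hg : AbsolutelyContinuousOnInterval g b c) :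
    AbsolutelyContinuousOnInterval (fun t => (g t).fst) b c :=
  absolutelyContinuousOnInterval_of_dist_le (C := 1) hg fun p _ q _ => by
    rw [one_mul]; exact dist_fst_le _ _

theorem absolutelyContinuousOnInterval_snd {g : ℝ → SpaceTime k} {b c : ℝ}
    (hg : AbsolutelyContinuousOnInterval g b c) :
    AbsolutelyContinuousOnInterval (fun t => (g t).snd) b c :=
  absolutelyContinuousOnInterval_of_dist_le (C := 1) hg fun p _ q _ => by
    rw [one_mul]; exact dist_snd_le _ _

/-- Almost everywhere the two components of `(V, W)` are differentiable together, so that their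
derivatives are the components of the derivative of `g`. -/
theorem isReducedTrajectory_iff {f : Space n → Space n} {G : Fin k → Space n → Space n}
    {x₀ : Space n} {g : SpaceTimeCurve k T} {y : ℝ → Space n} :
    IsReducedTrajectory f G x₀ g y ↔
      Solves (systemField f G) g.toFun g.exitParam y ∧ y 0 = x₀ := by
  have hd : ∀ᵐ t ∂volume.restrict (Icc 0 g.exitParam), DifferentiableAt ℝ g.toFun t :=
    ae_restrict_of_ae_restrict_of_subset Icc_subset_Ici_self
      (ae_differentiableAt_of_locallyAC g.locallyAC)
  have he : ∀ t, DifferentiableAt ℝ g.toFun t →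
      deriv (fun s => (g.toFun s).fst) t • f (y t) +
        ∑ i, deriv (fun s => (g.toFun s).snd) t i • G i (y t) =
          systemField f G (y t) (deriv g.toFun t) := fun t ht => by
    rw [systemField_apply, (hasDerivAt_fst ht.hasDerivAt).deriv,
      (hasDerivAt_snd ht.hasDerivAt).deriv]
  constructor
  · rintro ⟨h1, h2, h3⟩
    refine ⟨⟨h1, ?_⟩, h2⟩
    filter_upwards [h3, hd] with t h4 h5
    rwa [he t h5] at h4
  · rintro ⟨⟨h1, h3⟩, h2⟩
    refine ⟨h1, h2, ?_⟩
    filter_upwards [h3, hd] with t h4 h5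
    rwa [he t h5]

end field

/-! ### The exit parameter -/

namespace SpaceTimeCurve

variable {n k : ℕ} {T : ℝ}

theorem exitParam_eq_of_forall_lt (g : SpaceTimeCurve n T) {S : ℝ} (hS : 0 ≤ S)
    (h1 : (g.toFun S).fst ≤ T) (h2 : ∀ t, S < t → T < (g.toFun t).fst) : g.exitParam = S :=
  IsGreatest.csSup_eq ⟨⟨hS, h1⟩, fun t ht => by
    by_contra hcon
    exact (h2 t (not_le.1 hcon)).not_ge ht.2⟩

theorem monotoneOn_fst (g : SpaceTimeCurve n T) :
    MonotoneOn (fun t => (g.toFun t).fst) (Ici 0) := by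
  intro a ha b hb hab
  have h := integral_deriv_eq_sub hb (absolutelyContinuousOnInterval_fst (g.locallyAC b hb))
    ⟨ha, hab⟩ ⟨hb, le_rfl⟩
  have h0 : 0 ≤ ∫ t in a..b, deriv (fun s => (g.toFun s).fst) t := by
    refine intervalIntegral.integral_nonneg_of_ae_restrict hab ?_
    exact ae_restrict_of_ae_restrict_of_subset
      (Icc_subset_Ici_self.trans (Ici_subset_Ici.2 ha)) g.deriv_time_nonneg
  rw [h] at h0
  exact sub_nonneg.1 h0

theorem continuousOn_fst (g : SpaceTimeCurve n T) :
    ContinuousOn (fun t => (g.toFun t).fst) (Ici 0) := by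
  intro t ht
  have h := (absolutelyContinuousOnInterval_fst
    (g.locallyAC (t + 1) (by have : 0 ≤ t := ht; linarith))).continuousOn
  have ht0 : 0 ≤ t := ht
  rw [uIcc_of_le (by linarith)] at h
  refine (h t ⟨ht0, by linarith⟩).mono_of_mem_nhdsWithin ?_
  filter_upwards [self_mem_nhdsWithin, mem_nhdsWithin_of_mem_nhds (Iio_mem_nhds (lt_add_one t))]
    with r h1 h2
  exact ⟨h1, le_of_lt h2⟩

theorem bddAbove_fst_le (g : SpaceTimeCurve n T) :
    BddAbove {s : ℝ | 0 ≤ s ∧ (g.toFun s).fst ≤ T} := by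
  obtain ⟨t, ht, h⟩ := g.exists_gt
  refine ⟨t, fun s hs => ?_⟩
  by_contra hcon
  exact (h.trans_le (g.monotoneOn_fst ht hs.1 (not_le.1 hcon).le)).not_ge hs.2

theorem lt_fst_of_exitParam_lt (g : SpaceTimeCurve n T) {t : ℝ} (ht : g.exitParam < t) :
    T < (g.toFun t).fst := by
  by_contra hcon
  exact ht.not_ge (le_csSup g.bddAbove_fst_le
    ⟨g.exitParam_nonneg.trans ht.le, not_lt.1 hcon⟩)

theorem fst_exitParam (g : SpaceTimeCurve n T) (hT : 0 ≤ T) :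
    (g.toFun g.exitParam).fst = T := by
  apply le_antisymm
  · have hcl : IsClosed {s : ℝ | 0 ≤ s ∧ (g.toFun s).fst ≤ T} := by
      have := g.continuousOn_fst.preimage_isClosed_of_isClosed isClosed_Ici (isClosed_Iic (a := T))
      exact this
    exact (hcl.csSup_mem ⟨0, le_rfl, g.time_zero.le.trans hT⟩ g.bddAbove_fst_le).2
  · have hc : ContinuousWithinAt (fun t => (g.toFun t).fst) (Ioi g.exitParam) g.exitParam :=
      (g.continuousOn_fst _ g.exitParam_nonneg).mono
        (Ioi_subset_Ici g.exitParam_nonneg)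
    refine ge_of_tendsto (x := 𝓝[>] g.exitParam) hc.tendsto ?_
    filter_upwards [self_mem_nhdsWithin] with t ht
    exact (g.lt_fst_of_exitParam_lt ht).le

theorem fst_le_of_le_exitParam (g : SpaceTimeCurve n T) (hT : 0 ≤ T) {t : ℝ}
    (ht : t ∈ Icc 0 g.exitParam) : (g.toFun t).fst ≤ T :=
  (g.monotoneOn_fst ht.1 g.exitParam_nonneg ht.2).trans_eq (g.fst_exitParam hT)

/-- The space-time curve `(V, y)` on `[0, V^#(T)]`, where `V` is the time component of `g`; it is
continued with time running at unit speed and `y` at rest. -/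
noncomputable def withSpace (g : SpaceTimeCurve k T) (hT : 0 ≤ T) (y : ℝ → Space n)
    (hy : AbsolutelyContinuousOnInterval y 0 g.exitParam) : SpaceTimeCurve n T where
  toFun t := WithLp.toLp 2
    ((g.toFun (min t g.exitParam)).fst + max 0 (t - g.exitParam), y (min t g.exitParam))
  locallyAC b hb := by
    have hmin := locallyAC_min_const g.exitParam b hb
    have hmax : AbsolutelyContinuousOnInterval (fun t : ℝ => max 0 (t - g.exitParam)) 0 b :=
      absolutelyContinuousOnInterval_of_dist_le (C := 1) (isReparam_id.2.2.1 b hb)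
        fun p _ q _ => by
          have := (LipschitzWith.id.const_max (0 : ℝ)).dist_le_mul (p - g.exitParam)
            (q - g.exitParam)
          simpa using this
    refine absolutelyContinuousOnInterval_toLp (AbsolutelyContinuousOnInterval.fun_add ?_ hmax) ?_
    · exact absolutelyContinuousOnInterval_comp (g := fun t => (g.toFun t).fst)
        (φ := fun t => min t g.exitParam) hb g.exitParam_nonneg
        (absolutelyContinuousOnInterval_fst g.ac) hmin (fun _ _ _ _ h => min_le_min_right _ h)
        fun t ht => g.min_mem ht.1
    · exact absolutelyContinuousOnInterval_comp (φ := fun t => min t g.exitParam) hb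
        g.exitParam_nonneg hy hmin (fun _ _ _ _ h => min_le_min_right _ h)
        fun t ht => g.min_mem ht.1
  time_zero := by
    simp [g.exitParam_nonneg, g.time_zero]
  deriv_time_nonneg := by
    rw [← restrict_Ioi_eq_restrict_Ici]
    refine ae_restrict_of_forall_mem measurableSet_Ioi fun t ht => ?_
    have hm : MonotoneOn (fun t => (g.toFun (min t g.exitParam)).fst + max 0 (t - g.exitParam))
        (Ici 0) := fun a ha b hb hab =>
      add_le_add (g.monotoneOn_fst (g.min_mem ha).1 (g.min_mem hb).1 (min_le_min_right _ hab))
        (max_le_max le_rfl (sub_le_sub_right hab _))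
    have := hm.derivWithin_nonneg (x := t)
    rwa [derivWithin_of_mem_nhds (Ici_mem_nhds ht)] at this
  infinite_length := by
    refine top_unique ?_
    calc (⊤ : ℝ≥0∞) = ∫⁻ t in Ioi g.exitParam, 1 := by simp
      _ ≤ ∫⁻ t in Ioi g.exitParam, _ := by
          refine setLIntegral_mono' measurableSet_Ioi fun t ht => ?_
          have ht' : g.exitParam < t := ht
          have hd : HasDerivAt (fun r => (WithLp.toLp 2 ((g.toFun g.exitParam).fst +
              (r - g.exitParam), y g.exitParam) : SpaceTime n)) (WithLp.toLp 2 (1, 0)) t :=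
            hasDerivAt_toLp (((hasDerivAt_id t).sub_const _).const_add _) (hasDerivAt_const t _)
          have he : (fun t => (WithLp.toLp 2 ((g.toFun (min t g.exitParam)).fst +
              max 0 (t - g.exitParam), y (min t g.exitParam)) : SpaceTime n)) =ᶠ[𝓝 t]
              fun r => WithLp.toLp 2 ((g.toFun g.exitParam).fst + (r - g.exitParam),
                y g.exitParam) := by
            filter_upwards [Ioi_mem_nhds ht'] with r hr
            have hr' : g.exitParam < r := hr
            rw [min_eq_right hr'.le, max_eq_right (sub_pos.2 hr').le]
          rw [he.deriv_eq, hd.deriv, ← ofReal_norm]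
          simp
      _ ≤ _ := lintegral_mono_set (Ioi_subset_Ici g.exitParam_nonneg)
  exists_gt := by
    refine ⟨g.exitParam + 1, by linarith [g.exitParam_nonneg], ?_⟩
    simp [g.fst_exitParam hT]

end SpaceTimeCurve

/-! ### Solutions along the natural parameterization -/

section Cutoff

variable {E H : Type*} [NormedAddCommGroup E] [NormedSpace ℝ E]
  [NormedAddCommGroup H] [NormedSpace ℝ H]
  {F F' : E → H →L[ℝ] E} {g : ℝ → H} {y y₁ y₂ : ℝ → E} {A : ℝ}

theorem Solves.congr_field (h : Solves F g A y) (hFF' : ∀ t ∈ Icc 0 A, F (y t) = F' (y t)) :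
    Solves F' g A y := by
  refine ⟨h.ac, ?_⟩
  filter_upwards [h.ae_hasDerivAt, ae_restrict_mem measurableSet_Icc] with t ht htm
  rwa [← hFF' t htm]

theorem Solves.congr (h : Solves F g A y) {z : ℝ → E} (hA : 0 ≤ A) (hyz : EqOn y z (Icc 0 A)) :
    Solves F g A z := by
  refine ⟨absolutelyContinuousOnInterval_of_dist_le (C := 1) h.ac fun p hp q hq => ?_, ?_⟩
  · rw [uIcc_of_le hA] at hp hq
    rw [one_mul, hyz hp, hyz hq]
  · have h1 := h.ae_hasDerivAt
    rw [← restrict_Ioo_eq_restrict_Icc] at h1 ⊢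
    filter_upwards [h1, ae_restrict_mem measurableSet_Ioo] with t ht htm
    rw [← hyz (Ioo_subset_Icc_self htm)]
    refine ht.congr_of_eventuallyEq ?_
    filter_upwards [Icc_mem_nhds htm.1 htm.2] with r hr
    exact (hyz hr).symm

theorem Solves.mono (h : Solves F g A y) {B : ℝ} (hB : 0 ≤ B) (hBA : B ≤ A) : Solves F g B y :=
  ⟨h.ac.mono (by rw [uIcc_of_le hB, uIcc_of_le (hB.trans hBA)]; exact Icc_subset_Icc_right hBA),
    ae_restrict_of_ae_restrict_of_subset (Icc_subset_Icc_right hBA) h.ae_hasDerivAt⟩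

theorem Solves.exists_norm_le (h : Solves F g A y) (hA : 0 ≤ A) :
    ∃ R, ∀ t ∈ Icc 0 A, ‖y t‖ ≤ R := by
  obtain ⟨R, hR⟩ := h.ac.exists_bound
  rw [uIcc_of_le hA] at hR
  exact ⟨R, hR⟩

variable [FiniteDimensional ℝ E]

theorem Solves.eq_of_deriv_eq_zero (h : Solves F g A y) {a b : ℝ} (ha : a ∈ Icc 0 A)
    (hb : b ∈ Icc 0 A) (hab : a ≤ b) (h0 : ∀ t, a < t → deriv g t = 0) : y b = y a := by
  rw [← sub_eq_zero, (h.sub_eq_integral (ha.1.trans ha.2) ha hb hab).2,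
    intervalIntegral.integral_of_le hab]
  exact setIntegral_eq_zero_of_forall_eq_zero fun t ht => by rw [h0 t ht.1, map_zero]

variable [FiniteDimensional ℝ H]

/-- A locally Lipschitz field agrees on a given ball with a globally Lipschitz one. -/
theorem exists_lipschitzWith_eqOn_closedBall (hF : LocallyLipschitz F) (R : ℝ) :
    ∃ (K : NNReal) (F' : E → H →L[ℝ] E),
      LipschitzWith K F' ∧ EqOn F F' (Metric.closedBall 0 R) := by
  obtain ⟨K, hK⟩ := hF.locallyLipschitzOn.exists_lipschitzOnWith_of_compact
    (isCompact_closedBall (0 : E) R)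
  obtain ⟨F', h1, h2⟩ := hK.extend_finite_dimension
  exact ⟨_, F', h1, h2⟩

theorem Solves.eqOn (hF : LocallyLipschitz F) (hA : 0 ≤ A) (hg : LipschitzWith 1 g)
    (h₁ : Solves F g A y₁) (h₂ : Solves F g A y₂) (h0 : y₁ 0 = y₂ 0) :
    EqOn y₁ y₂ (Icc 0 A) := by
  obtain ⟨R₁, hR₁⟩ := h₁.exists_norm_le hA
  obtain ⟨R₂, hR₂⟩ := h₂.exists_norm_le hA
  obtain ⟨K, F', hF', he⟩ := exists_lipschitzWith_eqOn_closedBall hF (max R₁ R₂)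
  obtain ⟨M, hM⟩ := (isCompact_closedBall (0 : E) (max R₁ R₂)).exists_bound_of_continuousOn
    hF'.continuous.continuousOn
  have hb₁ : ∀ t ∈ Icc 0 A, y₁ t ∈ Metric.closedBall 0 (max R₁ R₂) := fun t ht =>
    mem_closedBall_zero_iff.2 ((hR₁ t ht).trans (le_max_left _ _))
  have hb₂ : ∀ t ∈ Icc 0 A, y₂ t ∈ Metric.closedBall 0 (max R₁ R₂) := fun t ht =>
    mem_closedBall_zero_iff.2 ((hR₂ t ht).trans (le_max_right _ _))
  have key := (Solves.dist_le_of_lipschitz hF' hA hg hg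
    (h₁.congr_field fun t ht => he (hb₁ t ht)) (h₂.congr_field fun t ht => he (hb₂ t ht)) h0
    fun t ht => hM _ (hb₂ t ht)).1
  intro t ht
  have := key t ht
  simp only [sub_self, norm_zero, intervalIntegral.integral_zero, mul_zero, zero_mul] at this
  exact sub_eq_zero.1 (norm_le_zero_iff.1 this)

end Cutoff

namespace SpaceTimeCurve

variable {n k : ℕ} {T : ℝ}

theorem integral_norm_deriv_natParam_le (g : SpaceTimeCurve k T) {a b : ℝ} (hab : a ≤ b) :
    ∫ t in a..b, ‖deriv g.natParam t‖ ≤ b - a := by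
  calc _ ≤ ∫ _ in a..b, (1 : ℝ) :=
        intervalIntegral.integral_mono_on hab (g.intervalIntegrable_deriv_natParam a b).norm
          intervalIntegrable_const fun t _ => g.norm_deriv_natParam_le t
    _ = _ := by simp

theorem ac_natParam (g : SpaceTimeCurve k T) (A : ℝ) :
    AbsolutelyContinuousOnInterval g.natParam 0 A :=
  (g.lipschitzWith_natParam.lipschitzOnWith (s := uIcc 0 A)).absolutelyContinuousOnInterval

variable {E : Type*} [NormedAddCommGroup E] [NormedSpace ℝ E] [FiniteDimensional ℝ E]
  {F : E → SpaceTime k →L[ℝ] E} {g : SpaceTimeCurve k T} {y : ℝ → E} {A : ℝ}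

theorem incrementEstimate_natParam (hF : LocallyLipschitz F) (hA : 0 ≤ A)
    (h : Solves F g.natParam A y) : IncrementEstimate F g.natParam (fun σ => σ) A y :=
  h.incrementEstimate hF hA (g.ac_natParam A) fun _ _ _ _ hab =>
    g.integral_norm_deriv_natParam_le hab

/-- A solution along `g` factors through the arc length, and the factor solves the equation along
the natural parameterization. -/
theorem solves_natParam (hF : LocallyLipschitz F) (h : Solves F g.toFun g.exitParam y) :
    Solves F g.natParam g.length (fun σ => y (g.paramOfArc σ)) ∧
      ∀ t ∈ Icc 0 g.exitParam, y (g.paramOfArc (g.arc t)) = y t := by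
  have hest : IncrementEstimate F g.toFun g.arc g.exitParam y :=
    h.incrementEstimate hF g.exitParam_nonneg g.ac fun a ha b hb _ => (g.arc_sub_arc ha hb).ge
  refine ⟨?_, fun t ht => ?_⟩
  · have h2 := hest.comp g.monotoneOn_paramOfArc fun σ _ => g.paramOfArc_mem σ
    have h3 : IncrementEstimate F g.natParam (fun σ => σ) g.length (fun σ => y (g.paramOfArc σ)) :=
      h2.congr (fun _ _ => rfl) (fun σ hσ => g.arc_paramOfArc hσ) fun _ _ => rfl
    exact h3.solves g.length_nonneg (g.ac_natParam _) (isReparam_id.2.2.1 _ g.length_nonneg)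
      fun _ _ _ _ hab => hab
  · exact hest.eq_of_eq (g.paramOfArc_mem _) ht (g.arc_paramOfArc (g.arc_mem ht.1))

theorem solves_comp_arc (hF : LocallyLipschitz F) (h : Solves F g.natParam g.length y) :
    Solves F g.toFun g.exitParam (fun t => y (g.arc t)) := by
  have h2 := (incrementEstimate_natParam hF g.length_nonneg h).comp
    (g.monotoneOn_arc.mono Icc_subset_Ici_self) fun t (ht : t ∈ Icc 0 g.exitParam) => g.arc_mem ht.1
  have h3 : IncrementEstimate F g.toFun g.arc g.exitParam (fun t => y (g.arc t)) :=
    h2.congr (fun t ht => (g.natParam_arc ht.1).trans (by rw [trunc, min_eq_left ht.2]))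
      (fun _ _ => rfl) fun _ _ => rfl
  exact h3.solves g.exitParam_nonneg g.ac (g.locallyAC_arc _ g.exitParam_nonneg)
    (g.monotoneOn_arc.mono Icc_subset_Ici_self)

/-- Continuous dependence on the driving curve: a solution along the limit persists along the
converging curves. All natural parameterizations are considered on one interval `[0, A]`, on which
they are at rest beyond their lengths. -/
theorem exists_solves_tendsto (hF : LocallyLipschitz F) {gs : ℕ → SpaceTimeCurve k T}
    (hgs : Tendsto (fun j => (gs j).cls) atTop (𝓝 g.cls)) (h : Solves F g.natParam g.length y)
    (hA : g.length ≤ A) (hAs : ∀ j, (gs j).length ≤ A) :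
    ∃ (Y : ℝ → E) (Ys : ℕ → ℝ → E), Solves F g.natParam A Y ∧ Y 0 = y 0 ∧
      (∀ᶠ j in atTop, Solves F (gs j).natParam A (Ys j) ∧ Ys j 0 = y 0) ∧
      (∃ δ : ℕ → ℝ, Tendsto δ atTop (𝓝 0) ∧ ∀ j, ∀ t ∈ Icc 0 A, ‖Ys j t - Y t‖ ≤ δ j) ∧
      Tendsto (fun j => ∫ r in (0 : ℝ)..A, ‖deriv (Ys j) r - deriv Y r‖) atTop (𝓝 0) := by
  have hA0 : 0 ≤ A := g.length_nonneg.trans hA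
  obtain ⟨R, hR⟩ := h.exists_norm_le g.length_nonneg
  obtain ⟨K, F', hF', he⟩ := exists_lipschitzWith_eqOn_closedBall hF (R + 1)
  obtain ⟨Y, hY0, hY⟩ := exists_solves_of_lipschitz hF' g.lipschitzWith_natParam (y 0) hA0
  have hex := fun j => exists_solves_of_lipschitz hF' (gs j).lipschitzWith_natParam (y 0) hA0
  choose Ys hYs0 hYs using hex
  have hball : ∀ t ∈ Icc 0 g.length, F (y t) = F' (y t) := fun t ht =>
    he (mem_closedBall_zero_iff.2 ((hR t ht).trans (le_add_of_nonneg_right zero_le_one)))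
  have hYy : EqOn Y y (Icc 0 g.length) :=
    (hY.mono g.length_nonneg hA).eqOn hF'.locallyLipschitz g.length_nonneg
      g.lipschitzWith_natParam (h.congr_field hball) hY0
  have hYR : ∀ t ∈ Icc 0 A, ‖Y t‖ ≤ R := by
    intro t ht
    rcases le_total t g.length with htL | htL
    · rw [hYy ⟨ht.1, htL⟩]
      exact hR t ⟨ht.1, htL⟩
    · rw [hY.eq_of_deriv_eq_zero ⟨g.length_nonneg, hA⟩ ht htL fun r hr =>
        g.deriv_natParam_of_gt hr, hYy ⟨g.length_nonneg, le_rfl⟩]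
      exact hR _ ⟨g.length_nonneg, le_rfl⟩
  obtain ⟨M, hM⟩ := (isCompact_closedBall (0 : E) R).exists_bound_of_continuousOn
    hF'.continuous.continuousOn
  have hest := fun j => Solves.dist_le_of_lipschitz hF' hA0 (gs j).lipschitzWith_natParam
    g.lipschitzWith_natParam (hYs j) hY ((hYs0 j).trans hY0.symm)
    fun t ht => hM _ (mem_closedBall_zero_iff.2 (hYR t ht))
  have hD := tendsto_integral_deriv_natParam hgs hA hAs
  have hδ : Tendsto (fun j => M * (∫ r in (0 : ℝ)..A,
      ‖deriv (gs j).natParam r - deriv g.natParam r‖) * Real.exp (K * A)) atTop (𝓝 0) := by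
    simpa using (hD.const_mul M).mul_const (Real.exp (K * A))
  refine ⟨Y, Ys, ?_, hY0, ?_, ⟨_, hδ, fun j => (hest j).1⟩, ?_⟩
  · exact hY.congr_field fun t ht => (he (mem_closedBall_zero_iff.2
      ((hYR t ht).trans (le_add_of_nonneg_right zero_le_one)))).symm
  · filter_upwards [hδ.eventually_lt_const one_pos] with j hj
    refine ⟨(hYs j).congr_field fun t ht => (he (mem_closedBall_zero_iff.2 ?_)).symm, hYs0 j⟩
    have h1 := ((hest j).1 t ht).trans hj.le
    have h2 := hYR t ht
    have h3 := norm_le_norm_add_norm_sub (Y t) (Ys j t)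
    rw [norm_sub_rev] at h1
    linarith
  · refine squeeze_zero (fun j => intervalIntegral.integral_nonneg hA0 fun _ _ => norm_nonneg _)
      (fun j => (hest j).2) ?_
    simpa using (hδ.const_mul (K * A)).add (hD.const_mul M)

end SpaceTimeCurve

/-! ### Continuous dependence of generalized trajectories -/

section Trajectories

variable {n k : ℕ} {T : ℝ} {f : Space n → Space n} {G : Fin k → Space n → Space n} {x₀ : Space n}

/-- The path `(V, y)`, where `V` is the time component of `p = (V, W)`. -/
def lift (p : ℝ → SpaceTime k) (y : ℝ → Space n) : ℝ → SpaceTime n :=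
  fun σ => WithLp.toLp 2 ((p σ).fst, y σ)

theorem isGeneralizedTrajectory_withSpace {g : SpaceTimeCurve k T} (hT : 0 ≤ T) {y : ℝ → Space n}
    (hy : Solves (systemField f G) g.toFun g.exitParam y) (hy0 : y 0 = x₀) :
    IsGeneralizedTrajectory f G x₀ g (g.withSpace hT y hy.ac) := by
  refine ⟨?_, fun t ht => ?_, isReducedTrajectory_iff.2 ⟨?_, ?_⟩⟩
  · refine SpaceTimeCurve.exitParam_eq_of_forall_lt _ g.exitParam_nonneg ?_ fun t ht => ?_
    · simp [SpaceTimeCurve.withSpace, g.fst_exitParam hT]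
    · simp [SpaceTimeCurve.withSpace, g.fst_exitParam hT, min_eq_right ht.le, ht]
  · simp [SpaceTimeCurve.withSpace, ht.2]
  · exact hy.congr g.exitParam_nonneg fun t ht => by simp [SpaceTimeCurve.withSpace, ht.2]
  · simp [SpaceTimeCurve.withSpace, g.exitParam_nonneg, hy0]

theorem IsGeneralizedTrajectory.solves {g : SpaceTimeCurve k T} {h : SpaceTimeCurve n T}
    (H : IsGeneralizedTrajectory f G x₀ g h) :
    Solves (systemField f G) g.toFun g.exitParam (fun t => (h.toFun t).snd) ∧
      (h.toFun 0).snd = x₀ :=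
  isReducedTrajectory_iff.1 H.2.2

theorem IsGeneralizedTrajectory.exists_solves_natParam
    (hF : LocallyLipschitz (systemField f G)) {g : SpaceTimeCurve k T} {h : SpaceTimeCurve n T}
    (H : IsGeneralizedTrajectory f G x₀ g h) :
    ∃ y, Solves (systemField f G) g.natParam g.length y ∧ y 0 = x₀ ∧
      ∀ t, 0 ≤ t → h.trunc t = lift g.natParam y (g.arc t) := by
  obtain ⟨h1, h2⟩ := SpaceTimeCurve.solves_natParam hF H.solves.1
  refine ⟨_, h1, ?_, fun t ht => ?_⟩
  · have := h2 0 g.left_mem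
    rw [g.arc_zero] at this
    exact this.trans H.solves.2
  · have hm := g.min_mem ht
    have e : g.arc (min t g.exitParam) = g.arc t := by simp [SpaceTimeCurve.arc]
    have e1 := H.2.1 _ hm
    have e2 := h2 _ hm
    rw [e] at e2
    rw [lift, g.natParam_arc ht]
    rw [e2, SpaceTimeCurve.trunc, SpaceTimeCurve.trunc, H.1, ← e1]
    rfl

/-- By uniqueness, every solution along the natural parameterization represents the trajectory. -/
theorem IsGeneralizedTrajectory.trunc_eq_lift (hF : LocallyLipschitz (systemField f G))
    {g : SpaceTimeCurve k T} {h : SpaceTimeCurve n T} (H : IsGeneralizedTrajectory f G x₀ g h)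
    {A : ℝ} (hA : g.length ≤ A) {Y : ℝ → Space n} (hY : Solves (systemField f G) g.natParam A Y)
    (hY0 : Y 0 = x₀) : EqOn h.trunc (fun t => lift g.natParam Y (g.arc t)) (Ici 0) := by
  obtain ⟨y, hy, hy0, hyt⟩ := H.exists_solves_natParam hF
  have := (hY.mono g.length_nonneg hA).eqOn hF g.length_nonneg g.lipschitzWith_natParam hy
    (hY0.trans hy0.symm)
  intro t ht
  simp only
  rw [hyt t ht, lift, lift, this (g.arc_mem ht)]

theorem ac_lift {g : SpaceTimeCurve k T} {A : ℝ} {Y : ℝ → Space n}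
    (hY : Solves (systemField f G) g.natParam A Y) :
    AbsolutelyContinuousOnInterval (lift g.natParam Y) 0 A :=
  absolutelyContinuousOnInterval_toLp
    (absolutelyContinuousOnInterval_fst (g.ac_natParam A)) hY.ac

/-- The length may be computed on any `[0, A]` that contains the arc lengths, since the lifted curve
rests after the length of `g`. -/
theorem IsGeneralizedTrajectory.length_eq (hF : LocallyLipschitz (systemField f G))
    {g : SpaceTimeCurve k T} {h : SpaceTimeCurve n T} (H : IsGeneralizedTrajectory f G x₀ g h)
    {A : ℝ} (hA : g.length ≤ A) {Y : ℝ → Space n} (hY : Solves (systemField f G) g.natParam A Y)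
    (hY0 : Y 0 = x₀) : h.length = ∫ σ in (0 : ℝ)..A, ‖deriv (lift g.natParam Y) σ‖ := by
  have hA0 := g.length_nonneg.trans hA
  have hLm : g.length ∈ Icc 0 A := ⟨g.length_nonneg, hA⟩
  have h1 := eVariationOn.comp_eq_of_monotoneOn (lift g.natParam Y) _ g.monotoneOn_arc
  rw [g.image_arc_Ici] at h1
  have h2 : eVariationOn h.trunc (Ici 0) = eVariationOn (lift g.natParam Y ∘ g.arc) (Ici 0) :=
    eVariationOn.congr (H.trunc_eq_lift hF hA hY hY0)
  have h3 := eVariationOn.union (lift g.natParam Y) (isGreatest_Icc g.length_nonneg)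
    (isLeast_Icc hA)
  have hconst : ∀ σ ∈ Icc g.length A, lift g.natParam Y σ = lift g.natParam Y g.length := by
    intro σ hσ
    rw [lift, lift, g.natParam_of_ge hσ.1, hY.eq_of_deriv_eq_zero hLm
      ⟨g.length_nonneg.trans hσ.1, hσ.2⟩ hσ.1 fun r hr => g.deriv_natParam_of_gt hr]
  rw [Icc_union_Icc_eq_Icc g.length_nonneg hA, eVariationOn.constant_on (s := Icc g.length A),
    add_zero] at h3
  · rw [h.length_eq_variation, h2, h1, ← h3, integral_norm_deriv_eq_variation hA0 (ac_lift hY)]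
  · rintro _ ⟨p, hp, rfl⟩ _ ⟨q, hq, rfl⟩
    rw [hconst p hp, hconst q hq]

theorem integral_norm_deriv_lift_sub_le {g₁ g₂ : SpaceTimeCurve k T} {A : ℝ} (hA : 0 ≤ A)
    {Y₁ Y₂ : ℝ → Space n} (hY₁ : Solves (systemField f G) g₁.natParam A Y₁)
    (hY₂ : Solves (systemField f G) g₂.natParam A Y₂) :
    |(∫ σ in (0 : ℝ)..A, ‖deriv (lift g₁.natParam Y₁) σ‖) -
        ∫ σ in (0 : ℝ)..A, ‖deriv (lift g₂.natParam Y₂) σ‖| ≤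
      (∫ σ in (0 : ℝ)..A, ‖deriv g₁.natParam σ - deriv g₂.natParam σ‖) +
        ∫ σ in (0 : ℝ)..A, ‖deriv Y₁ σ - deriv Y₂ σ‖ := by
  have i1 := (intervalIntegrable_deriv hA (ac_lift hY₁)).norm
  have i2 := (intervalIntegrable_deriv hA (ac_lift hY₂)).norm
  have i3 := ((g₁.intervalIntegrable_deriv_natParam 0 A).sub
    (g₂.intervalIntegrable_deriv_natParam 0 A)).norm
  have i4 := ((intervalIntegrable_deriv hA hY₁.ac).sub (intervalIntegrable_deriv hA hY₂.ac)).norm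
  have hd : ∀ (g : SpaceTimeCurve k T) {Y : ℝ → Space n}, Solves (systemField f G) g.natParam A Y →
      ∀ᵐ σ ∂volume.restrict (Ioc 0 A), deriv (lift g.natParam Y) σ =
        WithLp.toLp 2 ((deriv g.natParam σ).fst, deriv Y σ) := by
    intro g Y hY
    filter_upwards [ae_restrict_of_ae g.ae_differentiableAt_natParam,
      ae_restrict_of_ae_restrict_of_subset Ioc_subset_Icc_self hY.ae_hasDerivAt] with σ h1 h2
    have := (hasDerivAt_toLp (hasDerivAt_fst h1.hasDerivAt) h2).deriv
    rw [h2.deriv]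
    exact this
  rw [← intervalIntegral.integral_sub i1 i2, ← intervalIntegral.integral_add i3 i4,
    ← Real.norm_eq_abs]
  refine intervalIntegral.norm_integral_le_of_norm_le hA ?_ (i3.add i4)
  have h1 := hd g₁ hY₁
  have h2 := hd g₂ hY₂
  rw [ae_restrict_iff' measurableSet_Ioc] at h1 h2
  filter_upwards [h1, h2] with σ e1 e2 hσ
  rw [e1 hσ, e2 hσ]
  refine (abs_norm_sub_norm_le _ _).trans ?_
  rw [← dist_eq_norm, ← dist_eq_norm, ← dist_eq_norm]
  exact (dist_toLp_le _ _ _ _).trans (add_le_add (dist_fst_le _ _) le_rfl)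

theorem dist_natParam_le {g₁ g₂ : SpaceTimeCurve k T} {A σ : ℝ} (hσ : σ ∈ Icc 0 A) :
    dist (g₁.natParam σ) (g₂.natParam σ) ≤ dist (g₁.natParam 0) (g₂.natParam 0) +
      ∫ r in (0 : ℝ)..A, ‖deriv g₁.natParam r - deriv g₂.natParam r‖ := by
  have hA : 0 ≤ A := hσ.1.trans hσ.2
  have h0 : (0 : ℝ) ∈ Icc 0 A := ⟨le_rfl, hA⟩
  have i := fun a b : ℝ => (g₁.intervalIntegrable_deriv_natParam a b).sub
    (g₂.intervalIntegrable_deriv_natParam a b)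
  have e : g₁.natParam σ - g₂.natParam σ = (g₁.natParam 0 - g₂.natParam 0) +
      ∫ r in (0 : ℝ)..σ, (deriv g₁.natParam r - deriv g₂.natParam r) := by
    rw [intervalIntegral.integral_sub (g₁.intervalIntegrable_deriv_natParam _ _)
      (g₂.intervalIntegrable_deriv_natParam _ _), integral_deriv_eq_sub hA (g₁.ac_natParam A) h0 hσ,
      integral_deriv_eq_sub hA (g₂.ac_natParam A) h0 hσ]
    abel
  rw [dist_eq_norm, dist_eq_norm, e]
  refine (norm_add_le _ _).trans (add_le_add le_rfl ?_)
  refine (intervalIntegral.norm_integral_le_integral_norm hσ.1).trans ?_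
  exact intervalIntegral.integral_mono_interval le_rfl hσ.1 hσ.2
    (Eventually.of_forall fun _ => norm_nonneg _) (i 0 A).norm

theorem exists_length_le {g : SpaceTimeCurve k T} {gs : ℕ → SpaceTimeCurve k T}
    (hgs : Tendsto (fun j => (gs j).cls) atTop (𝓝 g.cls)) :
    ∃ A, g.length ≤ A ∧ ∀ j, (gs j).length ≤ A := by
  obtain ⟨B, hB⟩ := (SpaceTimeCurve.tendsto_length hgs).bddAbove_range
  exact ⟨max g.length B, le_max_left _ _, fun j =>
    (hB (mem_range_self j)).trans (le_max_right _ _)⟩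

theorem IsGeneralizedTrajectory.eventually_exists (hF : LocallyLipschitz (systemField f G))
    (hT : 0 ≤ T) {g : SpaceTimeCurve k T} {gs : ℕ → SpaceTimeCurve k T}
    (hgs : Tendsto (fun j => (gs j).cls) atTop (𝓝 g.cls)) {h : SpaceTimeCurve n T}
    (H : IsGeneralizedTrajectory f G x₀ g h) :
    ∀ᶠ j in atTop, ∃ h', IsGeneralizedTrajectory f G x₀ (gs j) h' := by
  obtain ⟨A, hA, hAs⟩ := exists_length_le hgs
  obtain ⟨y, hy, hy0, -⟩ := H.exists_solves_natParam hF
  obtain ⟨Y, Ys, -, -, hYs, -⟩ := SpaceTimeCurve.exists_solves_tendsto hF hgs hy hA hAs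
  filter_upwards [hYs] with j hj
  refine ⟨_, isGeneralizedTrajectory_withSpace hT
    (SpaceTimeCurve.solves_comp_arc hF (hj.1.mono (gs j).length_nonneg (hAs j))) ?_⟩
  rw [(gs j).arc_zero, hj.2, hy0]

/-- The generalized trajectory depends continuously on the generalized control. Uniform convergence
of the lifted natural parameterizations bounds `d_T`, and convergence of their velocities in `L¹`
gives convergence of the lengths. -/
theorem IsGeneralizedTrajectory.tendsto (hF : LocallyLipschitz (systemField f G))
    {g : SpaceTimeCurve k T} {gs : ℕ → SpaceTimeCurve k T}
    (hgs : Tendsto (fun j => (gs j).cls) atTop (𝓝 g.cls)) {h : SpaceTimeCurve n T}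
    {hs : ℕ → SpaceTimeCurve n T} (H : IsGeneralizedTrajectory f G x₀ g h)
    (Hs : ∀ j, IsGeneralizedTrajectory f G x₀ (gs j) (hs j)) :
    Tendsto (fun j => (hs j).cls) atTop (𝓝 h.cls) := by
  obtain ⟨A, hA, hAs⟩ := exists_length_le hgs
  have hA0 := g.length_nonneg.trans hA
  obtain ⟨y, hy, hy0, -⟩ := H.exists_solves_natParam hF
  obtain ⟨Y, Ys, hY, hY0, hYs, ⟨δ, hδ, hYδ⟩, hYd⟩ :=
    SpaceTimeCurve.exists_solves_tendsto hF hgs hy hA hAs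
  rw [hy0] at hY0 hYs
  have hD := SpaceTimeCurve.tendsto_integral_deriv_natParam hgs hA hAs
  have hL := tendsto_iff_dist_tendsto_zero.1 (SpaceTimeCurve.tendsto_length hgs)
  have h0 := tendsto_iff_dist_tendsto_zero.1
    (SpaceTimeCurve.tendsto_natParam hgs ⟨le_rfl, g.length_nonneg⟩)
  -- the estimate of the Fréchet distance needs a Lipschitz constant for the limit curve only
  obtain ⟨C, M, hM⟩ := SpaceTimeCurve.incrementEstimate_natParam hF hA0 hY
  have hlip : ∀ σ ∈ Icc 0 A, ∀ τ ∈ Icc 0 A,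
      dist (lift g.natParam Y σ) (lift g.natParam Y τ) ≤ (1 + |M|) * |σ - τ| := by
    intro σ hσ τ hτ
    wlog hστ : σ ≤ τ generalizing σ τ
    · rw [dist_comm, abs_sub_comm]
      exact this τ hτ σ hσ (le_of_not_ge hστ)
    refine (dist_toLp_le _ _ _ _).trans ?_
    have e1 := (dist_fst_le _ _).trans (g.lipschitzWith_natParam.dist_le_mul σ τ)
    have e2 := (hM σ hσ τ hτ hστ).1
    rw [NNReal.coe_one, one_mul, Real.dist_eq] at e1
    rw [dist_comm (Y σ), dist_eq_norm, add_mul, one_mul]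
    refine add_le_add e1 (e2.trans ?_)
    rw [abs_sub_comm σ, abs_of_nonneg (sub_nonneg.2 hστ)]
    exact mul_le_mul_of_nonneg_right (le_abs_self M) (sub_nonneg.2 hστ)
  rw [tendsto_iff_dist_tendsto_zero]
  have hbound : Tendsto (fun j =>
      ((dist ((gs j).natParam 0) (g.natParam 0) +
        ∫ r in (0 : ℝ)..A, ‖deriv (gs j).natParam r - deriv g.natParam r‖) + δ j +
        (1 + |M|) * dist (gs j).length g.length) +
      ((∫ r in (0 : ℝ)..A, ‖deriv (gs j).natParam r - deriv g.natParam r‖) +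
        ∫ r in (0 : ℝ)..A, ‖deriv (Ys j) r - deriv Y r‖)) atTop (𝓝 0) := by
    simpa using (((h0.add hD).add hδ).add (hL.const_mul (1 + |M|))).add (hD.add hYd)
  refine squeeze_zero' (Eventually.of_forall fun _ => dist_nonneg) ?_ hbound
  filter_upwards [hYs] with j hj
  rw [dist_cls]
  refine add_le_add ?_ ?_
  · refine ENNReal.toReal_le_of_le_ofReal ?_ ?_
    · have hδ0 : 0 ≤ δ j := (norm_nonneg _).trans (hYδ j 0 ⟨le_rfl, hA0⟩)
      have := intervalIntegral.integral_nonneg hA0 (μ := volume)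
        fun r _ => norm_nonneg (deriv (gs j).natParam r - deriv g.natParam r)
      positivity
    rw [frechetDist_congr ((Hs j).trunc_eq_lift hF (hAs j) hj.1 hj.2)
      (H.trunc_eq_lift hF hA hY hY0), Real.dist_eq]
    refine frechetDist_comp_arc_le (gs j) g (by positivity) (fun σ hσ => ?_)
      fun σ hσ τ hτ => hlip σ ⟨hσ.1, hσ.2.trans (hAs j)⟩ τ ⟨hτ.1, hτ.2.trans hA⟩
    have hσA : σ ∈ Icc 0 A := ⟨hσ.1, hσ.2.trans (hAs j)⟩
    refine (dist_toLp_le _ _ _ _).trans (add_le_add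
      ((dist_fst_le _ _).trans (dist_natParam_le hσA)) ?_)
    rw [dist_eq_norm]
    exact hYδ j σ hσA
  · rw [(Hs j).length_eq hF (hAs j) hj.1 hj.2, H.length_eq hF hA hY hY0]
    exact integral_norm_deriv_lift_sub_le hA0 hj.1 hY

end Trajectories

/-! ### Ordinary controls -/

section Ordinary

variable {n k : ℕ} {T : ℝ} {f : Space n → Space n} {G : Fin k → Space n → Space n} {x₀ : Space n}

theorem exitParam_graphCurve (hT : 0 ≤ T) {x : ℝ → Space n} (hx : LocallyAC x) :
    (graphCurve T x hx).exitParam = T :=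
  SpaceTimeCurve.exitParam_eq_of_forall_lt _ hT le_rfl fun _ ht => ht

theorem isReducedTrajectory_graphCurve_iff (hT : 0 ≤ T) {u : ℝ → Space k}
    (hu : LocallyIntegrableOn u (Ici 0)) {x : ℝ → Space n} :
    IsReducedTrajectory f G x₀ (graphCurve T _ (locallyAC_primitive hu)) x ↔
      AbsolutelyContinuousOnInterval x 0 T ∧ IsTrajectory f G x₀ T u x := by
  have hui : IntervalIntegrable u volume 0 T := by
    rw [intervalIntegrable_iff_integrableOn_Icc_of_le hT]
    exact hu.integrableOn_compact_subset (fun y hy => hy.1) isCompact_Icc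
  have hd : ∀ᵐ t ∂volume.restrict (Icc 0 T),
      deriv (fun s => ∫ r in (0 : ℝ)..s, u r) t = u t := by
    rw [ae_restrict_iff' measurableSet_Icc]
    filter_upwards [hui.ae_hasDerivAt_integral] with t ht htm
    rw [← uIcc_of_le hT] at htm
    exact (ht htm 0 (by simp)).deriv
  have he : ∀ t, deriv (fun s => ∫ r in (0 : ℝ)..s, u r) t = u t →
      deriv (fun s => ((graphCurve T _ (locallyAC_primitive hu)).toFun s).fst) t • f (x t) +
        ∑ i, deriv (fun s => ((graphCurve T _ (locallyAC_primitive hu)).toFun s).snd) t i •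
          G i (x t) = f (x t) + ∑ i, u t i • G i (x t) := by
    intro t ht
    have h1 : deriv (fun s => ((graphCurve T _ (locallyAC_primitive hu)).toFun s).fst) t = 1 :=
      deriv_id t
    have h2 : deriv (fun s => ((graphCurve T _ (locallyAC_primitive hu)).toFun s).snd) t = u t := ht
    rw [h1, h2, one_smul]
  rw [IsReducedTrajectory, IsTrajectory, exitParam_graphCurve hT]
  refine and_congr_right fun _ => and_congr_right fun _ => ⟨fun h => ?_, fun h => ?_⟩
  · filter_upwards [h, hd] with t h1 h2
    rwa [he t h2] at h1
  · filter_upwards [h, hd] with t h1 h2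
    rwa [he t h2]

theorem isGeneralizedTrajectory_graphCurve (hT : 0 ≤ T) {u : ℝ → Space k}
    (hu : LocallyIntegrableOn u (Ici 0)) {x : ℝ → Space n}
    (hx : AbsolutelyContinuousOnInterval x 0 T) (h : IsTrajectory f G x₀ T u x) :
    IsGeneralizedTrajectory f G x₀ (graphCurve T _ (locallyAC_primitive hu))
      (graphCurve T _ (locallyAC_stop hT hx)) := by
  refine ⟨by rw [exitParam_graphCurve hT, exitParam_graphCurve hT], fun t _ => rfl, ?_⟩
  obtain ⟨h1, h2⟩ := isReducedTrajectory_iff.1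
    ((isReducedTrajectory_graphCurve_iff hT hu).2 ⟨hx, h⟩)
  refine isReducedTrajectory_iff.2 ⟨h1.congr (SpaceTimeCurve.exitParam_nonneg _) fun t ht => ?_, ?_⟩
  · rw [exitParam_graphCurve hT] at ht
    show x t = x (min t T)
    rw [min_eq_left ht.2]
  · show x (min 0 T) = x₀
    rw [min_eq_left hT, h2]

/-- Every generalized control `(V, W)` with `W(0) = 0` is approximated by ordinary controls: on
`[0, V^#(T)]` the time `V` is replaced by the strictly increasing
`q(t) = (V(t) + e t) T / (T + e V^#(T))`, and the curve `(q, W)` is the graph of `W ∘ q⁻¹`. -/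
theorem exists_ordinaryControl_dist_le (hT : 0 < T) (g : SpaceTimeCurve k T)
    (hg : (g.toFun 0).snd = 0) {e : ℝ} (he : 0 < e) :
    ∃ (u : ℝ → Space k) (hu : LocallyIntegrableOn u (Ici 0)),
      dist (ordinaryControl T u hu).1 g.cls ≤ 3 * (e * g.exitParam) := by
  set S := g.exitParam with hS
  have hS0 : 0 ≤ S := g.exitParam_nonneg
  have hSm : S ∈ Icc 0 S := ⟨hS0, le_rfl⟩
  set V : ℝ → ℝ := fun t => (g.toFun t).fst with hV
  set W : ℝ → Space k := fun t => (g.toFun t).snd with hW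
  have hVac : LocallyAC V := fun b hb => absolutelyContinuousOnInterval_fst (g.locallyAC b hb)
  have hWac : LocallyAC W := fun b hb => absolutelyContinuousOnInterval_snd (g.locallyAC b hb)
  have hVS : V S = T := g.fst_exitParam hT.le
  have hVm : MonotoneOn V (Ici 0) := g.monotoneOn_fst
  have hV0 : V 0 = 0 := g.time_zero
  have hden : 0 < T + e * S := by positivity
  set c : ℝ := T / (T + e * S) with hc
  have hc0 : 0 < c := by positivity
  have hcT : c * (T + e * S) = T := by rw [hc]; field_simp
  have hc1 : c ≤ 1 := by
    rw [hc, div_le_one hden]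
    have := mul_nonneg he.le hS0
    linarith
  have hminm : MonotoneOn (fun t : ℝ => min t S) (Ici 0) := fun _ _ _ _ h => min_le_min_right _ h
  have hminmaps : MapsTo (fun t : ℝ => min t S) (Ici 0) (Ici 0) := fun t ht => (g.min_mem ht).1
  set q : ℝ → ℝ := fun t => c * (V (min t S) + e * t) with hq
  have hqac : LocallyAC q := fun b hb =>
    (((hVac.comp_monotone (locallyAC_min_const S) hminm hminmaps).add_mul e) b hb).const_mul c
  have hqr : IsReparam q := by
    refine isReparam_of_le_sub (e := c * e) (mul_pos hc0 he) hqac ?_ fun a b ha hab => ?_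
    · simp [hq, min_eq_left hS0, hV0]
    · have h1 := hVm (hminmaps ha) (hminmaps (ha.trans hab : 0 ≤ b)) (min_le_min_right S hab)
      have h2 := mul_le_mul_of_nonneg_left h1 hc0.le
      have e1 : q b - q a = c * V (min b S) - c * V (min a S) + c * e * (b - a) := by
        rw [hq]; ring
      simp only at h2
      linarith
  have hqS : q S = T := by simp only [hq]; rw [min_self, hVS, hcT]
  obtain ⟨β, hβ, hinv⟩ := hqr.exists_inv
  set U : ℝ → Space k := fun t => W (β t) with hU
  have hUac : LocallyAC U := hWac.comp_monotone hβ.2.2.1 hβ.1 hβ.2.1.mapsTo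
  have hU0 : U 0 = 0 := by rw [hU]; simp only; rw [hβ.map_zero]; exact hg
  have hUint : ∀ t, 0 ≤ t → ∫ r in (0 : ℝ)..t, deriv U r = U t := fun t ht => by
    rw [integral_deriv_eq_sub ht (hUac t ht) ⟨le_rfl, ht⟩ ⟨ht, le_rfl⟩, hU0, sub_zero]
  have hu : LocallyIntegrableOn (deriv U) (Ici 0) := by
    rw [locallyIntegrableOn_iff isClosed_Ici.isLocallyClosed]
    intro C hC hCc
    obtain ⟨b, hb⟩ := hCc.bddAbove
    have hb0 : 0 ≤ max b 0 := le_max_right _ _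
    have := intervalIntegrable_deriv hb0 (hUac _ hb0)
    rw [intervalIntegrable_iff_integrableOn_Icc_of_le hb0] at this
    exact this.mono_set fun x hx => ⟨hC hx, (hb hx).trans (le_max_left _ _)⟩
  refine ⟨deriv U, hu, ?_⟩
  set γ : SpaceTimeCurve k T := graphCurve T _ (locallyAC_primitive hu) with hγ
  have hγT : γ.exitParam = T := exitParam_graphCurve hT.le _
  set P : ℝ → SpaceTime k := fun t => WithLp.toLp 2 (q t, W t) with hP
  have hγq : ∀ t, 0 ≤ t → γ.trunc (q t) = P (min t S) := by
    intro t ht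
    have hm := g.min_mem ht
    have e1 : min (q t) T = q (min t S) := by
      rw [← hqS]
      exact (hqr.1.map_min ht hS0).symm
    have e2 : ∫ r in (0 : ℝ)..q (min t S), deriv U r = W (min t S) := by
      rw [hUint _ (hqr.nonneg hm.1)]
      exact congrArg W (hinv.1 hm.1)
    rw [SpaceTimeCurve.trunc, hγT, e1, hP]
    show (WithLp.toLp 2 (q (min t S), ∫ r in (0 : ℝ)..q (min t S), deriv U r) : SpaceTime k) = _
    rw [e2]
  have hqV : ∀ r ∈ Icc 0 S, q r - V r = c * e * r - (1 - c) * V r := by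
    intro r hr
    simp only [hq]
    rw [min_eq_left hr.2]
    ring
  -- `1 - c = c e S / T`
  have h1c : (1 - c) * T = c * e * S := by linear_combination -hcT
  show dist γ.cls g.cls ≤ _
  rw [dist_cls, SpaceTimeCurve.dT_comm]
  have hdT : SpaceTimeCurve.dT g γ ≤ e * S := by
    refine ENNReal.toReal_le_of_le_ofReal (by positivity) (frechetDist_le_of_dist_le hqr ?_)
    intro t ht
    have hm := g.min_mem ht
    rw [hγq t ht]
    have e1 : g.trunc t = WithLp.toLp 2 (V (min t S), W (min t S)) := rfl
    rw [e1]
    refine (dist_toLp_le _ _ _ _).trans ?_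
    rw [dist_self, add_zero, dist_comm, Real.dist_eq, hqV _ hm]
    have h2 : V (min t S) ≤ T := g.fst_le_of_le_exitParam hT.le hm
    have h3 : 0 ≤ V (min t S) := hV0 ▸ hVm self_mem_Ici hm.1 hm.1
    have h4 : 0 ≤ 1 - c := sub_nonneg.2 hc1
    have h5 := mul_le_mul_of_nonneg_left h2 h4
    have h6 := mul_nonneg h4 h3
    have h7 := mul_le_mul_of_nonneg_left hm.2 (mul_nonneg hc0.le he.le)
    have h8 := mul_nonneg (mul_nonneg hc0.le he.le) hm.1
    have h9 := mul_le_mul_of_nonneg_right hc1 (mul_nonneg he.le hS0)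
    rw [abs_le]
    constructor <;> linarith
  have hPac : AbsolutelyContinuousOnInterval P 0 S :=
    absolutelyContinuousOnInterval_toLp (hqac S hS0) (hWac S hS0)
  have hlen : γ.length = ∫ t in (0 : ℝ)..S, ‖deriv P t‖ := by
    have h1 := eVariationOn.comp_eq_of_monotoneOn γ.trunc q hqr.1
    rw [hqr.2.1.image_eq] at h1
    have h2 : eVariationOn (γ.trunc ∘ q) (Ici 0) =
        eVariationOn (P ∘ fun t : ℝ => min t S) (Ici 0) := eVariationOn.congr hγq
    have h3 := eVariationOn.comp_eq_of_monotoneOn P _ hminm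
    have himg : (fun t : ℝ => min t S) '' Ici 0 = Icc 0 S := by
      ext x
      constructor
      · rintro ⟨t, ht, rfl⟩
        exact g.min_mem ht
      · intro hx
        exact ⟨x, hx.1, min_eq_left hx.2⟩
    rw [himg] at h3
    rw [γ.length_eq_variation, ← h1, h2, h3, integral_norm_deriv_eq_variation hS0 hPac]
  have hlendiff : |γ.length - g.length| ≤ 2 * (e * S) := by
    have hVi : IntervalIntegrable (deriv V) volume 0 S := intervalIntegrable_deriv hS0 (hVac S hS0)
    have i3 : IntervalIntegrable (fun t => c * e + (1 - c) * deriv V t) volume 0 S :=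
      intervalIntegrable_const.add (hVi.const_mul _)
    rw [hlen, SpaceTimeCurve.length, ← intervalIntegral.integral_sub
      (intervalIntegrable_deriv hS0 hPac).norm (intervalIntegrable_deriv hS0 g.ac).norm,
      ← Real.norm_eq_abs]
    have hpt : ∀ᵐ t ∂volume.restrict (Ioo 0 S),
        ‖‖deriv P t‖ - ‖deriv g.toFun t‖‖ ≤ c * e + (1 - c) * deriv V t := by
      have h1 : ∀ᵐ t ∂volume.restrict (Ioo 0 S), 0 ≤ deriv V t :=
        ae_restrict_of_ae_restrict_of_subset (fun t ht => ht.1.le) g.deriv_time_nonneg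
      have h2 : ∀ᵐ t ∂volume.restrict (Ioo 0 S), DifferentiableAt ℝ g.toFun t :=
        ae_restrict_of_ae_restrict_of_subset (fun t ht => ht.1.le)
          (ae_differentiableAt_of_locallyAC g.locallyAC)
      filter_upwards [h1, h2, ae_restrict_mem measurableSet_Ioo] with t hv hd ht
      have d1 := hasDerivAt_fst hd.hasDerivAt
      have d2 := hasDerivAt_snd hd.hasDerivAt
      have dq : HasDerivAt q (c * ((deriv g.toFun t).fst + e * 1)) t := by
        refine ((d1.add ((hasDerivAt_id t).const_mul e)).const_mul c).congr_of_eventuallyEq ?_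
        filter_upwards [Iio_mem_nhds ht.2] with r hr
        simp only [hq]
        rw [min_eq_left (le_of_lt hr)]
        rfl
      have dP : deriv P t = WithLp.toLp 2 (c * ((deriv g.toFun t).fst + e * 1),
          (deriv g.toFun t).snd) := (hasDerivAt_toLp dq d2).deriv
      have dV : deriv V t = (deriv g.toFun t).fst := d1.deriv
      rw [dV] at hv ⊢
      refine (abs_norm_sub_norm_le _ _).trans ?_
      rw [← dist_eq_norm, dP]
      refine (dist_toLp_le _ (deriv g.toFun t).fst _ (deriv g.toFun t).snd).trans ?_
      rw [dist_self, add_zero, Real.dist_eq]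
      have h4 := mul_nonneg (sub_nonneg.2 hc1) hv
      have h5 := mul_pos hc0 he
      rw [abs_le]
      constructor <;> linarith
    refine (intervalIntegral.norm_integral_le_of_norm_le (g := fun t => c * e + (1 - c) * deriv V t)
      hS0 ?_ i3).trans ?_
    · rw [restrict_Ioo_eq_restrict_Ioc, ae_restrict_iff' measurableSet_Ioc] at hpt
      exact hpt
    · rw [intervalIntegral.integral_add intervalIntegrable_const (hVi.const_mul _),
        intervalIntegral.integral_const, intervalIntegral.integral_const_mul,
        integral_deriv_eq_sub hS0 (hVac S hS0) ⟨le_rfl, hS0⟩ hSm, hVS, hV0, sub_zero, sub_zero, h1c,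
        smul_eq_mul]
      have h9 := mul_le_mul_of_nonneg_right hc1 (mul_nonneg he.le hS0)
      linarith
  linarith

theorem dense_ordinaryControl (hT : 0 < T) :
    Dense {c : GeneralizedControl k T | ∃ u hu, ordinaryControl T u hu = c} := by
  rintro ⟨_, g, rfl, hg⟩
  rw [Metric.mem_closure_iff]
  intro ε hε
  have hS := g.exitParam_nonneg
  obtain ⟨u, hu, h⟩ := exists_ordinaryControl_dist_le hT g hg
    (e := ε / (3 * (g.exitParam + 1))) (by positivity)
  refine ⟨_, ⟨u, hu, rfl⟩, ?_⟩
  rw [dist_comm]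
  refine lt_of_le_of_lt h ?_
  have : 3 * (ε / (3 * (g.exitParam + 1)) * g.exitParam) =
      ε * (g.exitParam / (g.exitParam + 1)) := by field_simp
  rw [this]
  exact mul_lt_of_lt_one_right hε ((div_lt_one (by linarith)).2 (lt_add_one _))

end Ordinary

/-! ### The generalized input-to-trajectory map -/

section Map

variable {n k : ℕ} {T : ℝ} {f : Space n → Space n} {G : Fin k → Space n → Space n} {x₀ : Space n}

theorem exists_cls_eq (c : FrechetSpace n T) : ∃ g : SpaceTimeCurve n T, g.cls = c :=
  Quotient.exists_rep c

theorem isOpen_admissibleControls (hF : LocallyLipschitz (systemField f G)) (hT : 0 ≤ T) :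
    IsOpen (admissibleControls f G x₀ T) := by
  rw [← isClosed_compl_iff]
  refine IsSeqClosed.isClosed fun cs c hcs hlim hc => ?_
  obtain ⟨g, h, hgc, H⟩ := hc
  choose gs hgs using fun j => exists_cls_eq (cs j).1
  have hlim' : Tendsto (fun j => (gs j).cls) atTop (𝓝 g.cls) := by
    rw [hgc]
    simp_rw [hgs]
    exact (continuous_subtype_val.tendsto c).comp hlim
  obtain ⟨j, h', H'⟩ := (H.eventually_exists hF hT hlim').exists
  exact hcs j ⟨gs j, h', hgs j, H'⟩

/-- A trajectory along one parameterization yields trajectories along all equivalent ones: a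
constant sequence converges to every parameterization of the same curve. -/
theorem IsGeneralizedTrajectory.exists_of_cls_eq (hF : LocallyLipschitz (systemField f G))
    (hT : 0 ≤ T) {g g' : SpaceTimeCurve k T} (hgg' : g'.cls = g.cls) {h : SpaceTimeCurve n T}
    (H : IsGeneralizedTrajectory f G x₀ g h) : ∃ h', IsGeneralizedTrajectory f G x₀ g' h' := by
  have hlim : Tendsto (fun _ : ℕ => g'.cls) atTop (𝓝 g.cls) := hgg' ▸ tendsto_const_nhds
  exact (H.eventually_exists hF hT (gs := fun _ => g') hlim).exists.choose_spec

theorem IsGeneralizedTrajectory.cls_eq (hF : LocallyLipschitz (systemField f G))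
    {g g' : SpaceTimeCurve k T} (hgg' : g'.cls = g.cls) {h h' : SpaceTimeCurve n T}
    (H : IsGeneralizedTrajectory f G x₀ g h) (H' : IsGeneralizedTrajectory f G x₀ g' h') :
    h'.cls = h.cls := by
  have hlim : Tendsto (fun _ : ℕ => g'.cls) atTop (𝓝 g.cls) := hgg' ▸ tendsto_const_nhds
  exact tendsto_nhds_unique tendsto_const_nhds
    (H.tendsto hF (gs := fun _ => g') (hs := fun _ => h') hlim fun _ => H')

theorem eq_of_extendsInputToTrajectory (hF : LocallyLipschitz (systemField f G)) (hT : 0 < T)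
    {Φ Ψ : admissibleControls f G x₀ T → FrechetSpace n T}
    (hΦ : ExtendsInputToTrajectory f G x₀ hT.le (admissibleControls f G x₀ T) Φ)
    (hΨ : ExtendsInputToTrajectory f G x₀ hT.le (admissibleControls f G x₀ T) Ψ)
    (hΦc : Continuous Φ) (hΨc : Continuous Ψ) : Ψ = Φ := by
  refine hΨc.ext_on ((dense_ordinaryControl hT).preimage
    (isOpen_admissibleControls hF hT.le).isOpenMap_subtype_val) hΦc ?_
  rintro ⟨_, hc⟩ ⟨u, hu, rfl⟩
  obtain ⟨g, h, hg, H⟩ := hc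
  obtain ⟨h', H'⟩ := H.exists_of_cls_eq hF hT.le
    (g' := graphCurve T _ (locallyAC_primitive hu)) hg.symm
  obtain ⟨hx, hx'⟩ := (isReducedTrajectory_graphCurve_iff hT.le hu).1 H'.2.2
  obtain ⟨_, e1⟩ := hΦ u hu _ hx hx'
  obtain ⟨_, e2⟩ := hΨ u hu _ hx hx'
  exact e2.trans e1.symm

end Map

end FrechetCurves

theorem mainTheorem1 {n k : ℕ} (f : Space n → Space n) (G : Fin k → Space n → Space n)
    (hf : LocallyLipschitz f) (hG : ∀ i, LocallyLipschitz (G i)) (x₀ : Space n)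
    {T : ℝ} (hT : 0 < T) :
    IsOpen (admissibleControls f G x₀ T) ∧
    ∃ Φ : admissibleControls f G x₀ T → FrechetSpace n T,
      -- `Φ` is the map `[(V, W)] ↦ [(V, y_{(v, w)})]`, for every choice of the representative:
      (∀ (c : admissibleControls f G x₀ T) (g : SpaceTimeCurve k T), g.cls = c.1.1 →
        (∃ h : SpaceTimeCurve n T, IsGeneralizedTrajectory f G x₀ g h) ∧
        ∀ h : SpaceTimeCurve n T, IsGeneralizedTrajectory f G x₀ g h → Φ c = h.cls) ∧
      ExtendsInputToTrajectory f G x₀ hT.le (admissibleControls f G x₀ T) Φ ∧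
      Continuous Φ ∧
      ∀ Ψ : admissibleControls f G x₀ T → FrechetSpace n T,
        ExtendsInputToTrajectory f G x₀ hT.le (admissibleControls f G x₀ T) Ψ →
        Continuous Ψ → Ψ = Φ := by
  have hF := locallyLipschitz_systemField hf hG
  choose g h hg H using fun c : admissibleControls f G x₀ T => c.2
  have hwd : ∀ (c : admissibleControls f G x₀ T) (g' : SpaceTimeCurve k T), g'.cls = c.1.1 →
      (∃ h' : SpaceTimeCurve n T, IsGeneralizedTrajectory f G x₀ g' h') ∧
        ∀ h' : SpaceTimeCurve n T, IsGeneralizedTrajectory f G x₀ g' h' → (h c).cls = h'.cls :=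
    fun c g' hg' => ⟨(H c).exists_of_cls_eq hF hT.le (hg'.trans (hg c).symm),
      fun h' H' => ((H c).cls_eq hF (hg'.trans (hg c).symm) H').symm⟩
  have hext : ExtendsInputToTrajectory f G x₀ hT.le (admissibleControls f G x₀ T)
      fun c => (h c).cls := by
    intro u hu x hx hux
    have H' := isGeneralizedTrajectory_graphCurve hT.le hu hx hux
    exact ⟨⟨_, _, rfl, H'⟩, (hwd _ _ rfl).2 _ H'⟩
  have hcont : Continuous fun c : admissibleControls f G x₀ T => (h c).cls := by
    refine SeqContinuous.continuous fun cs c hlim => ?_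
    refine (H c).tendsto hF (gs := fun j => g (cs j)) (hs := fun j => h (cs j)) ?_ fun j => H (cs j)
    simp_rw [hg]
    exact ((continuous_subtype_val.comp continuous_subtype_val).tendsto c).comp hlim
  exact ⟨isOpen_admissibleControls hF hT.le, _, hwd, hext, hcont, fun Ψ hΨ hΨc =>
    eq_of_extendsInputToTrajectory hF hT hext hΨ hcont hΨc⟩
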